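/- **Model.** Let $d\ge 2$ and let $X=\mu+r\,W\,U_\Omega$ be a random vector of $\mathbb R^d$, where $\mu\in\mathbb R^d$, $r>0$, $W$ is a positive real random variable with atomless law (and with a bounded density if $d=2$), $U_\Omega$ is uniformly distributed, with respect to the surface measure, on a measurable subset $\Omega$ of positive surface measure of the unit sphere of $\mathbb R^d$, and $W$ and $U_\Omega$ are independent. Put $r^\star=r\,\mathbb E[W]$ and $\theta=(\mu,r^\star)\in\mathbb R^d\times\mathbb R$, and endow $\mathbb R^d\times\mathbb R$ with the Euclidean norm of $\mathbb R^{d+1}$. For $x\in\mathbb R^d$ and $y=(z,a)\in\mathbb R^d\times\mathbb R$ put $$\nabla_y g(x,y):=\begin{pmatrix} z-x-a\,\dfrac{z-x}{\|z-x\|}\\ a-\|z-x\|\end{pmatrix}$$ (the gradient in $y$ of $\tfrac12(\|x-z\|-a)^2$; the quotient is read as $0$ if $z=x$), and $$\Gamma(z):=\mathbb E\Big[\tfrac1{\|X-z\|}\Big(I_d-\tfrac{(X-z)(X-z)^T}{\|X-z\|^2}\Big)\Big],\qquad \Gamma_\theta:=\begin{pmatrix} I_d-r^\star\,\Gamma(\mu)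 & \mathbb E\Big[\tfrac{X-\mu}{\|X-\mu\|}\Big]\\ \mathbb E\Big[\tfrac{X-\mu}{\|X-\mu\|}\Big]^T & 1\end{pmatrix},$$ the latter being the Hessian at $\theta$ of $G(z,a)=\tfrac12\mathbb E[(\|X-z\|-a)^2]$. **Assumptions.** - [A1] $\mathbb E[\|X-\mu\|^{-2}]<\infty$. - [A2] $\mathbb E[\|X-\mu\|^{2}]<\infty$. - [A3] $R_\mu,R_r>0$ are constants such that, for some $A$ with $\|\mathbb E[U_\Omega]\|^2<A<1$, $$\sup_{\|z-\mu\|\le R_\mu}\lambda_{\max}(\Gamma(z))<\frac{1-\|\mathbb E[U_\Omega]\|^2/A}{r^\star+\frac32R_r},$$ where $\lambda_{\max}$ denotes the largest eigenvalue. - [A4] $\Gamma_\theta$ is positive definite. **Algorithm.** Let $\mathcal K\subset\mathbb R^d\times(0,\infty)$ be a compact convex set, contained in $\overline{\mathcal B(\mu,R_\mu)}\times\overline{\mathcal B(r^\star,R_r)}$, with $\theta$ in its interior. Let $\pi:\mathbb R^d\times\mathbb R\to\mathcal K$ be a Borel map with $\pi(y)=y$ for $y\in\mathcal K$ such that, for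 all $y,y'\in\mathbb R^d\times(0,\infty)$, $\|\pi(y)-\pi(y')\|\le\|y-y'\|$, and $\pi(y)\in\partial\mathcal K$ if $y\notin\mathcal K$. Let $(X_n)_{n\ge1}$ be i.i.d. random vectors with the law of $X$, let $\widehat\theta_1$ be a (possibly random) point of $\mathcal K$, independent of $(X_n)_{n\ge2}$, let $\gamma_n=c_\gamma n^{-\alpha}$ with $c_\gamma>0$ and $\alpha\in(1/2,1)$, and put, for $n\ge1$, $$\widehat\theta_{n+1}=\pi\big(\widehat\theta_n-\gamma_n\nabla_yg(X_{n+1},\widehat\theta_n)\big),\qquad \overline\theta_n=\frac1n\sum_{k=1}^n\widehat\theta_k .$$ **Theorem.** Assume [A1]–[A4] and $\mathbb E[\|X-\mu\|^{12}]<\infty$. Then $$\sqrt n\,(\overline\theta_n-\theta)\xrightarrow[n\to\infty]{\ \mathcal L\ }\mathcal N\big(0,\Gamma_\theta^{-1}\Sigma\,\Gamma_\theta^{-1}\big),\qquad \Sigma:=\mathbb E\big[\nabla_yg(X,\theta)\,\nabla_yg(X,\theta)^T\big],$$ where $\Gamma_\theta^{-1}\Sigma\,\Gamma_\theta^{-1}$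 is positive semidefinite. -/

import Mathlib

open MeasureTheory ProbabilityTheory Filter Metric

noncomputable section

namespace SphereFit

/-- The observation space `ℝ^d` with its Euclidean norm. -/
abbrev Pt (d : ℕ) : Type := EuclideanSpace ℝ (Fin d)

/-- The parameter space `ℝ^d × ℝ`, with the Euclidean norm of `ℝ^(d+1)`. The coordinates `Sum.inl i`
are those of the centre, the coordinate `Sum.inr ()` is the radius. -/
abbrev Par (d : ℕ) : Type := EuclideanSpace ℝ (Fin d ⊕ Unit)

/-- The parameter `(z, a)`. -/
def Par.mk {d : ℕ} (z : Pt d) (a : ℝ) : Par d :=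
  WithLp.toLp 2 (Sum.elim (fun i => z i) (fun _ => a))

/-- The centre `z` of `y = (z, a)`. -/
def Par.center {d : ℕ} (y : Par d) : Pt d := WithLp.toLp 2 (fun i => y (Sum.inl i))

/-- The radius `a` of `y = (z, a)`. -/
def Par.radius {d : ℕ} (y : Par d) : ℝ := y (Sum.inr ())

/-- The model `X = μ + r W U_S`: `r > 0`, `W` is a positive random variable with a continuous
(atomless) law, with a bounded density if `d = 2`, `U` is uniformly distributed (for the surface
measure) on the measurable subset `S` of the unit sphere, and `W` and `U` are independent. -/
structure IsTruncatedSphereModel {d : ℕ} {Ω₀ : Type*} [MeasurableSpace Ω₀] (P₀ : Measure Ω₀)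
    (X : Ω₀ → Pt d) (μ : Pt d) (r : ℝ) (W : Ω₀ → ℝ) (S : Set (sphere (0 : Pt d) 1))
    (U : Ω₀ → sphere (0 : Pt d) 1) : Prop where
  r_pos : 0 < r
  measurable_W : Measurable W
  measurable_U : Measurable U
  W_pos : ∀ᵐ ω ∂P₀, 0 < W ω
  W_continuous : ∀ w : ℝ, P₀ (W ⁻¹' {w}) = 0
  W_bounded_density : d = 2 → ∃ C : NNReal, P₀.map W ≤ C • (volume : Measure ℝ)
  measurableSet_S : MeasurableSet S
  U_uniform : pdf.IsUniform U S P₀ (volume : Measure (Pt d)).toSphere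
  indep : IndepFun W U P₀
  eq_X : ∀ ω, X ω = μ + (r * W ω) • (U ω : Pt d)

section Observation

variable {d : ℕ} {Ω₀ : Type*} [MeasurableSpace Ω₀]

/-- `r⋆ = r 𝔼[W]`. -/
def rStar (P₀ : Measure Ω₀) (r : ℝ) (W : Ω₀ → ℝ) : ℝ := r * ∫ ω, W ω ∂P₀

/-- The target `θ = (μ, r⋆)`. -/
def theta (P₀ : Measure Ω₀) (μ : Pt d) (r : ℝ) (W : Ω₀ → ℝ) : Par d := Par.mk μ (rStar P₀ r W)

/-- The gradient with respect to `y = (z, a)` of `(1/2) (‖x - z‖ - a)^2`, that is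
`(z - x - a (z - x) / ‖z - x‖, a - ‖z - x‖)`. -/
def gradG (x : Pt d) (y : Par d) : Par d :=
  Par.mk (y.center - x - (y.radius / ‖y.center - x‖) • (y.center - x))
    (y.radius - ‖y.center - x‖)

/-- `Γ(z) = 𝔼[‖X - z‖⁻¹ (I_d - (X - z)(X - z)ᵀ / ‖X - z‖²)]`, entry by entry. -/
def curvMatrix (P₀ : Measure Ω₀) (X : Ω₀ → Pt d) (z : Pt d) : Matrix (Fin d) (Fin d) ℝ :=
  Matrix.of fun i j =>
    ∫ ω, ‖X ω - z‖⁻¹ *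
      ((1 : Matrix (Fin d) (Fin d) ℝ) i j
        - (X ω i - z i) * (X ω j - z j) / ‖X ω - z‖ ^ 2) ∂P₀

/-- `𝔼[(X - μ) / ‖X - μ‖]` as a column. -/
def meanDirection (P₀ : Measure Ω₀) (X : Ω₀ → Pt d) (μ : Pt d) : Matrix (Fin d) Unit ℝ :=
  Matrix.of fun i _ => ∫ ω, (X ω i - μ i) / ‖X ω - μ‖ ∂P₀

/-- The Hessian `Γ_θ` at `θ = (μ, a)` of `G(y) = (1/2) 𝔼[(‖X - z‖ - a)^2]`. -/
def hessian (P₀ : Measure Ω₀) (X : Ω₀ → Pt d) (μ : Pt d) (a : ℝ) :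
    Matrix (Fin d ⊕ Unit) (Fin d ⊕ Unit) ℝ :=
  Matrix.fromBlocks (1 - a • curvMatrix P₀ X μ) (meanDirection P₀ X μ)
    (meanDirection P₀ X μ).transpose 1

/-- `Σ = 𝔼[v vᵀ]` with `v` the gradient at `y` for the observation `X`. -/
def gradCov (P₀ : Measure Ω₀) (X : Ω₀ → Pt d) (y : Par d) :
    Matrix (Fin d ⊕ Unit) (Fin d ⊕ Unit) ℝ :=
  Matrix.of fun i j => ∫ ω, gradG (X ω) y i * gradG (X ω) y j ∂P₀

/-- The asymptotic covariance `Γ_θ⁻¹ Σ Γ_θ⁻¹`. -/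
def limitCov (P₀ : Measure Ω₀) (X : Ω₀ → Pt d) (μ : Pt d) (r : ℝ) (W : Ω₀ → ℝ) :
    Matrix (Fin d ⊕ Unit) (Fin d ⊕ Unit) ℝ :=
  (hessian P₀ X μ (rStar P₀ r W))⁻¹ * gradCov P₀ X (theta P₀ μ r W)
    * (hessian P₀ X μ (rStar P₀ r W))⁻¹

/-- The largest (real) eigenvalue of a symmetric real matrix. -/
def lambdaMax (M : Matrix (Fin d) (Fin d) ℝ) : ℝ := sSup (spectrum ℝ M)

/-- [A1]: `𝔼[‖X - μ‖⁻²] < ∞`. -/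
def A1 (P₀ : Measure Ω₀) (X : Ω₀ → Pt d) (μ : Pt d) : Prop :=
  Integrable (fun ω => (‖X ω - μ‖ ^ 2)⁻¹) P₀

/-- [A2]: `𝔼[‖X - μ‖²] < ∞`. -/
def A2 (P₀ : Measure Ω₀) (X : Ω₀ → Pt d) (μ : Pt d) : Prop :=
  Integrable (fun ω => ‖X ω - μ‖ ^ 2) P₀

/-- [A3], with the constants `Rμ` and `Rr`; the supremum is taken in `[-∞, ∞]`. -/
def A3 (P₀ : Measure Ω₀) (X : Ω₀ → Pt d) (μ : Pt d) (r : ℝ) (W : Ω₀ → ℝ)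
    (U : Ω₀ → sphere (0 : Pt d) 1) (Rμ Rr : ℝ) : Prop :=
  0 < Rμ ∧ 0 < Rr ∧ ∃ A : ℝ, ‖∫ ω, (U ω : Pt d) ∂P₀‖ ^ 2 < A ∧ A < 1 ∧
    (⨆ z ∈ closedBall μ Rμ, (lambdaMax (curvMatrix P₀ X z) : EReal)) <
      (((1 - ‖∫ ω, (U ω : Pt d) ∂P₀‖ ^ 2 / A) / (rStar P₀ r W + 3 / 2 * Rr) : ℝ) : EReal)

/-- [A4]: the Hessian `Γ_θ` is positive definite. -/
def A4 (P₀ : Measure Ω₀) (X : Ω₀ → Pt d) (μ : Pt d) (r : ℝ) (W : Ω₀ → ℝ) : Prop :=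
  (hessian P₀ X μ (rStar P₀ r W)).PosDef

end Observation

/-- `π` is a projection onto `K`: it takes its values in `K`, fixes the points of `K`, and on
`ℝ^d × (0, ∞)` it is 1-Lipschitz and sends the points outside `K` to the frontier of `K`. Off
`ℝ^d × (0, ∞)` its values in `K` are arbitrary, subject only to measurability. -/
structure IsProjectionOnto {d : ℕ} (K : Set (Par d)) (π : Par d → Par d) : Prop where
  measurable : Measurable π
  mem : ∀ y, π y ∈ K
  fix : ∀ y ∈ K, π y = y
  nonexpansive : ∀ y y' : Par d, 0 < y.radius → 0 < y'.radius → ‖π y - π y'‖ ≤ ‖y - y'‖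
  frontier : ∀ y : Par d, 0 < y.radius → y ∉ K → π y ∈ frontier K

/-- The projected Robbins-Monro algorithm: `θ̂_1` is the given starting point and
`θ̂_{n+1} = π (θ̂_n - γ_n ∇g(X_{n+1}, θ̂_n))` for `n ≥ 1` (the value at index `0` plays no role). -/
def prm {d : ℕ} {Ω : Type*} (π : Par d → Par d) (γ : ℕ → ℝ) (X : ℕ → Ω → Pt d)
    (start : Ω → Par d) : ℕ → Ω → Par d
  | 0, ω => start ω
  | 1, ω => start ω
  | n + 2, ω =>
      π (prm π γ X start (n + 1) ω
        - γ (n + 1) • gradG (X (n + 2) ω) (prm π γ X start (n + 1) ω))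

/-- The averaged algorithm `θ̄_n = (1/n) ∑_{k=1}^n θ̂_k`. -/
def prmAvg {d : ℕ} {Ω : Type*} (π : Par d → Par d) (γ : ℕ → ℝ) (X : ℕ → Ω → Pt d)
    (start : Ω → Par d) (n : ℕ) (ω : Ω) : Par d :=
  (n : ℝ)⁻¹ • ∑ k ∈ Finset.Icc 1 n, prm π γ X start k ω

end SphereFit

end

/-!
The step gradient is `∇g(x, y)` with `y = (z, a)`, and `G(z, a) = 𝔼[(‖X - z‖ - a)²] / 2`. The proof
has a part about stochastic approximation, which knows nothing about spheres, and a part about `G`.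

**Stochastic approximation.** Let `g` be a random field, dominated in `L²` on the compact set `K`,
Lipschitz at `θ` with an `L²` constant, whose mean is strongly monotone at `θ` and is `A (y - θ)` up
to a quadratic error (`IsRegularField`). Since `π` is nonexpansive and fixes `θ`, strong
monotonicity gives `𝔼‖θ̂ₖ - θ‖² = O(k^{-α})` (`exists_integral_sq_error_le`). Solving one step for
the linear part writes `A (θ̂ₖ - θ) + g (Xₖ₊₁, θ)` as the sum of four terms (`linear_error_eq`), and
each of them, summed up to time `n`, is `o(√n)` in `L¹` (`tendsto_integral_norm_remainder`):
* the telescoping term `γₖ⁻¹ (θ̂ₖ - θ̂ₖ₊₁)`, by summation by parts;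
* the correction made by the projection, divided by `γₖ`; the correction vanishes unless the error
  or the increment exceeds a fixed threshold, `θ` being interior to `K`, and so is
  `O(γₖ 𝔼‖θ̂ₖ - θ‖² + γₖ²)`, that is `O(γₖ²)`, in `L¹`;
* the centred increments of the field between `θ` and `θ̂ₖ`, which are orthogonal in `L²`;
* the linearization error, which is `O(𝔼‖θ̂ₖ - θ‖²)`.

The second and the last sums are `O(∑ k^{-α}) = O(n^{1-α})`, which is where `α > 1/2` is needed.
Hence `√n (θ̄ₙ - θ)` is `-n^{-1/2} ∑ A⁻¹ g (Xₖ, θ)` up to a negligible term, and the multivariate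
central limit theorem concludes (`IsProjectedAlgorithm.tendstoInDistribution_average`).

**The loss `G`.** `X - μ` has direction `U` and length `r W`, and the two are independent, so
`𝔼[X - μ] = r⋆ 𝔼[U]` and `θ` is a critical point of `G`. Pointwise expansions of `v ↦ ‖v‖` and
`v ↦ v / ‖v‖` with remainders `‖h‖² ‖v‖⁻¹` and `‖h‖² ‖v‖⁻²` give, thanks to `𝔼‖X - μ‖⁻² < ∞`, both
the Lipschitz property and the linearization of the gradient, with the Hessian `Γ_θ` as linear part.

Strong monotonicity on `K` (`IsCentredLaw.exists_strongly_monotone`) comes from the exact formula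
`⟪∇G(μ + h, r⋆ + β), (h, β)⟫ = ‖h‖² + β² + 2 β ⟪𝔼[U], h⟫ - ∫₀¹ (r⋆ + β (2 - t)) hᵀ Γ(μ + t h) h dt`,
the bound on the largest eigenvalue of `Γ`, and `2 |β ⟪𝔼[U], h⟫| ≤ A β² + ‖𝔼[U]‖² ‖h‖² / A`. The
formula requires that almost no observation lies on the segment from `μ` to `μ + h`, and that
`x ↦ ‖x - z‖⁻¹` is integrable for almost all `z` on it. In dimension at least `2` both hold for
almost every `h`, by Fubini's theorem and the local integrability of `‖·‖⁻¹`; the inequality then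
extends to all `h` because `∇G` is continuous, the law of `X` having no atoms.
-/

set_option linter.unusedSectionVars false

noncomputable section

namespace SphereFit

/-! ### Real sequences with polynomial steps -/

lemma rpow_eq_div_rpow_mul (x p : ℝ) (k : ℕ) (hx : 0 ≤ x) :
    x ^ p = (x / ((k : ℝ) + 1)) ^ p * ((k : ℝ) + 1) ^ p := by
  have hk : (0 : ℝ) < (k : ℝ) + 1 := by positivity
  rw [← Real.mul_rpow (by positivity) hk.le, div_mul_cancel₀ _ hk.ne']

/-- Bernoulli's inequality at `-1 / (k + 1)`. -/
lemma mul_rpow_sub_one_le_rpow_sub {p : ℝ} (hp0 : 0 ≤ p) (hp1 : p ≤ 1) (k : ℕ) :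
    p * ((k : ℝ) + 1) ^ (p - 1) ≤ ((k : ℝ) + 1) ^ p - (k : ℝ) ^ p := by
  have hk : (0 : ℝ) < (k : ℝ) + 1 := by positivity
  have h1 : (1 + -((k : ℝ) + 1)⁻¹) ^ p ≤ 1 + p * -((k : ℝ) + 1)⁻¹ := by
    apply rpow_one_add_le_one_add_mul_self _ hp0 hp1
    rw [neg_le_neg_iff]
    exact inv_le_one_of_one_le₀ (by linarith [Nat.cast_nonneg (α := ℝ) k])
  have h2 : (k : ℝ) / ((k : ℝ) + 1) = 1 + -((k : ℝ) + 1)⁻¹ := by field_simp; ring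
  rw [rpow_eq_div_rpow_mul (k : ℝ) p k (by positivity), h2, Real.rpow_sub_one hk.ne']
  have h3 : 0 ≤ ((k : ℝ) + 1) ^ p := by positivity
  calc p * (((k : ℝ) + 1) ^ p / ((k : ℝ) + 1))
      = ((k : ℝ) + 1) ^ p - (1 + p * -((k : ℝ) + 1)⁻¹) * ((k : ℝ) + 1) ^ p := by
        field_simp; ring
    _ ≤ _ := by gcongr

lemma le_rpow_of_le_one {x p : ℝ} (hx0 : 0 ≤ x) (hx1 : x ≤ 1) (hp1 : p ≤ 1) :
    x ≤ x ^ p := by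
  rcases hx0.eq_or_lt with rfl | hx
  · positivity
  · simpa using Real.rpow_le_rpow_of_exponent_ge hx hx1 hp1

lemma rpow_sub_le_rpow_sub_one {p : ℝ} (hp1 : p ≤ 1) (k : ℕ) :
    ((k : ℝ) + 1) ^ p - (k : ℝ) ^ p ≤ ((k : ℝ) + 1) ^ (p - 1) := by
  have hk : (0 : ℝ) < (k : ℝ) + 1 := by positivity
  have h1 : (k : ℝ) / ((k : ℝ) + 1) ≤ ((k : ℝ) / ((k : ℝ) + 1)) ^ p :=
    le_rpow_of_le_one (by positivity) (by rw [div_le_one hk]; linarith) hp1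
  rw [rpow_eq_div_rpow_mul (k : ℝ) p k (by positivity), Real.rpow_sub_one hk.ne']
  have h3 : 0 ≤ ((k : ℝ) + 1) ^ p := by positivity
  calc _ ≤ ((k : ℝ) + 1) ^ p - (k : ℝ) / ((k : ℝ) + 1) * ((k : ℝ) + 1) ^ p := by gcongr
    _ = _ := by field_simp; ring

lemma sum_rpow_neg_le {s : ℝ} (hs0 : 0 ≤ s) (hs1 : s < 1) (n : ℕ) :
    ∑ k ∈ Finset.range n, ((k : ℝ) + 1) ^ (-s) ≤ (1 - s)⁻¹ * (n : ℝ) ^ (1 - s) := by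
  have hs : 0 < 1 - s := by linarith
  induction n with
  | zero => simp [Real.zero_rpow hs.ne']
  | succ n ih =>
    rw [Finset.sum_range_succ]
    have h := mul_rpow_sub_one_le_rpow_sub hs.le (by linarith) n
    have h2 : (1 - s) - 1 = -s := by ring
    rw [h2] at h
    have h3 : ((n : ℝ) + 1) ^ (-s) ≤ (1 - s)⁻¹ * (((n : ℝ) + 1) ^ (1 - s) - (n : ℝ) ^ (1 - s)) := by
      rw [inv_mul_eq_div, le_div_iff₀ hs]; linarith
    push_cast
    linarith [mul_sub (1 - s)⁻¹ (((n : ℝ) + 1) ^ (1 - s)) ((n : ℝ) ^ (1 - s))]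

/-- If `s > 1/2`, the partial sums of `(k + 1) ^ (-s)` are negligible before `√n`. -/
lemma tendsto_inv_sqrt_mul_sum_rpow_neg {s : ℝ} (hs0 : 1 / 2 < s) (hs1 : s < 1) :
    Tendsto (fun n : ℕ => (√n)⁻¹ * ∑ k ∈ Finset.range n, ((k : ℝ) + 1) ^ (-s)) atTop
      (nhds 0) := by
  have h1 : Tendsto (fun n : ℕ => (1 - s)⁻¹ * (n : ℝ) ^ (-(s - 1 / 2))) atTop (nhds 0) := by
    simpa using ((tendsto_rpow_neg_atTop (by linarith : 0 < s - 1 / 2)).comp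
      tendsto_natCast_atTop_atTop).const_mul (1 - s)⁻¹
  refine squeeze_zero' (Eventually.of_forall fun n => by positivity) ?_ h1
  filter_upwards [eventually_gt_atTop 0] with n hn
  have hn' : (0 : ℝ) < n := by exact_mod_cast hn
  calc _ ≤ (√n)⁻¹ * ((1 - s)⁻¹ * (n : ℝ) ^ (1 - s)) := by
        gcongr; exact sum_rpow_neg_le (by linarith) hs1 n
    _ = (1 - s)⁻¹ * ((n : ℝ) ^ (-(1 / 2) : ℝ) * (n : ℝ) ^ (1 - s)) := by
        rw [Real.sqrt_eq_rpow, Real.rpow_neg hn'.le]; ring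
    _ = _ := by rw [← Real.rpow_add hn']; congr 2; ring

/-- Summation by parts, for the weights `B (k + 1)` with `B 0 = 0`. -/
lemma sum_smul_sub_succ {E : Type*} [AddCommGroup E] [Module ℝ E] (B : ℕ → ℝ) (hB : B 0 = 0)
    (t : ℕ → E) (n : ℕ) :
    ∑ k ∈ Finset.range n, B (k + 1) • (t k - t (k + 1)) =
      ∑ k ∈ Finset.range n, (B (k + 1) - B k) • t k - B n • t n := by
  induction n with
  | zero => simp [hB]
  | succ n ih =>
    rw [Finset.sum_range_succ, Finset.sum_range_succ, ih]
    module

/-- An eventual bound by a multiple of a positive sequence can be made to hold from the start. -/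
lemma exists_le_mul_of_eventually {f r : ℕ → ℝ} (hr : ∀ k, 0 < r k)
    (h : ∃ C, ∀ᶠ k in atTop, f k ≤ C * r k) : ∃ C, 0 ≤ C ∧ ∀ k, f k ≤ C * r k := by
  obtain ⟨C, hC⟩ := h
  obtain ⟨N, hN⟩ := eventually_atTop.1 hC
  refine ⟨|C| + ∑ j ∈ Finset.range N, |f j| / r j, ?_, fun k => ?_⟩
  · have := fun j => (hr j).le
    have : 0 ≤ ∑ j ∈ Finset.range N, |f j| / r j :=
      Finset.sum_nonneg fun j _ => div_nonneg (abs_nonneg _) (this j)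
    positivity
  have hterm : ∀ j ∈ Finset.range N, 0 ≤ |f j| / r j :=
    fun j _ => div_nonneg (abs_nonneg _) (hr j).le
  rcases le_or_gt N k with hk | hk
  · refine (hN k hk).trans (mul_le_mul_of_nonneg_right ?_ (hr k).le)
    linarith [le_abs_self C, Finset.sum_nonneg hterm]
  · have h1 := Finset.single_le_sum hterm (Finset.mem_range.2 hk)
    calc f k ≤ |f k| := le_abs_self _
      _ = |f k| / r k * r k := by rw [div_mul_cancel₀ _ (hr k).ne']
      _ ≤ _ := mul_le_mul_of_nonneg_right (by linarith [abs_nonneg C]) (hr k).le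

lemma rpow_neg_sub_succ_le {α : ℝ} (h1 : α ≤ 1) (k : ℕ) :
    ((k : ℝ) + 1) ^ (-α) - ((k : ℝ) + 2) ^ (-α) ≤ ((k : ℝ) + 1) ^ (-α) * ((k : ℝ) + 1)⁻¹ := by
  have hk : (0 : ℝ) < (k : ℝ) + 1 := by positivity
  have hk2 : (0 : ℝ) < (k : ℝ) + 2 := by positivity
  have h := le_rpow_of_le_one (x := ((k : ℝ) + 1) / ((k : ℝ) + 2)) (by positivity)
    (by rw [div_le_one hk2]; linarith) h1
  rw [Real.div_rpow hk.le hk2.le] at h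
  have h2 : 1 - ((k : ℝ) + 1)⁻¹ ≤ ((k : ℝ) + 1) / ((k : ℝ) + 2) := by
    rw [← sub_nonneg]
    have : ((k : ℝ) + 1) / ((k : ℝ) + 2) - (1 - ((k : ℝ) + 1)⁻¹)
        = (((k : ℝ) + 1) * ((k : ℝ) + 2))⁻¹ := by field_simp; ring
    rw [this]; positivity
  rw [Real.rpow_neg hk.le, Real.rpow_neg hk2.le]
  have h3 := h2.trans h
  have h4 : 0 < ((k : ℝ) + 1) ^ α := by positivity
  have h5 := mul_le_mul_of_nonneg_right h3 (inv_nonneg.2 h4.le)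
  have h6 : ((k : ℝ) + 1) ^ α / ((k : ℝ) + 2) ^ α * (((k : ℝ) + 1) ^ α)⁻¹
      = (((k : ℝ) + 2) ^ α)⁻¹ := by field_simp
  rw [h6] at h5
  linarith

lemma tendsto_succ_rpow_neg {s : ℝ} (hs : 0 < s) :
    Tendsto (fun k : ℕ => ((k : ℝ) + 1) ^ (-s)) atTop (nhds 0) :=
  (tendsto_rpow_neg_atTop hs).comp
    (tendsto_atTop_add_const_right _ _ tendsto_natCast_atTop_atTop)

/-- The recursion `u (k+1) ≤ (1 - b a k) u k + C (a k)²` with steps `a k = c (k+1) ^ (-α)`,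
`α < 1`, forces `u k = O((k+1) ^ (-α))`: since `a k - a (k+1) = o((a k)²)`, a large multiple of the
step is a supersolution. -/
lemma recursion_bound {u : ℕ → ℝ} {c α b C : ℝ} (hc : 0 < c) (hα0 : 0 < α) (hα1 : α < 1)
    (hb : 0 < b) (hC : 0 ≤ C)
    (h : ∀ᶠ k : ℕ in atTop, u (k + 1) ≤
      (1 - b * (c * ((k : ℝ) + 1) ^ (-α))) * u k + C * (c * ((k : ℝ) + 1) ^ (-α)) ^ 2) :
    ∃ C', 0 ≤ C' ∧ ∀ k : ℕ, u k ≤ C' * ((k : ℝ) + 1) ^ (-α) := by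
  have hpos : ∀ k : ℕ, 0 < ((k : ℝ) + 1) ^ (-α) := fun k => by positivity
  refine exists_le_mul_of_eventually hpos ?_
  have e1 : ∀ᶠ k : ℕ in atTop, ((k : ℝ) + 1) ^ (-α) ≤ (b * c)⁻¹ :=
    (tendsto_succ_rpow_neg hα0).eventually_le_const (by positivity)
  have e2 : ∀ᶠ k : ℕ in atTop, ((k : ℝ) + 1) ^ (-(1 - α)) ≤ b * c / 2 :=
    (tendsto_succ_rpow_neg (by linarith)).eventually_le_const (by positivity)
  obtain ⟨N, hN⟩ := eventually_atTop.1 (h.and (e1.and e2))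
  -- `D` is large enough for `D a` to be a supersolution, and to dominate `u` at time `N`.
  set D := max (2 * C * c / b) (u N / ((N : ℝ) + 1) ^ (-α)) with hD
  refine ⟨D, eventually_atTop.2 ⟨N, fun k hk => ?_⟩⟩
  induction k, hk using Nat.le_induction with
  | base =>
    calc u N = u N / ((N : ℝ) + 1) ^ (-α) * ((N : ℝ) + 1) ^ (-α) := by
          rw [div_mul_cancel₀ _ (hpos N).ne']
      _ ≤ _ := mul_le_mul_of_nonneg_right (le_max_right _ _) (hpos N).le
  | succ k hk ih =>
    obtain ⟨g1, g2, g3⟩ := hN k hk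
    have hk0 : (0 : ℝ) < (k : ℝ) + 1 := by positivity
    set x := ((k : ℝ) + 1) ^ (-α) with hx
    have hx0 : 0 < x := hpos k
    -- the recursion is monotone in `u k` once `b a k ≤ 1`
    have hcoef : 0 ≤ 1 - b * (c * x) := by
      have := mul_le_mul_of_nonneg_left g2 (by positivity : 0 ≤ b * c)
      rw [mul_inv_cancel₀ (by positivity)] at this
      linarith
    have hdiff : x - ((k : ℝ) + 2) ^ (-α) ≤ b * c / 2 * x ^ 2 := by
      refine (rpow_neg_sub_succ_le hα1.le k).trans ?_
      have : ((k : ℝ) + 1)⁻¹ = ((k : ℝ) + 1) ^ (-(1 - α)) * x := by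
        rw [hx, ← Real.rpow_add hk0, ← Real.rpow_neg_one]; congr 1; ring
      rw [this]
      have : x * (((k : ℝ) + 1) ^ (-(1 - α)) * x) = ((k : ℝ) + 1) ^ (-(1 - α)) * x ^ 2 := by ring
      rw [this]
      gcongr
    have hDC : C * c ^ 2 ≤ D * (b * c / 2) := by
      have : 2 * C * c / b ≤ D := le_max_left _ _
      rw [div_le_iff₀ hb] at this
      nlinarith
    have hD0 : 0 ≤ D := le_trans (by positivity) (le_max_left _ _)
    have hcast : ((k + 1 : ℕ) : ℝ) + 1 = (k : ℝ) + 2 := by push_cast; ring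
    rw [hcast]
    have s1 := mul_le_mul_of_nonneg_left ih hcoef
    have s2 := mul_le_mul_of_nonneg_left hdiff hD0
    have s3 := mul_le_mul_of_nonneg_right hDC (sq_nonneg x)
    nlinarith

/-! ### Independence of the past and of the next observation -/

section Past

variable {Ω β β' 𝒳 : Type*} [MeasurableSpace β] [MeasurableSpace β'] [MeasurableSpace 𝒳]

/-- The starting point and the first `k` observations. -/
def past (start : Ω → β) (Y : ℕ → Ω → 𝒳) (k : ℕ) (ω : Ω) : β × (Finset.range k → 𝒳) :=
  (start ω, fun i => Y i ω)

/-- The sigma-algebra generated by the starting point and the first `k` observations. -/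
@[reducible] def pastSigma (start : Ω → β) (Y : ℕ → Ω → 𝒳) (k : ℕ) : MeasurableSpace Ω :=
  MeasurableSpace.comap (past start Y k) inferInstance

variable {start : Ω → β} {Y : ℕ → Ω → 𝒳}

lemma measurable_start_pastSigma (k : ℕ) : Measurable[pastSigma start Y k] start :=
  measurable_fst.comp (comap_measurable (past start Y k))

lemma pastSigma_mono_succ (k : ℕ) : pastSigma start Y k ≤ pastSigma start Y (k + 1) := by
  have h : past start Y k =
      (fun p : β × (Finset.range (k + 1) → 𝒳) => (p.1, fun i : Finset.range k =>
        p.2 ⟨i.1, Finset.mem_range.2 ((Finset.mem_range.1 i.2).trans (Nat.lt_succ_self k))⟩)) ∘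
        past start Y (k + 1) := rfl
  unfold pastSigma
  rw [h, ← MeasurableSpace.comap_comp]
  refine MeasurableSpace.comap_mono (Measurable.comap_le ?_)
  fun_prop

lemma measurable_obs_pastSigma (k : ℕ) : Measurable[pastSigma start Y (k + 1)] (Y k) :=
  ((measurable_pi_apply (⟨k, Finset.self_mem_range_succ k⟩ : Finset.range (k + 1))).comp
    measurable_snd).comp (comap_measurable (past start Y (k + 1)))

variable [MeasurableSpace Ω] {P : Measure Ω} [IsProbabilityMeasure P]

lemma indepFun_prodMk_of_indepFun {A : Ω → β} {B : Ω → β'} {C : Ω → 𝒳}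
    (hA : Measurable A) (hB : Measurable B) (hC : Measurable C)
    (h1 : IndepFun A (fun ω => (B ω, C ω)) P) (h2 : IndepFun B C P) :
    IndepFun (fun ω => (A ω, B ω)) C P := by
  have hAB : IndepFun A B P := h1.comp measurable_id measurable_fst
  rw [indepFun_iff_map_prod_eq_prod_map_map (by fun_prop) (by fun_prop)] at h1 h2 hAB ⊢
  have : (fun ω => ((A ω, B ω), C ω)) =
      MeasurableEquiv.prodAssoc.symm ∘ fun ω => (A ω, (B ω, C ω)) := rfl
  rw [this, ← Measure.map_map (by fun_prop) (by fun_prop), h1, h2, hAB, ← Measure.prodAssoc_prod,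
    MeasurableEquiv.map_symm_map]

lemma pastSigma_le (hs : Measurable start) (hY : ∀ k, Measurable (Y k)) (k : ℕ) :
    pastSigma start Y k ≤ (inferInstance : MeasurableSpace Ω) := by
  refine Measurable.comap_le ?_
  unfold past
  fun_prop

/-- A variable determined by the starting point and the first `k` observations is independent of the
next one. -/
lemma indepFun_of_measurable_pastSigma (hs : Measurable start) (hY : ∀ k, Measurable (Y k))
    (hindep : iIndepFun Y P) (hstart : IndepFun start (fun ω k => Y k ω) P)
    {k : ℕ} {Z : Ω → β'} (hZ : Measurable[pastSigma start Y k] Z) : IndepFun Z (Y k) P := by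
  have h1 : IndepFun (past start Y k) (Y k) P := by
    refine indepFun_prodMk_of_indepFun hs (by fun_prop) (hY k) ?_ ?_
    · exact hstart.comp (ψ := fun y : ℕ → 𝒳 => ((fun i : Finset.range k => y i), y k))
        measurable_id (by fun_prop)
    · have := hindep.indepFun_finset (Finset.range k) {k} (by simp) hY
      exact this.comp (ψ := fun y : ({k} : Finset ℕ) → 𝒳 => y ⟨k, by simp⟩)
        measurable_id (by fun_prop)
  rw [IndepFun_iff_Indep] at h1 ⊢
  exact indep_of_indep_of_le_left h1 (Measurable.comap_le hZ)

/-- Freezing: the expectation of a function of two independent variables is computed by first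
averaging over the second one. -/
lemma integral_eq_integral_integral_of_indepFun {F : Type*} [NormedAddCommGroup F]
    [NormedSpace ℝ F] {Z : Ω → β} {V : Ω → 𝒳} {ν : Measure 𝒳}
    (hZ : Measurable Z) (hV : Measurable V) (hν : P.map V = ν) (hind : IndepFun Z V P)
    {f : β × 𝒳 → F} (hf : StronglyMeasurable f) (hint : Integrable (fun ω => f (Z ω, V ω)) P) :
    ∫ ω, f (Z ω, V ω) ∂P = ∫ ω, ∫ x, f (Z ω, x) ∂ν ∂P := by
  have hmap := (indepFun_iff_map_prod_eq_prod_map_map hZ.aemeasurable hV.aemeasurable).1 hind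
  have : IsProbabilityMeasure ν := hν ▸ Measure.isProbabilityMeasure_map hV.aemeasurable
  rw [hν] at hmap
  have hZV : Measurable fun ω => (Z ω, V ω) := by fun_prop
  have hint' : Integrable f ((P.map Z).prod ν) := by
    rw [← hmap, integrable_map_measure hf.aestronglyMeasurable hZV.aemeasurable]
    exact hint
  have : IsProbabilityMeasure (P.map Z) := Measure.isProbabilityMeasure_map hZ.aemeasurable
  calc ∫ ω, f (Z ω, V ω) ∂P = ∫ p, f p ∂((P.map Z).prod ν) := by
        rw [← hmap, integral_map hZV.aemeasurable hf.aestronglyMeasurable]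
    _ = ∫ z, ∫ x, f (z, x) ∂ν ∂(P.map Z) := integral_prod f hint'
    _ = _ := by
        rw [integral_map hZ.aemeasurable]
        exact hf.integral_prod_right'.aestronglyMeasurable

end Past

/-! ### The multivariate central limit theorem -/

section CLT

open scoped RealInnerProductSpace

variable {ι : Type*} [Fintype ι] [DecidableEq ι] {Ω : Type*} [MeasurableSpace Ω] {P : Measure Ω}
  [IsProbabilityMeasure P]

/-- The Cramér-Wold device: the one-dimensional central limit theorem for each `⟪V k, t⟫` gives
the pointwise convergence of the characteristic functions. -/
theorem tendstoInDistribution_inv_sqrt_smul_sum {V : ℕ → Ω → EuclideanSpace ℝ ι}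
    {S : Matrix ι ι ℝ} (hS : S.PosSemidef) (hindep : iIndepFun V P)
    (hident : ∀ k, IdentDistrib (V k) (V 0) P P) (hL2 : MemLp (V 0) 2 P) (hmean : P[V 0] = 0)
    (hvar : ∀ t : EuclideanSpace ℝ ι, ∫ ω, ⟪V 0 ω, t⟫ ^ 2 ∂P = t ⬝ᵥ S.mulVec t) :
    TendstoInDistribution (fun (n : ℕ) ω => (√n)⁻¹ • ∑ k ∈ Finset.range n, V k ω) atTop id
      (fun _ => P) (multivariateGaussian 0 S) where
  forall_aemeasurable n := by
    have := fun k => (hident k).aemeasurable_fst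
    fun_prop
  aemeasurable_limit := aemeasurable_id
  tendsto := by
    refine ProbabilityMeasure.tendsto_iff_tendsto_charFun.2 fun t => ?_
    have hVm := fun k => (hident k).aemeasurable_fst
    have hL2t : MemLp (fun ω => ⟪V 0 ω, t⟫) 2 P := hL2.inner_const t
    have hmean_t : ∫ ω, ⟪V 0 ω, t⟫ ∂P = 0 := by
      have := integral_inner (𝕜 := ℝ) (hL2.integrable one_le_two) t
      simp_rw [real_inner_comm]
      rw [this, hmean, inner_zero_right]
    have hvar_t : Var[fun ω => ⟪V 0 ω, t⟫; P] = t ⬝ᵥ S.mulVec t := by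
      rw [variance_of_integral_eq_zero hL2t.aemeasurable hmean_t, hvar t]
    have hclt := tendstoInDistribution_inv_sqrt_mul_sum_sub (P := P)
      (X := fun k ω => ⟪V k ω, t⟫) (Y := id)
      (P' := gaussianReal 0 Var[fun ω => ⟪V 0 ω, t⟫; P].toNNReal) HasLaw.id hL2t
      (hindep.comp (fun _ x => ⟪x, t⟫) (fun _ => by fun_prop))
      (fun k => (hident k).comp (u := fun x => ⟪x, t⟫) (by fun_prop))
    have h1 := ProbabilityMeasure.tendsto_iff_tendsto_charFun.1 hclt.tendsto 1
    have hlim : charFun (Measure.map id (multivariateGaussian 0 S)) t =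
        charFun (Measure.map id (gaussianReal 0 Var[fun ω => ⟪V 0 ω, t⟫; P].toNNReal)) 1 := by
      rw [Measure.map_id, Measure.map_id, charFun_multivariateGaussian hS, charFun_gaussianReal,
        Real.coe_toNNReal _ (variance_nonneg _ _), hvar_t]
      simp
    simp only [ProbabilityMeasure.coe_mk] at h1 ⊢
    rw [hlim]
    refine h1.congr fun n => ?_
    rw [charFun_apply, charFun_apply, integral_map, integral_map]
    · refine integral_congr_ae (Eventually.of_forall fun ω => ?_)
      simp [hmean_t, inner_smul_left, sum_inner]
    all_goals fun_prop

end CLT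

/-! ### The projected Robbins-Monro algorithm for a general field -/

section RobbinsMonro

open scoped RealInnerProductSpace

variable {E 𝒳 Ω : Type*} [NormedAddCommGroup E] [InnerProductSpace ℝ E] [CompleteSpace E]
  [SecondCountableTopology E] [MeasurableSpace E] [BorelSpace E] [MeasurableSpace 𝒳]
  [MeasurableSpace Ω]

lemma integrable_inner_of_memLp_two {P : Measure Ω} {u v : Ω → E} (hu : MemLp u 2 P)
    (hv : MemLp v 2 P) : Integrable (fun ω => ⟪u ω, v ω⟫) P :=
  (hu.norm.integrable_mul hv.norm).mono' (hu.aestronglyMeasurable.inner hv.aestronglyMeasurable)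
    (Eventually.of_forall fun ω => norm_inner_le_norm (u ω) (v ω))

/-- The step `c (k + 1) ^ (-α)`, indexed from `0`. -/
def stepSize (c α : ℝ) (k : ℕ) : ℝ := c * ((k : ℝ) + 1) ^ (-α)

/-- The conditions on a random field `g` under which the algorithm is analysed, for observations of
law `ν`: on `K` the field is dominated by `M ∈ L²`, it is Lipschitz at `θ` with random constant
`L ∈ L²`, and its mean is strongly monotone at `θ` and equal to the linear map `A` up to a
quadratic error; the latter includes that the mean field vanishes at `θ`. -/
structure IsRegularField (g : 𝒳 → E → E) (ν : Measure 𝒳) (K : Set E) (θ : E) (A : E →L[ℝ] E)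
    (M L : 𝒳 → ℝ) (b C : ℝ) : Prop where
  measurable : Measurable (Function.uncurry g)
  measurable_M : Measurable M
  measurable_L : Measurable L
  memLp_M : MemLp M 2 ν
  memLp_L : MemLp L 2 ν
  L_nonneg : ∀ x, 0 ≤ L x
  norm_le : ∀ x, ∀ y ∈ K, ‖g x y‖ ≤ M x
  norm_sub_le : ∀ᵐ x ∂ν, ∀ y ∈ K, ‖g x y - g x θ‖ ≤ L x * ‖y - θ‖
  b_pos : 0 < b
  monotone : ∀ y ∈ K, b * ‖y - θ‖ ^ 2 ≤ ⟪∫ x, g x y ∂ν, y - θ⟫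
  C_nonneg : 0 ≤ C
  linearization : ∀ y ∈ K, ‖(∫ x, g x y ∂ν) - A (y - θ)‖ ≤ C * ‖y - θ‖ ^ 2

/-- The projected algorithm `Θ (k + 1) = π (Θ k - a k • g (Y k) (Θ k))` driven by i.i.d.
observations `Y` of law `ν` and started in `K`. The map `π` fixes `K` and is nonexpansive on a set
`D` which contains `K`, and all the possible arguments of `π` when the step is small. -/
structure IsProjectedAlgorithm (P : Measure Ω) (g : 𝒳 → E → E) (ν : Measure 𝒳) (K D : Set E)
    (θ : E) (π : E → E) (a : ℕ → ℝ) (Y : ℕ → Ω → 𝒳) (Θ : ℕ → Ω → E) : Prop where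
  isCompact : IsCompact K
  mem_interior : θ ∈ interior K
  subset : K ⊆ D
  measurable_proj : Measurable π
  proj_mem : ∀ y, π y ∈ K
  proj_fix : ∀ y ∈ K, π y = y
  proj_nonexpansive : ∀ y ∈ D, ∀ y' ∈ D, ‖π y - π y'‖ ≤ ‖y - y'‖
  step_mem : ∀ᶠ k in atTop, ∀ x, ∀ y ∈ K, y - a k • g x y ∈ D
  measurable_obs : ∀ k, Measurable (Y k)
  map_obs : ∀ k, P.map (Y k) = ν
  indep_obs : iIndepFun Y P
  measurable_start : Measurable (Θ 0)
  start_mem : ∀ ω, Θ 0 ω ∈ K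
  indep_start : IndepFun (Θ 0) (fun ω k => Y k ω) P
  succ : ∀ k ω, Θ (k + 1) ω = π (Θ k ω - a k • g (Y k ω) (Θ k ω))

namespace IsRegularField

variable {g : 𝒳 → E → E} {ν : Measure 𝒳} [IsProbabilityMeasure ν] {K : Set E} {θ : E}
  {A : E →L[ℝ] E} {M L : 𝒳 → ℝ} {b C : ℝ}

lemma integral_eq_zero (h : IsRegularField g ν K θ A M L b C) (hθ : θ ∈ K) :
    ∫ x, g x θ ∂ν = 0 := by
  have := h.linearization θ hθ
  simpa using this

lemma integrable (h : IsRegularField g ν K θ A M L b C) {y : E} (hy : y ∈ K) :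
    Integrable (fun x => g x y) ν :=
  (h.memLp_M.integrable one_le_two).mono'
    (h.measurable.comp (by fun_prop : Measurable fun x => (x, y))).aestronglyMeasurable
    (Eventually.of_forall fun x => h.norm_le x y hy)

lemma M_nonneg (h : IsRegularField g ν K θ A M L b C) (hθ : θ ∈ K) (x : 𝒳) : 0 ≤ M x :=
  (norm_nonneg _).trans (h.norm_le x θ hθ)

lemma norm_integral_le (h : IsRegularField g ν K θ A M L b C) (hθ : θ ∈ K) {y : E} (hy : y ∈ K) :
    ‖∫ x, g x y ∂ν‖ ≤ (∫ x, L x ∂ν) * ‖y - θ‖ := by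
  have h1 : ∫ x, g x y ∂ν = ∫ x, (g x y - g x θ) ∂ν := by
    rw [integral_sub (h.integrable hy) (h.integrable hθ), h.integral_eq_zero hθ, sub_zero]
  rw [h1, ← integral_mul_const]
  refine norm_integral_le_of_norm_le ((h.memLp_L.integrable one_le_two).mul_const _) ?_
  filter_upwards [h.norm_sub_le] with x hx using hx y hy

lemma measurable_mean (h : IsRegularField g ν K θ A M L b C) :
    Measurable fun y => ∫ x, g x y ∂ν :=
  (StronglyMeasurable.integral_prod_left (μ := ν)
    h.measurable.stronglyMeasurable).measurable

end IsRegularField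

/-- The centred increment `g x y - g x θ - 𝔼[g(·, y)]`. -/
def centredField (g : 𝒳 → E → E) (ν : Measure 𝒳) (θ : E) (x : 𝒳) (y : E) : E :=
  g x y - g x θ - ∫ x', g x' y ∂ν

namespace IsRegularField

variable {g : 𝒳 → E → E} {ν : Measure 𝒳} [IsProbabilityMeasure ν] {K : Set E} {θ : E}
  {A : E →L[ℝ] E} {M L : 𝒳 → ℝ} {b C : ℝ}

lemma measurable_centredField (h : IsRegularField g ν K θ A M L b C) :
    Measurable (Function.uncurry (centredField g ν θ)) := by
  have h1 := h.measurable_mean.comp (measurable_snd : Measurable (Prod.snd : 𝒳 × E → E))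
  have h2 : Measurable fun p : 𝒳 × E => g p.1 θ :=
    h.measurable.comp (by fun_prop : Measurable fun p : 𝒳 × E => (p.1, θ))
  exact (h.measurable.sub h2).sub h1

lemma integral_centredField (h : IsRegularField g ν K θ A M L b C) (hθ : θ ∈ K) {y : E}
    (hy : y ∈ K) : ∫ x, centredField g ν θ x y ∂ν = 0 := by
  unfold centredField
  have h1 : Integrable (fun x => g x y - g x θ) ν := (h.integrable hy).sub (h.integrable hθ)
  rw [integral_sub h1 (integrable_const _),
    integral_sub (h.integrable hy) (h.integrable hθ), h.integral_eq_zero hθ]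
  simp

lemma integrable_centredField (h : IsRegularField g ν K θ A M L b C) (hθ : θ ∈ K) {y : E}
    (hy : y ∈ K) : Integrable (fun x => centredField g ν θ x y) ν :=
  ((h.integrable hy).sub (h.integrable hθ)).sub (integrable_const _)

lemma norm_centredField_le (h : IsRegularField g ν K θ A M L b C) (hθ : θ ∈ K) :
    ∀ᵐ x ∂ν, ∀ y ∈ K, ‖centredField g ν θ x y‖ ≤ (L x + ∫ x', L x' ∂ν) * ‖y - θ‖ := by
  filter_upwards [h.norm_sub_le] with x hx y hy
  unfold centredField
  rw [add_mul]
  exact (_root_.norm_sub_le _ _).trans (add_le_add (hx y hy) (h.norm_integral_le hθ hy))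

end IsRegularField

namespace IsProjectedAlgorithm

variable {P : Measure Ω} [IsProbabilityMeasure P]
  {g : 𝒳 → E → E} {ν : Measure 𝒳} [IsProbabilityMeasure ν] {K D : Set E} {θ : E}
  {A : E →L[ℝ] E} {M L : 𝒳 → ℝ} {b C : ℝ} {π : E → E} {a : ℕ → ℝ} {Y : ℕ → Ω → 𝒳} {Θ : ℕ → Ω → E}

lemma theta_mem (hP : IsProjectedAlgorithm P g ν K D θ π a Y Θ) : θ ∈ K :=
  interior_subset hP.mem_interior

lemma mem (hP : IsProjectedAlgorithm P g ν K D θ π a Y Θ) (k : ℕ) (ω : Ω) : Θ k ω ∈ K := by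
  cases k with
  | zero => exact hP.start_mem ω
  | succ k => rw [hP.succ]; exact hP.proj_mem _

lemma exists_norm_le (hP : IsProjectedAlgorithm P g ν K D θ π a Y Θ) :
    ∃ R, 0 ≤ R ∧ ∀ k ω, ‖Θ k ω - θ‖ ≤ R := by
  obtain ⟨R, hR⟩ := hP.isCompact.isBounded.exists_norm_le
  refine ⟨R + ‖θ‖, ?_, fun k ω => (norm_sub_le _ _).trans (by gcongr; exact hR _ (hP.mem k ω))⟩
  have := (norm_nonneg _).trans (hR θ hP.theta_mem)
  positivity

lemma measurable_past (h : IsRegularField g ν K θ A M L b C)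
    (hP : IsProjectedAlgorithm P g ν K D θ π a Y Θ) (k : ℕ) :
    Measurable[pastSigma (Θ 0) Y k] (Θ k) := by
  induction k with
  | zero => exact measurable_start_pastSigma 0
  | succ k ih =>
    have h1 : Measurable[pastSigma (Θ 0) Y (k + 1)] (Θ k) := ih.mono (pastSigma_mono_succ k) le_rfl
    have h2 : Measurable[pastSigma (Θ 0) Y (k + 1)] (Y k) := measurable_obs_pastSigma k
    have h3 : Measurable[pastSigma (Θ 0) Y (k + 1)] fun ω => g (Y k ω) (Θ k ω) :=
      h.measurable.comp (h2.prodMk h1)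
    have : Θ (k + 1) = fun ω => π (Θ k ω - a k • g (Y k ω) (Θ k ω)) := funext (hP.succ k)
    rw [this]
    exact hP.measurable_proj.comp (h1.sub (h3.const_smul (a k)))

lemma measurable (h : IsRegularField g ν K θ A M L b C)
    (hP : IsProjectedAlgorithm P g ν K D θ π a Y Θ) (k : ℕ) : Measurable (Θ k) :=
  (measurable_past h hP k).mono (pastSigma_le hP.measurable_start hP.measurable_obs k) le_rfl

lemma measurable_field (h : IsRegularField g ν K θ A M L b C)
    (hP : IsProjectedAlgorithm P g ν K D θ π a Y Θ) (k : ℕ) :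
    Measurable fun ω => g (Y k ω) (Θ k ω) :=
  h.measurable.comp ((hP.measurable_obs k).prodMk (measurable h hP k))

lemma indepFun (hP : IsProjectedAlgorithm P g ν K D θ π a Y Θ) {β : Type*} [MeasurableSpace β]
    {k : ℕ} {Z : Ω → β} (hZ : Measurable[pastSigma (Θ 0) Y k] Z) : IndepFun Z (Y k) P :=
  indepFun_of_measurable_pastSigma hP.measurable_start hP.measurable_obs hP.indep_obs
    hP.indep_start hZ

lemma memLp_comp (hP : IsProjectedAlgorithm P g ν K D θ π a Y Θ) {F : Type*}
    [NormedAddCommGroup F] {f : 𝒳 → F} {p : ENNReal} (hf : MemLp f p ν) (k : ℕ) :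
    MemLp (fun ω => f (Y k ω)) p P := by
  rw [← hP.map_obs k] at hf
  exact hf.comp_of_map (hP.measurable_obs k).aemeasurable

lemma integral_comp (hP : IsProjectedAlgorithm P g ν K D θ π a Y Θ) {F : Type*}
    [NormedAddCommGroup F] [NormedSpace ℝ F] {f : 𝒳 → F} (hf : AEStronglyMeasurable f ν) (k : ℕ) :
    ∫ ω, f (Y k ω) ∂P = ∫ x, f x ∂ν := by
  rw [← hP.map_obs k] at hf ⊢
  rw [integral_map (hP.measurable_obs k).aemeasurable hf]

lemma ae_comp (hP : IsProjectedAlgorithm P g ν K D θ π a Y Θ) {p : 𝒳 → Prop}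
    (hp : ∀ᵐ x ∂ν, p x) (k : ℕ) : ∀ᵐ ω ∂P, p (Y k ω) := by
  rw [← hP.map_obs k] at hp
  exact ae_of_ae_map (hP.measurable_obs k).aemeasurable hp

lemma memLp_error (h : IsRegularField g ν K θ A M L b C)
    (hP : IsProjectedAlgorithm P g ν K D θ π a Y Θ) (k : ℕ) (p : ENNReal) :
    MemLp (fun ω => Θ k ω - θ) p P := by
  obtain ⟨R, -, hR⟩ := hP.exists_norm_le
  exact MemLp.of_bound ((measurable h hP k).sub_const θ).aestronglyMeasurable R
    (Eventually.of_forall (hR k))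

lemma integrable_sq_error (h : IsRegularField g ν K θ A M L b C)
    (hP : IsProjectedAlgorithm P g ν K D θ π a Y Θ) (k : ℕ) :
    Integrable (fun ω => ‖Θ k ω - θ‖ ^ 2) P :=
  (memLp_error h hP k 2).integrable_norm_pow two_ne_zero

lemma memLp_field (h : IsRegularField g ν K θ A M L b C)
    (hP : IsProjectedAlgorithm P g ν K D θ π a Y Θ) (k : ℕ) :
    MemLp (fun ω => g (Y k ω) (Θ k ω)) 2 P :=
  (hP.memLp_comp h.memLp_M k).mono' (measurable_field h hP k).aestronglyMeasurable
    (Eventually.of_forall fun ω => h.norm_le _ _ (hP.mem k ω))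

/-- The mean factorizes: the error at time `k` is independent of the observation `Y k`. -/
lemma integral_mul_sq_error (h : IsRegularField g ν K θ A M L b C)
    (hP : IsProjectedAlgorithm P g ν K D θ π a Y Θ) {f : 𝒳 → ℝ} (hf : Measurable f) (k : ℕ) :
    ∫ ω, f (Y k ω) * ‖Θ k ω - θ‖ ^ 2 ∂P = (∫ x, f x ∂ν) * ∫ ω, ‖Θ k ω - θ‖ ^ 2 ∂P := by
  have hi : IndepFun (fun ω => f (Y k ω)) (fun ω => ‖Θ k ω - θ‖ ^ 2) P :=
    (hP.indepFun (measurable_past h hP k)).symm.comp (φ := f) (ψ := fun y => ‖y - θ‖ ^ 2) hf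
      (by fun_prop)
  rw [hi.integral_fun_mul_eq_mul_integral
    (hf.comp (hP.measurable_obs k)).aestronglyMeasurable
    (integrable_sq_error h hP k).aestronglyMeasurable, hP.integral_comp hf.aestronglyMeasurable]

lemma integrable_mul_sq_error (h : IsRegularField g ν K θ A M L b C)
    (hP : IsProjectedAlgorithm P g ν K D θ π a Y Θ) {f : 𝒳 → ℝ} (hf : Integrable f ν) (k : ℕ) :
    Integrable (fun ω => f (Y k ω) * ‖Θ k ω - θ‖ ^ 2) P := by
  obtain ⟨R, hR0, hR⟩ := hP.exists_norm_le
  have hfY : Integrable (fun ω => f (Y k ω)) P :=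
    memLp_one_iff_integrable.1 (hP.memLp_comp (memLp_one_iff_integrable.2 hf) k)
  refine hfY.mul_bdd (c := R ^ 2) (integrable_sq_error h hP k).aestronglyMeasurable
    (Eventually.of_forall fun ω => ?_)
  rw [norm_pow, norm_norm]
  exact pow_le_pow_left₀ (norm_nonneg _) (hR k ω) 2

lemma integral_inner_field (h : IsRegularField g ν K θ A M L b C)
    (hP : IsProjectedAlgorithm P g ν K D θ π a Y Θ) (k : ℕ) :
    ∫ ω, ⟪g (Y k ω) (Θ k ω), Θ k ω - θ⟫ ∂P = ∫ ω, ⟪∫ x, g x (Θ k ω) ∂ν, Θ k ω - θ⟫ ∂P := by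
  have hmeas : Measurable fun p : E × 𝒳 => ⟪g p.2 p.1, p.1 - θ⟫ :=
    (h.measurable.comp measurable_swap).inner (by fun_prop)
  rw [integral_eq_integral_integral_of_indepFun (Z := Θ k) (V := Y k)
    (f := fun p : E × 𝒳 => ⟪g p.2 p.1, p.1 - θ⟫) (measurable h hP k)
    (hP.measurable_obs k) (hP.map_obs k) (hP.indepFun (measurable_past h hP k))
    hmeas.stronglyMeasurable]
  · refine integral_congr_ae (Eventually.of_forall fun ω => ?_)
    have := integral_inner (𝕜 := ℝ) (h.integrable (hP.mem k ω)) (Θ k ω - θ)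
    simp_rw [← real_inner_comm (Θ k ω - θ)] at this
    exact this
  · exact integrable_inner_of_memLp_two (memLp_field h hP k) (memLp_error h hP k 2)

/-- The mean square error is of the order of the step: nonexpansiveness of the projection and
strong monotonicity of the mean field give the recursion of `recursion_bound`. -/
theorem exists_integral_sq_error_le {c α : ℝ} (hc : 0 < c) (hα0 : 0 < α) (hα1 : α < 1)
    (h : IsRegularField g ν K θ A M L b C)
    (hP : IsProjectedAlgorithm P g ν K D θ π (stepSize c α) Y Θ) :
    ∃ C', 0 ≤ C' ∧ ∀ k : ℕ, ∫ ω, ‖Θ k ω - θ‖ ^ 2 ∂P ≤ C' * ((k : ℝ) + 1) ^ (-α) := by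
  refine recursion_bound (c := c) (b := 2 * b) (C := ∫ x, M x ^ 2 ∂ν) hc hα0 hα1
    (by linarith [h.b_pos]) (integral_nonneg fun x => sq_nonneg _) ?_
  filter_upwards [hP.step_mem] with k hk
  change _ ≤ (1 - 2 * b * stepSize c α k) * _ + (∫ x, M x ^ 2 ∂ν) * stepSize c α k ^ 2
  set s := stepSize c α k with hs
  have hs0 : 0 ≤ s := by rw [hs, stepSize]; positivity
  have hpt : ∀ ω, ‖Θ (k + 1) ω - θ‖ ^ 2 ≤ ‖Θ k ω - θ‖ ^ 2
      - 2 * s * ⟪g (Y k ω) (Θ k ω), Θ k ω - θ⟫ + s ^ 2 * M (Y k ω) ^ 2 := by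
    intro ω
    have hmem := hP.mem k ω
    have h1 : ‖Θ (k + 1) ω - θ‖ ≤ ‖Θ k ω - θ - s • g (Y k ω) (Θ k ω)‖ := by
      have := hP.proj_nonexpansive _ (hk (Y k ω) _ hmem) θ (hP.subset hP.theta_mem)
      rw [hP.proj_fix θ hP.theta_mem] at this
      rw [hP.succ, sub_right_comm]
      exact this
    have h2 : ‖g (Y k ω) (Θ k ω)‖ ^ 2 ≤ M (Y k ω) ^ 2 :=
      pow_le_pow_left₀ (norm_nonneg _) (h.norm_le _ _ hmem) 2
    calc ‖Θ (k + 1) ω - θ‖ ^ 2 ≤ ‖Θ k ω - θ - s • g (Y k ω) (Θ k ω)‖ ^ 2 :=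
          pow_le_pow_left₀ (norm_nonneg _) h1 2
      _ = ‖Θ k ω - θ‖ ^ 2 - 2 * s * ⟪g (Y k ω) (Θ k ω), Θ k ω - θ⟫
            + s ^ 2 * ‖g (Y k ω) (Θ k ω)‖ ^ 2 := by
          rw [norm_sub_sq_real, inner_smul_right, real_inner_comm, norm_smul, mul_pow,
            Real.norm_eq_abs, sq_abs]
          ring
      _ ≤ _ := by gcongr
  have i1 := integrable_sq_error h hP k
  have i2 : Integrable (fun ω => ⟪g (Y k ω) (Θ k ω), Θ k ω - θ⟫) P :=
    integrable_inner_of_memLp_two (memLp_field h hP k) (memLp_error h hP k 2)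
  have i3 : Integrable (fun ω => M (Y k ω) ^ 2) P := (hP.memLp_comp h.memLp_M k).integrable_sq
  have i4 : Integrable (fun ω => ⟪∫ x, g x (Θ k ω) ∂ν, Θ k ω - θ⟫) P := by
    obtain ⟨R, hR0, hR⟩ := hP.exists_norm_le
    have hL0 : 0 ≤ ∫ x, L x ∂ν := integral_nonneg h.L_nonneg
    refine Integrable.of_bound (C := (∫ x, L x ∂ν) * R * R)
      ((h.measurable_mean.comp (measurable h hP k)).inner
        ((measurable h hP k).sub_const θ)).aestronglyMeasurable (Eventually.of_forall fun ω => ?_)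
    refine (norm_inner_le_norm _ _).trans ?_
    have h1 := h.norm_integral_le hP.theta_mem (hP.mem k ω)
    have h2 := hR k ω
    exact mul_le_mul (h1.trans (by gcongr)) h2 (norm_nonneg _) (by positivity)
  have hmono : b * ∫ ω, ‖Θ k ω - θ‖ ^ 2 ∂P ≤ ∫ ω, ⟪g (Y k ω) (Θ k ω), Θ k ω - θ⟫ ∂P := by
    rw [integral_inner_field h hP k, ← integral_const_mul]
    exact integral_mono (i1.const_mul b) i4 fun ω => h.monotone _ (hP.mem k ω)
  calc ∫ ω, ‖Θ (k + 1) ω - θ‖ ^ 2 ∂P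
      ≤ ∫ ω, (‖Θ k ω - θ‖ ^ 2 - 2 * s * ⟪g (Y k ω) (Θ k ω), Θ k ω - θ⟫
          + s ^ 2 * M (Y k ω) ^ 2) ∂P :=
        integral_mono (integrable_sq_error h hP (k + 1))
          ((i1.sub (i2.const_mul (2 * s))).add (i3.const_mul (s ^ 2))) hpt
    _ = ∫ ω, ‖Θ k ω - θ‖ ^ 2 ∂P - 2 * s * ∫ ω, ⟪g (Y k ω) (Θ k ω), Θ k ω - θ⟫ ∂P
          + s ^ 2 * ∫ x, M x ^ 2 ∂ν := by
        have i5 : Integrable (fun ω => ‖Θ k ω - θ‖ ^ 2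
            - 2 * s * ⟪g (Y k ω) (Θ k ω), Θ k ω - θ⟫) P := i1.sub (i2.const_mul (2 * s))
        rw [integral_add i5 (i3.const_mul (s ^ 2)),
          integral_sub i1 (i2.const_mul (2 * s)), integral_const_mul, integral_const_mul,
          hP.integral_comp (f := fun x => M x ^ 2)
            (h.measurable_M.pow_const 2).aestronglyMeasurable]
    _ ≤ _ := by nlinarith [mul_le_mul_of_nonneg_left hmono hs0]

end IsProjectedAlgorithm

end RobbinsMonro

/-! ### Asymptotic normality of the averaged algorithm -/

section Averaging

open scoped RealInnerProductSpace

variable {E 𝒳 Ω : Type*} [NormedAddCommGroup E] [InnerProductSpace ℝ E] [CompleteSpace E]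
  [SecondCountableTopology E] [MeasurableSpace E] [BorelSpace E] [MeasurableSpace 𝒳]
  [MeasurableSpace Ω]

lemma integral_norm_le_sqrt {P : Measure Ω} [IsProbabilityMeasure P] {f : Ω → E}
    (hf : MemLp f 2 P) : ∫ ω, ‖f ω‖ ∂P ≤ √(∫ ω, ‖f ω‖ ^ 2 ∂P) := by
  refine Real.le_sqrt_of_sq_le ?_
  have h := variance_nonneg (fun ω => ‖f ω‖) P
  rw [variance_eq_sub hf.norm] at h
  simpa using h

namespace IsProjectedAlgorithm

variable {P : Measure Ω} [IsProbabilityMeasure P]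
  {g : 𝒳 → E → E} {ν : Measure 𝒳} [IsProbabilityMeasure ν] {K D : Set E} {θ : E}
  {A : E →L[ℝ] E} {M L : 𝒳 → ℝ} {b C : ℝ} {π : E → E} {a : ℕ → ℝ} {Y : ℕ → Ω → 𝒳} {Θ : ℕ → Ω → E}

lemma measurable_centred_past (h : IsRegularField g ν K θ A M L b C)
    (hP : IsProjectedAlgorithm P g ν K D θ π a Y Θ) (k : ℕ) :
    Measurable[pastSigma (Θ 0) Y (k + 1)] fun ω => centredField g ν θ (Y k ω) (Θ k ω) := by
  have h1 : Measurable[pastSigma (Θ 0) Y (k + 1)] (Θ k) :=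
    (measurable_past h hP k).mono (pastSigma_mono_succ k) le_rfl
  have h2 : Measurable[pastSigma (Θ 0) Y (k + 1)] (Y k) := measurable_obs_pastSigma k
  exact h.measurable_centredField.comp (h2.prodMk h1)

lemma measurable_sum_centred_past (h : IsRegularField g ν K θ A M L b C)
    (hP : IsProjectedAlgorithm P g ν K D θ π a Y Θ) (n : ℕ) :
    Measurable[pastSigma (Θ 0) Y n]
      fun ω => ∑ k ∈ Finset.range n, centredField g ν θ (Y k ω) (Θ k ω) := by
  induction n with
  | zero => simp
  | succ n ih =>
    simp_rw [Finset.sum_range_succ]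
    exact (ih.mono (pastSigma_mono_succ n) le_rfl).add (measurable_centred_past h hP n)

lemma norm_centred_le (h : IsRegularField g ν K θ A M L b C)
    (hP : IsProjectedAlgorithm P g ν K D θ π a Y Θ) (k : ℕ) :
    ∀ᵐ ω ∂P, ‖centredField g ν θ (Y k ω) (Θ k ω)‖ ≤
      (L (Y k ω) + ∫ x, L x ∂ν) * ‖Θ k ω - θ‖ := by
  filter_upwards [hP.ae_comp (h.norm_centredField_le hP.theta_mem) k] with ω hω
  exact hω _ (hP.mem k ω)

lemma memLp_centred (h : IsRegularField g ν K θ A M L b C)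
    (hP : IsProjectedAlgorithm P g ν K D θ π a Y Θ) (k : ℕ) :
    MemLp (fun ω => centredField g ν θ (Y k ω) (Θ k ω)) 2 P := by
  obtain ⟨R, hR0, hR⟩ := hP.exists_norm_le
  have hL : MemLp (fun ω => (L (Y k ω) + ∫ x, L x ∂ν) * R) 2 P :=
    (((hP.memLp_comp h.memLp_L k).add (memLp_const _)).mul_const R)
  refine hL.mono' (h.measurable_centredField.comp
    ((hP.measurable_obs k).prodMk (measurable h hP k))).aestronglyMeasurable ?_
  filter_upwards [norm_centred_le h hP k] with ω hω
  have : 0 ≤ ∫ x, L x ∂ν := integral_nonneg h.L_nonneg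
  have := h.L_nonneg (Y k ω)
  exact hω.trans (by gcongr; exact hR k ω)

lemma memLp_sum_centred (h : IsRegularField g ν K θ A M L b C)
    (hP : IsProjectedAlgorithm P g ν K D θ π a Y Θ) (n : ℕ) :
    MemLp (fun ω => ∑ k ∈ Finset.range n, centredField g ν θ (Y k ω) (Θ k ω)) 2 P :=
  memLp_finsetSum _ fun k _ => memLp_centred h hP k

/-- Given the past, the next centred increment has mean zero. -/
lemma integral_inner_sum_centred (h : IsRegularField g ν K θ A M L b C)
    (hP : IsProjectedAlgorithm P g ν K D θ π a Y Θ) (n : ℕ) :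
    ∫ ω, ⟪∑ k ∈ Finset.range n, centredField g ν θ (Y k ω) (Θ k ω),
      centredField g ν θ (Y n ω) (Θ n ω)⟫ ∂P = 0 := by
  set S := fun ω => ∑ k ∈ Finset.range n, centredField g ν θ (Y k ω) (Θ k ω) with hS
  have hZ : Measurable[pastSigma (Θ 0) Y n] fun ω => (S ω, Θ n ω) :=
    (measurable_sum_centred_past h hP n).prodMk (measurable_past h hP n)
  have hmeas : Measurable fun p : (E × E) × 𝒳 => ⟪p.1.1, centredField g ν θ p.2 p.1.2⟫ :=
    (by fun_prop : Measurable fun p : (E × E) × 𝒳 => p.1.1).inner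
      (h.measurable_centredField.comp
        (by fun_prop : Measurable fun p : (E × E) × 𝒳 => (p.2, p.1.2)))
  have := integral_eq_integral_integral_of_indepFun (Z := fun ω => (S ω, Θ n ω)) (V := Y n)
    (f := fun p : (E × E) × 𝒳 => ⟪p.1.1, centredField g ν θ p.2 p.1.2⟫)
    (hZ.mono (pastSigma_le hP.measurable_start hP.measurable_obs n) le_rfl)
    (hP.measurable_obs n) (hP.map_obs n) (hP.indepFun hZ) hmeas.stronglyMeasurable
    (integrable_inner_of_memLp_two (memLp_sum_centred h hP n) (memLp_centred h hP n))
  simp only at this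
  rw [this]
  refine integral_eq_zero_of_ae (Eventually.of_forall fun ω => ?_)
  simp only
  rw [integral_inner (𝕜 := ℝ) (h.integrable_centredField hP.theta_mem (hP.mem n ω)),
    h.integral_centredField hP.theta_mem (hP.mem n ω), inner_zero_right]
  rfl

/-- The centred increments are orthogonal in `L²`. -/
lemma integral_sq_sum_centred_le (h : IsRegularField g ν K θ A M L b C)
    (hP : IsProjectedAlgorithm P g ν K D θ π a Y Θ) (n : ℕ) :
    ∫ ω, ‖∑ k ∈ Finset.range n, centredField g ν θ (Y k ω) (Θ k ω)‖ ^ 2 ∂P ≤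
      (∫ x, (L x + ∫ x', L x' ∂ν) ^ 2 ∂ν) *
        ∑ k ∈ Finset.range n, ∫ ω, ‖Θ k ω - θ‖ ^ 2 ∂P := by
  induction n with
  | zero => simp
  | succ n ih =>
    have hS := memLp_sum_centred h hP n
    have he := memLp_centred h hP n
    have i1 := hS.integrable_norm_pow two_ne_zero
    have i2 := (integrable_inner_of_memLp_two hS he).const_mul 2
    have i3 := he.integrable_norm_pow two_ne_zero
    have hL : MemLp (fun x => L x + ∫ x', L x' ∂ν) 2 ν := h.memLp_L.add (memLp_const _)
    have hbound : ∫ ω, ‖centredField g ν θ (Y n ω) (Θ n ω)‖ ^ 2 ∂P ≤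
        (∫ x, (L x + ∫ x', L x' ∂ν) ^ 2 ∂ν) * ∫ ω, ‖Θ n ω - θ‖ ^ 2 ∂P := by
      rw [← integral_mul_sq_error h hP (f := fun x => (L x + ∫ x', L x' ∂ν) ^ 2)
        ((h.measurable_L.add_const _).pow_const 2)]
      refine integral_mono_ae i3 (integrable_mul_sq_error h hP hL.integrable_sq n) ?_
      filter_upwards [norm_centred_le h hP n] with ω hω
      rw [← mul_pow]
      exact pow_le_pow_left₀ (norm_nonneg _) hω 2
    simp_rw [Finset.sum_range_succ, norm_add_sq_real]
    have i12 : Integrable (fun ω =>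
        ‖∑ k ∈ Finset.range n, centredField g ν θ (Y k ω) (Θ k ω)‖ ^ 2 +
          2 * ⟪∑ k ∈ Finset.range n, centredField g ν θ (Y k ω) (Θ k ω),
            centredField g ν θ (Y n ω) (Θ n ω)⟫) P := i1.add i2
    rw [integral_add i12 i3, integral_add i1 i2, integral_const_mul,
      integral_inner_sum_centred h hP n, mul_add]
    linarith

/-- The correction made by the projection at step `k`. -/
def residual (g : 𝒳 → E → E) (a : ℕ → ℝ) (Y : ℕ → Ω → 𝒳) (Θ : ℕ → Ω → E) (k : ℕ) (ω : Ω) : E :=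
  Θ (k + 1) ω - (Θ k ω - a k • g (Y k ω) (Θ k ω))

lemma memLp_residual (h : IsRegularField g ν K θ A M L b C)
    (hP : IsProjectedAlgorithm P g ν K D θ π a Y Θ) (k : ℕ) :
    MemLp (residual g a Y Θ k) 2 P := by
  have : residual g a Y Θ k = fun ω => (Θ (k + 1) ω - θ) - ((Θ k ω - θ)
      - a k • g (Y k ω) (Θ k ω)) := by
    funext ω; simp only [residual]; abel
  rw [this]
  exact (memLp_error h hP (k + 1) 2).sub
    ((memLp_error h hP k 2).sub ((memLp_field h hP k).const_smul (a k)))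

/-- Since `θ` is interior to `K`, the projection acts only if the error or the increment exceeds a
fixed threshold `ρ / 2`. Its norm is at most `2 a k M`, and one more factor, the squared error or the
increment over the threshold, is then at least `1`. -/
lemma exists_norm_residual_le (h : IsRegularField g ν K θ A M L b C)
    (hP : IsProjectedAlgorithm P g ν K D θ π a Y Θ) (ha : ∀ k, 0 ≤ a k) :
    ∃ r, 0 < r ∧ ∀ᶠ k in atTop, ∀ ω, ‖residual g a Y Θ k ω‖ ≤
      a k * (r * (M (Y k ω) * ‖Θ k ω - θ‖ ^ 2) + a k * (r * M (Y k ω) ^ 2)) := by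
  obtain ⟨ρ, hρ, hball⟩ := Metric.isOpen_iff.1 isOpen_interior θ hP.mem_interior
  have hρ2 : 0 < ρ / 2 := by linarith
  refine ⟨2 * (ρ / 2)⁻¹ ^ 2 + 2 * (ρ / 2)⁻¹, by positivity, ?_⟩
  filter_upwards [hP.step_mem] with k hk ω
  have hmem := hP.mem k ω
  have hM0 : 0 ≤ M (Y k ω) := h.M_nonneg hP.theta_mem _
  have hgM := h.norm_le (Y k ω) _ hmem
  have hak := ha k
  set w := Θ k ω - a k • g (Y k ω) (Θ k ω) with hw
  have hres : residual g a Y Θ k ω = π w - w := by rw [residual, hP.succ]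
  have hstep : ‖a k • g (Y k ω) (Θ k ω)‖ ≤ a k * M (Y k ω) := by
    rw [norm_smul, Real.norm_of_nonneg hak]; gcongr
  rw [hres]
  by_cases hsmall : ‖Θ k ω - θ‖ < ρ / 2 ∧ a k * M (Y k ω) < ρ / 2
  · have hwK : w ∈ K := by
      refine interior_subset (hball ?_)
      rw [mem_ball_iff_norm]
      calc ‖w - θ‖ = ‖(Θ k ω - θ) - a k • g (Y k ω) (Θ k ω)‖ := by rw [hw, sub_right_comm]
        _ ≤ ‖Θ k ω - θ‖ + ‖a k • g (Y k ω) (Θ k ω)‖ := norm_sub_le _ _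
        _ < ρ := by linarith [hsmall.1, hsmall.2]
    rw [hP.proj_fix w hwK, sub_self, norm_zero]
    positivity
  · have hlip : ‖π w - w‖ ≤ 2 * (a k * M (Y k ω)) := by
      have h1 := hP.proj_nonexpansive w (hk _ _ hmem) (Θ k ω) (hP.subset hmem)
      rw [hP.proj_fix _ hmem] at h1
      have h2 : ‖w - Θ k ω‖ ≤ a k * M (Y k ω) := by
        rw [hw, sub_sub_cancel_left, norm_neg]; exact hstep
      calc ‖π w - w‖ = ‖(π w - Θ k ω) - (w - Θ k ω)‖ := by rw [sub_sub_sub_cancel_right]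
        _ ≤ ‖π w - Θ k ω‖ + ‖w - Θ k ω‖ := norm_sub_le _ _
        _ ≤ _ := by linarith
    refine hlip.trans ?_
    have hfac : 1 ≤ (ρ / 2)⁻¹ ^ 2 * ‖Θ k ω - θ‖ ^ 2 + (ρ / 2)⁻¹ * (a k * M (Y k ω)) := by
      rw [not_and_or, not_lt, not_lt] at hsmall
      rcases hsmall with hc | hc
      · have : 1 ≤ ((ρ / 2)⁻¹ * ‖Θ k ω - θ‖) ^ 2 := by
          apply one_le_pow₀
          rw [inv_mul_eq_div, le_div_iff₀ hρ2]; linarith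
        rw [mul_pow] at this
        have : 0 ≤ (ρ / 2)⁻¹ * (a k * M (Y k ω)) := by positivity
        linarith
      · have : 1 ≤ (ρ / 2)⁻¹ * (a k * M (Y k ω)) := by
          rw [inv_mul_eq_div, le_div_iff₀ hρ2]; linarith
        have : 0 ≤ (ρ / 2)⁻¹ ^ 2 * ‖Θ k ω - θ‖ ^ 2 := by positivity
        linarith
    have hnn : 0 ≤ 2 * (a k * M (Y k ω)) := by positivity
    calc 2 * (a k * M (Y k ω)) ≤ 2 * (a k * M (Y k ω)) *
          ((ρ / 2)⁻¹ ^ 2 * ‖Θ k ω - θ‖ ^ 2 + (ρ / 2)⁻¹ * (a k * M (Y k ω))) :=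
          le_mul_of_one_le_right hnn hfac
      _ = a k * (2 * (ρ / 2)⁻¹ ^ 2 * (M (Y k ω) * ‖Θ k ω - θ‖ ^ 2)
            + a k * (2 * (ρ / 2)⁻¹ * M (Y k ω) ^ 2)) := by ring
      _ ≤ _ := by gcongr <;> simp <;> positivity

lemma stepSize_pos {c : ℝ} (hc : 0 < c) (α : ℝ) (k : ℕ) : 0 < stepSize c α k := by
  unfold stepSize; positivity

/-- Divided by the step, the correction made by the projection is of the order of the step in `L¹`. -/
lemma exists_integral_norm_residual_le {c α : ℝ} (hc : 0 < c) (hα0 : 0 < α) (hα1 : α < 1)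
    (h : IsRegularField g ν K θ A M L b C)
    (hP : IsProjectedAlgorithm P g ν K D θ π (stepSize c α) Y Θ) :
    ∃ C', 0 ≤ C' ∧ ∀ k : ℕ, (stepSize c α k)⁻¹ * ∫ ω, ‖residual g (stepSize c α) Y Θ k ω‖ ∂P ≤
      C' * ((k : ℝ) + 1) ^ (-α) := by
  refine exists_le_mul_of_eventually (fun k => by positivity) ?_
  obtain ⟨r, hr, hres⟩ := exists_norm_residual_le h hP fun k => (stepSize_pos hc α k).le
  obtain ⟨C₁, hC₁, hu⟩ := exists_integral_sq_error_le hc hα0 hα1 h hP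
  refine ⟨r * ((∫ x, M x ∂ν) * C₁) + c * (r * ∫ x, M x ^ 2 ∂ν), ?_⟩
  filter_upwards [hres] with k hk
  have hs := stepSize_pos hc α k
  have hMint := h.memLp_M.integrable one_le_two
  have hM0 : 0 ≤ ∫ x, M x ∂ν := integral_nonneg (h.M_nonneg hP.theta_mem)
  have i1 := integrable_mul_sq_error h hP hMint k
  have i2 : Integrable (fun ω => M (Y k ω) ^ 2) P := (hP.memLp_comp h.memLp_M k).integrable_sq
  rw [inv_mul_le_iff₀ hs]
  calc ∫ ω, ‖residual g (stepSize c α) Y Θ k ω‖ ∂P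
      ≤ ∫ ω, stepSize c α k * (r * (M (Y k ω) * ‖Θ k ω - θ‖ ^ 2)
          + stepSize c α k * (r * M (Y k ω) ^ 2)) ∂P :=
        integral_mono ((memLp_residual h hP k).integrable one_le_two).norm
          (((i1.const_mul r).add ((i2.const_mul r).const_mul _)).const_mul _) hk
    _ = stepSize c α k * (r * ((∫ x, M x ∂ν) * ∫ ω, ‖Θ k ω - θ‖ ^ 2 ∂P)
          + stepSize c α k * (r * ∫ x, M x ^ 2 ∂ν)) := by
        rw [integral_const_mul, integral_add (i1.const_mul r) ((i2.const_mul r).const_mul _),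
          integral_const_mul, integral_const_mul, integral_const_mul,
          integral_mul_sq_error h hP h.measurable_M,
          hP.integral_comp (f := fun x => M x ^ 2)
            (h.measurable_M.pow_const 2).aestronglyMeasurable]
    _ ≤ stepSize c α k * (r * ((∫ x, M x ∂ν) * (C₁ * ((k : ℝ) + 1) ^ (-α)))
          + stepSize c α k * (r * ∫ x, M x ^ 2 ∂ν)) := by gcongr; exact hu k
    _ = _ := by rw [stepSize]; ring

/-- One step of the algorithm, solved for the linear part of the mean field. -/
lemma linear_error_eq (k : ℕ) (ω : Ω)
    (hak : a k ≠ 0) :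
    A (Θ k ω - θ) + g (Y k ω) θ = (a k)⁻¹ • ((Θ k ω - θ) - (Θ (k + 1) ω - θ))
      + (a k)⁻¹ • residual g a Y Θ k ω - centredField g ν θ (Y k ω) (Θ k ω)
      - ((∫ x, g x (Θ k ω) ∂ν) - A (Θ k ω - θ)) := by
  have h1 : (a k)⁻¹ • ((Θ k ω - θ) - (Θ (k + 1) ω - θ)) + (a k)⁻¹ • residual g a Y Θ k ω
      = g (Y k ω) (Θ k ω) := by
    rw [← smul_add, residual]
    have : Θ k ω - θ - (Θ (k + 1) ω - θ) + (Θ (k + 1) ω - (Θ k ω - a k • g (Y k ω) (Θ k ω)))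
        = a k • g (Y k ω) (Θ k ω) := by abel
    rw [this, inv_smul_smul₀ hak]
  rw [h1, centredField]
  abel

end IsProjectedAlgorithm

end Averaging

section AveragingCLT

open scoped RealInnerProductSpace

variable {E 𝒳 Ω : Type*} [NormedAddCommGroup E] [InnerProductSpace ℝ E] [CompleteSpace E]
  [SecondCountableTopology E] [MeasurableSpace E] [BorelSpace E] [MeasurableSpace 𝒳]
  [MeasurableSpace Ω]

namespace IsProjectedAlgorithm

variable {P : Measure Ω} [IsProbabilityMeasure P]
  {g : 𝒳 → E → E} {ν : Measure 𝒳} [IsProbabilityMeasure ν] {K D : Set E} {θ : E}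
  {A : E →L[ℝ] E} {M L : 𝒳 → ℝ} {b C : ℝ} {π : E → E} {a : ℕ → ℝ} {Y : ℕ → Ω → 𝒳} {Θ : ℕ → Ω → E}

lemma integral_norm_error_le (h : IsRegularField g ν K θ A M L b C)
    (hP : IsProjectedAlgorithm P g ν K D θ π a Y Θ) {C' s : ℝ} {k : ℕ} (hC : 0 ≤ C')
    (hu : ∫ ω, ‖Θ k ω - θ‖ ^ 2 ∂P ≤ C' * ((k : ℝ) + 1) ^ (-s)) :
    ∫ ω, ‖Θ k ω - θ‖ ∂P ≤ √C' * ((k : ℝ) + 1) ^ (-(s / 2)) := by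
  refine (integral_norm_le_sqrt (memLp_error h hP k 2)).trans ?_
  refine (Real.sqrt_le_sqrt hu).trans_eq ?_
  rw [Real.sqrt_mul hC, Real.sqrt_eq_rpow (((k : ℝ) + 1) ^ (-s)), ← Real.rpow_mul (by positivity)]
  congr 2; ring

lemma sqrt_mul_inv_eq {x : ℝ} (n : ℕ) (hn : 0 < n) :
    (√(n : ℝ))⁻¹ * (n : ℝ) ^ x = (n : ℝ) ^ (x - 1 / 2) := by
  have : (0 : ℝ) < n := by exact_mod_cast hn
  rw [Real.sqrt_eq_rpow, ← Real.rpow_neg this.le, ← Real.rpow_add this]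
  congr 1; ring

/-- The accumulated telescoping term is negligible before `√n`, by summation by parts. -/
lemma tendsto_integral_norm_sum_increments {c α : ℝ} (hc : 0 < c) (hα0 : 1 / 2 < α) (hα1 : α < 1)
    (h : IsRegularField g ν K θ A M L b C)
    (hP : IsProjectedAlgorithm P g ν K D θ π (stepSize c α) Y Θ) :
    Tendsto (fun n : ℕ => (√n)⁻¹ * ∫ ω, ‖∑ k ∈ Finset.range n,
      (stepSize c α k)⁻¹ • ((Θ k ω - θ) - (Θ (k + 1) ω - θ))‖ ∂P) atTop (nhds 0) := by
  obtain ⟨C₁, hC₁, hu⟩ := exists_integral_sq_error_le hc (by linarith) hα1 h hP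
  set B : ℕ → ℝ := fun k => c⁻¹ * (k : ℝ) ^ α with hB
  have hB0 : B 0 = 0 := by simp [hB, Real.zero_rpow (by linarith : α ≠ 0)]
  have hBs : ∀ k, (stepSize c α k)⁻¹ = B (k + 1) := by
    intro k
    have : (0 : ℝ) ≤ (k : ℝ) + 1 := by positivity
    simp only [hB, stepSize, Real.rpow_neg this, mul_inv, inv_inv]
    push_cast; rfl
  have hBnn : ∀ k, 0 ≤ B k := fun k => by positivity
  have hBd : ∀ k, 0 ≤ B (k + 1) - B k := by
    intro k
    rw [sub_nonneg]
    simp only [hB]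
    gcongr
    simp
  have hBd' : ∀ k : ℕ, B (k + 1) - B k ≤ c⁻¹ * ((k : ℝ) + 1) ^ (α - 1) := by
    intro k
    have := rpow_sub_le_rpow_sub_one hα1.le k
    simp only [hB, ← mul_sub]
    push_cast
    gcongr
  have hint : ∀ k, Integrable (fun ω => Θ k ω - θ) P :=
    fun k => memLp_one_iff_integrable.1 (memLp_error h hP k 1)
  have hE : ∀ k : ℕ, ∫ ω, ‖Θ k ω - θ‖ ∂P ≤ √C₁ * ((k : ℝ) + 1) ^ (-(α / 2)) :=
    fun k => integral_norm_error_le h hP hC₁ (hu k)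
  have hbound : ∀ n : ℕ, 0 < n → (√n)⁻¹ * ∫ ω, ‖∑ k ∈ Finset.range n,
      (stepSize c α k)⁻¹ • ((Θ k ω - θ) - (Θ (k + 1) ω - θ))‖ ∂P ≤
      c⁻¹ * √C₁ * ((√n)⁻¹ * ∑ k ∈ Finset.range n, ((k : ℝ) + 1) ^ (-(1 - α / 2)))
        + c⁻¹ * √C₁ * (n : ℝ) ^ (-((1 - α) / 2)) := by
    intro n hn
    have hn' : (0 : ℝ) < n := by exact_mod_cast hn
    have i1 : ∀ k, Integrable (fun ω => (B (k + 1) - B k) * ‖Θ k ω - θ‖) P :=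
      fun k => (hint k).norm.const_mul _
    have i2 : Integrable (fun ω => ∑ k ∈ Finset.range n, (B (k + 1) - B k) * ‖Θ k ω - θ‖) P :=
      integrable_finsetSum _ fun k _ => i1 k
    have hparts : ∫ ω, ‖∑ k ∈ Finset.range n,
        (stepSize c α k)⁻¹ • ((Θ k ω - θ) - (Θ (k + 1) ω - θ))‖ ∂P ≤
        ∑ k ∈ Finset.range n, (B (k + 1) - B k) * ∫ ω, ‖Θ k ω - θ‖ ∂P
          + B n * ∫ ω, ‖Θ n ω - θ‖ ∂P := by
      simp_rw [← integral_const_mul]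
      rw [← integral_finsetSum _ fun k _ => i1 k, ← integral_add i2 ((hint n).norm.const_mul _)]
      refine integral_mono_of_nonneg (Eventually.of_forall fun ω => norm_nonneg _)
        (i2.add ((hint n).norm.const_mul _)) (Eventually.of_forall fun ω => ?_)
      simp only [hBs]
      rw [sum_smul_sub_succ B hB0 (fun k => Θ k ω - θ) n]
      refine (norm_sub_le _ _).trans (add_le_add ((norm_sum_le _ _).trans (le_of_eq ?_)) ?_)
      · refine Finset.sum_congr rfl fun k _ => ?_
        rw [norm_smul, Real.norm_of_nonneg (hBd k)]
      · rw [norm_smul, Real.norm_of_nonneg (hBnn n)]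
    have hsum : ∑ k ∈ Finset.range n, (B (k + 1) - B k) * ∫ ω, ‖Θ k ω - θ‖ ∂P ≤
        c⁻¹ * √C₁ * ∑ k ∈ Finset.range n, ((k : ℝ) + 1) ^ (-(1 - α / 2)) := by
      rw [Finset.mul_sum]
      refine Finset.sum_le_sum fun k _ => ?_
      have hk : (0 : ℝ) < (k : ℝ) + 1 := by positivity
      calc (B (k + 1) - B k) * ∫ ω, ‖Θ k ω - θ‖ ∂P
          ≤ (c⁻¹ * ((k : ℝ) + 1) ^ (α - 1)) * (√C₁ * ((k : ℝ) + 1) ^ (-(α / 2))) :=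
            mul_le_mul (hBd' k) (hE k) (integral_nonneg fun _ => norm_nonneg _) (by positivity)
        _ = c⁻¹ * √C₁ * (((k : ℝ) + 1) ^ (α - 1) * ((k : ℝ) + 1) ^ (-(α / 2))) := by ring
        _ = _ := by rw [← Real.rpow_add hk]; congr 2; ring
    have hlast : B n * ∫ ω, ‖Θ n ω - θ‖ ∂P ≤ c⁻¹ * √C₁ * (n : ℝ) ^ (α / 2) := by
      have hmono : ((n : ℝ) + 1) ^ (-(α / 2)) ≤ (n : ℝ) ^ (-(α / 2)) :=
        Real.rpow_le_rpow_of_nonpos hn' (by linarith) (by linarith)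
      calc B n * ∫ ω, ‖Θ n ω - θ‖ ∂P ≤ (c⁻¹ * (n : ℝ) ^ α) * (√C₁ * (n : ℝ) ^ (-(α / 2))) :=
            mul_le_mul le_rfl ((hE n).trans (by gcongr))
              (integral_nonneg fun _ => norm_nonneg _) (by positivity)
        _ = c⁻¹ * √C₁ * ((n : ℝ) ^ α * (n : ℝ) ^ (-(α / 2))) := by ring
        _ = _ := by rw [← Real.rpow_add hn']; congr 2; ring
    calc _ ≤ (√n)⁻¹ * (c⁻¹ * √C₁ * ∑ k ∈ Finset.range n, ((k : ℝ) + 1) ^ (-(1 - α / 2))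
          + c⁻¹ * √C₁ * (n : ℝ) ^ (α / 2)) := by
          gcongr; linarith
      _ = c⁻¹ * √C₁ * ((√n)⁻¹ * ∑ k ∈ Finset.range n, ((k : ℝ) + 1) ^ (-(1 - α / 2)))
          + c⁻¹ * √C₁ * ((√n)⁻¹ * (n : ℝ) ^ (α / 2)) := by ring
      _ = _ := by rw [sqrt_mul_inv_eq n hn]; congr 3; ring
  have lim : Tendsto (fun n : ℕ =>
      c⁻¹ * √C₁ * ((√n)⁻¹ * ∑ k ∈ Finset.range n, ((k : ℝ) + 1) ^ (-(1 - α / 2)))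
        + c⁻¹ * √C₁ * (n : ℝ) ^ (-((1 - α) / 2))) atTop (nhds 0) := by
    have l1 := (tendsto_inv_sqrt_mul_sum_rpow_neg (s := 1 - α / 2) (by linarith)
      (by linarith)).const_mul (c⁻¹ * √C₁)
    have l2 := ((tendsto_rpow_neg_atTop (by linarith : 0 < (1 - α) / 2)).comp
      tendsto_natCast_atTop_atTop).const_mul (c⁻¹ * √C₁)
    simpa using l1.add l2
  refine squeeze_zero' (Eventually.of_forall fun n => ?_) ?_ lim
  · exact mul_nonneg (by positivity) (integral_nonneg fun _ => norm_nonneg _)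
  · filter_upwards [eventually_gt_atTop 0] with n hn using hbound n hn

/-- The linearised error plus the gradient noise at `θ`, summed up to time `n`. -/
def remainder (g : 𝒳 → E → E) (θ : E) (A : E →L[ℝ] E) (Y : ℕ → Ω → 𝒳) (Θ : ℕ → Ω → E)
    (n : ℕ) (ω : Ω) : E :=
  ∑ k ∈ Finset.range n, (A (Θ k ω - θ) + g (Y k ω) θ)

lemma memLp_remainder (h : IsRegularField g ν K θ A M L b C)
    (hP : IsProjectedAlgorithm P g ν K D θ π a Y Θ) (n : ℕ) :
    MemLp (remainder g θ A Y Θ n) 2 P := by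
  unfold remainder
  refine memLp_finsetSum _ fun k _ => MemLp.add ?_ ?_
  · exact A.comp_memLp' (memLp_error h hP k 2)
  · have : MemLp (fun x => g x θ) 2 ν := h.memLp_M.mono'
      (h.measurable.comp (by fun_prop : Measurable fun x => (x, θ))).aestronglyMeasurable
      (Eventually.of_forall fun x => h.norm_le x θ hP.theta_mem)
    exact hP.memLp_comp this k

/-- The remainder is `o(√n)` in `L¹`. It is the sum of the telescoping term `F1`, the projection
corrections, bounded by `F2`, the centred increments `F3`, and the linearization errors, bounded by
`F4`. -/
theorem tendsto_integral_norm_remainder {c α : ℝ} (hc : 0 < c) (hα0 : 1 / 2 < α) (hα1 : α < 1)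
    (h : IsRegularField g ν K θ A M L b C)
    (hP : IsProjectedAlgorithm P g ν K D θ π (stepSize c α) Y Θ) :
    Tendsto (fun n : ℕ => (√n)⁻¹ * ∫ ω, ‖remainder g θ A Y Θ n ω‖ ∂P) atTop (nhds 0) := by
  obtain ⟨C₁, hC₁, hu⟩ := exists_integral_sq_error_le hc (by linarith) hα1 h hP
  obtain ⟨C₂, hC₂, hres⟩ := exists_integral_norm_residual_le hc (by linarith) hα1 h hP
  set s : ℕ → ℝ := fun n => ∑ k ∈ Finset.range n, ((k : ℝ) + 1) ^ (-α) with hs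
  set L2 : ℝ := ∫ x, (L x + ∫ x', L x' ∂ν) ^ 2 ∂ν with hL2
  have hL20 : 0 ≤ L2 := integral_nonneg fun _ => sq_nonneg _
  set I : ℕ → ℝ := fun n => ∫ ω, ‖∑ k ∈ Finset.range n,
      (stepSize c α k)⁻¹ • ((Θ k ω - θ) - (Θ (k + 1) ω - θ))‖ ∂P with hI
  have hlim_s : Tendsto (fun n : ℕ => (√n)⁻¹ * s n) atTop (nhds 0) :=
    tendsto_inv_sqrt_mul_sum_rpow_neg hα0 hα1
  have hsum_u : ∀ n, ∑ k ∈ Finset.range n, ∫ ω, ‖Θ k ω - θ‖ ^ 2 ∂P ≤ C₁ * s n := by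
    intro n
    rw [hs, Finset.mul_sum]
    exact Finset.sum_le_sum fun k _ => hu k
  have hmain : ∀ n : ℕ, ∫ ω, ‖remainder g θ A Y Θ n ω‖ ∂P ≤
      I n + C₂ * s n + √(L2 * (C₁ * s n)) + C * (C₁ * s n) := by
    intro n
    set F1 : Ω → E := fun ω => ∑ k ∈ Finset.range n,
      (stepSize c α k)⁻¹ • ((Θ k ω - θ) - (Θ (k + 1) ω - θ)) with hF1
    set F2 : Ω → ℝ := fun ω => ∑ k ∈ Finset.range n,
      (stepSize c α k)⁻¹ * ‖residual g (stepSize c α) Y Θ k ω‖ with hF2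
    set F3 : Ω → E := fun ω => ∑ k ∈ Finset.range n, centredField g ν θ (Y k ω) (Θ k ω) with hF3
    set F4 : Ω → ℝ := fun ω => ∑ k ∈ Finset.range n, C * ‖Θ k ω - θ‖ ^ 2 with hF4
    have j1 : Integrable F1 P := by
      refine integrable_finsetSum _ fun k _ => Integrable.smul _ ?_
      exact (memLp_one_iff_integrable.1 (memLp_error h hP k 1)).sub
        (memLp_one_iff_integrable.1 (memLp_error h hP (k + 1) 1))
    have j2k : ∀ k, Integrable (fun ω =>
        (stepSize c α k)⁻¹ * ‖residual g (stepSize c α) Y Θ k ω‖) P :=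
      fun k => ((memLp_residual h hP k).integrable one_le_two).norm.const_mul _
    have j2 : Integrable F2 P := integrable_finsetSum _ fun k _ => j2k k
    have m3 : MemLp F3 2 P := memLp_sum_centred h hP n
    have j3 : Integrable F3 P := m3.integrable one_le_two
    have j4k : ∀ k, Integrable (fun ω => C * ‖Θ k ω - θ‖ ^ 2) P :=
      fun k => (integrable_sq_error h hP k).const_mul C
    have j4 : Integrable F4 P := integrable_finsetSum _ fun k _ => j4k k
    have hpt : ∀ ω, ‖remainder g θ A Y Θ n ω‖ ≤ ‖F1 ω‖ + F2 ω + ‖F3 ω‖ + F4 ω := by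
      intro ω
      have heq : remainder g θ A Y Θ n ω = F1 ω
          + ∑ k ∈ Finset.range n, (stepSize c α k)⁻¹ • residual g (stepSize c α) Y Θ k ω - F3 ω
          - ∑ k ∈ Finset.range n, ((∫ x, g x (Θ k ω) ∂ν) - A (Θ k ω - θ)) := by
        rw [remainder, hF1, hF3, ← Finset.sum_add_distrib, ← Finset.sum_sub_distrib,
          ← Finset.sum_sub_distrib]
        exact Finset.sum_congr rfl fun k _ =>
          linear_error_eq k ω (stepSize_pos hc α k).ne'
      rw [heq]
      refine (norm_sub_le _ _).trans (add_le_add ((norm_sub_le _ _).trans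
        (add_le_add ((norm_add_le _ _).trans (add_le_add le_rfl ?_)) le_rfl)) ?_)
      · refine (norm_sum_le _ _).trans (Finset.sum_le_sum fun k _ => ?_)
        rw [norm_smul, Real.norm_of_nonneg (inv_nonneg.2 (stepSize_pos hc α k).le)]
      · exact (norm_sum_le _ _).trans
          (Finset.sum_le_sum fun k _ => h.linearization _ (hP.mem k ω))
    have j12 : Integrable (fun ω => ‖F1 ω‖ + F2 ω) P := j1.norm.add j2
    have j123 : Integrable (fun ω => ‖F1 ω‖ + F2 ω + ‖F3 ω‖) P := j12.add j3.norm
    have e2 : ∫ ω, F2 ω ∂P ≤ C₂ * s n := by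
      rw [hF2, integral_finsetSum _ fun k _ => j2k k, hs, Finset.mul_sum]
      refine Finset.sum_le_sum fun k _ => ?_
      rw [integral_const_mul]
      exact hres k
    have e3 : ∫ ω, ‖F3 ω‖ ∂P ≤ √(L2 * (C₁ * s n)) := by
      refine (integral_norm_le_sqrt m3).trans (Real.sqrt_le_sqrt ?_)
      exact (integral_sq_sum_centred_le h hP n).trans (by gcongr; exact hsum_u n)
    have e4 : ∫ ω, F4 ω ∂P ≤ C * (C₁ * s n) := by
      rw [hF4, integral_finsetSum _ fun k _ => j4k k]
      simp_rw [integral_const_mul]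
      rw [← Finset.mul_sum]
      have := h.C_nonneg
      gcongr
      exact hsum_u n
    calc ∫ ω, ‖remainder g θ A Y Θ n ω‖ ∂P
        ≤ ∫ ω, (‖F1 ω‖ + F2 ω + ‖F3 ω‖ + F4 ω) ∂P :=
          integral_mono ((memLp_remainder h hP n).integrable one_le_two).norm (j123.add j4) hpt
      _ = ∫ ω, ‖F1 ω‖ ∂P + ∫ ω, F2 ω ∂P + ∫ ω, ‖F3 ω‖ ∂P + ∫ ω, F4 ω ∂P := by
          rw [integral_add j123 j4, integral_add j12 j3.norm, integral_add j1.norm j2]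
      _ ≤ _ := by gcongr
  -- `√(s n) / √n = √(n⁻¹ s n)`, and `n⁻¹ s n ≤ n^{-1/2} s n`.
  have hlim_sqrt : Tendsto (fun n : ℕ => (√n)⁻¹ * √(L2 * (C₁ * s n))) atTop (nhds 0) := by
    have l1 : Tendsto (fun n : ℕ => √(L2 * C₁ * ((√n)⁻¹ * s n))) atTop (nhds 0) := by
      have := (hlim_s.const_mul (L2 * C₁)).sqrt
      simpa using this
    refine squeeze_zero' (Eventually.of_forall fun n => by positivity) ?_ l1
    filter_upwards [eventually_ge_atTop 1] with n hn
    have hn1 : (1 : ℝ) ≤ √n := Real.one_le_sqrt.2 (by exact_mod_cast hn)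
    have hn0 : (0 : ℝ) < √n := by linarith
    have hs0 : 0 ≤ s n := Finset.sum_nonneg fun k _ => by positivity
    refine Real.le_sqrt_of_sq_le ?_
    rw [mul_pow, Real.sq_sqrt (by positivity)]
    have : (√n)⁻¹ ^ 2 ≤ (√n)⁻¹ := pow_le_of_le_one (by positivity)
      (inv_le_one_of_one_le₀ hn1) two_ne_zero
    calc (√n)⁻¹ ^ 2 * (L2 * (C₁ * s n)) ≤ (√n)⁻¹ * (L2 * (C₁ * s n)) := by gcongr
      _ = _ := by ring
  have hlim : Tendsto (fun n : ℕ => (√n)⁻¹ * I n + C₂ * ((√n)⁻¹ * s n)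
      + (√n)⁻¹ * √(L2 * (C₁ * s n)) + C * C₁ * ((√n)⁻¹ * s n)) atTop (nhds 0) := by
    have := (((tendsto_integral_norm_sum_increments hc hα0 hα1 h hP).add
      (hlim_s.const_mul C₂)).add hlim_sqrt).add (hlim_s.const_mul (C * C₁))
    simp only [mul_zero, add_zero] at this
    exact this
  refine squeeze_zero (fun n => ?_) (fun n => ?_) hlim
  · exact mul_nonneg (by positivity) (integral_nonneg fun _ => norm_nonneg _)
  · calc _ ≤ (√n)⁻¹ * (I n + C₂ * s n + √(L2 * (C₁ * s n)) + C * (C₁ * s n)) := by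
          gcongr; exact hmain n
      _ = _ := by ring

end IsProjectedAlgorithm

end AveragingCLT

section Normality

open scoped RealInnerProductSpace

variable {ι 𝒳 Ω : Type*} [Fintype ι] [DecidableEq ι] [MeasurableSpace 𝒳] [MeasurableSpace Ω]
  {P : Measure Ω} [IsProbabilityMeasure P] {g : 𝒳 → EuclideanSpace ℝ ι → EuclideanSpace ℝ ι}
  {ν : Measure 𝒳} [IsProbabilityMeasure ν] {K D : Set (EuclideanSpace ℝ ι)}
  {θ : EuclideanSpace ℝ ι} {A : EuclideanSpace ℝ ι →L[ℝ] EuclideanSpace ℝ ι} {M L : 𝒳 → ℝ}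
  {b C : ℝ} {π : EuclideanSpace ℝ ι → EuclideanSpace ℝ ι} {Y : ℕ → Ω → 𝒳}
  {Θ : ℕ → Ω → EuclideanSpace ℝ ι}

/-- Asymptotic normality of the averaged projected algorithm. With `B = A⁻¹`, the normalised
average is `-n^{-1/2} ∑ B g (Y k) θ`, to which the central limit theorem for i.i.d. vectors
applies, up to `B` applied to the negligible remainder. -/
theorem IsProjectedAlgorithm.tendstoInDistribution_average {c α : ℝ} (hc : 0 < c)
    (hα0 : 1 / 2 < α) (hα1 : α < 1)
    (h : IsRegularField g ν K θ A M L b C)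
    (hP : IsProjectedAlgorithm P g ν K D θ π (stepSize c α) Y Θ)
    (B : EuclideanSpace ℝ ι →L[ℝ] EuclideanSpace ℝ ι) (hB : ∀ y, B (A y) = y)
    {S : Matrix ι ι ℝ} (hS : S.PosSemidef)
    (hvar : ∀ t : EuclideanSpace ℝ ι, ∫ x, ⟪B (g x θ), t⟫ ^ 2 ∂ν = t ⬝ᵥ S.mulVec t) :
    TendstoInDistribution
      (fun (n : ℕ) ω => √n • ((n : ℝ)⁻¹ • ∑ k ∈ Finset.range n, Θ k ω - θ))
      atTop id (fun _ => P) (multivariateGaussian 0 S) := by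
  set f : 𝒳 → EuclideanSpace ℝ ι := fun x => -B (g x θ) with hf
  have hgm : Measurable fun x => g x θ :=
    h.measurable.comp (by fun_prop : Measurable fun x => (x, θ))
  have hfm : Measurable f := (B.measurable.comp hgm).neg
  have hgL2 : MemLp (fun x => g x θ) 2 ν := h.memLp_M.mono' hgm.aestronglyMeasurable
    (Eventually.of_forall fun x => h.norm_le x θ hP.theta_mem)
  have hfL2 : MemLp f 2 ν := (B.comp_memLp' hgL2).neg
  have hmean : ∫ x, f x ∂ν = 0 := by
    rw [hf, integral_neg, B.integral_comp_comm (hgL2.integrable one_le_two),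
      h.integral_eq_zero hP.theta_mem, map_zero, neg_zero]
  have hident : ∀ k, IdentDistrib (Y k) (Y 0) P P := fun k =>
    ⟨(hP.measurable_obs k).aemeasurable, (hP.measurable_obs 0).aemeasurable,
      by rw [hP.map_obs, hP.map_obs]⟩
  have hclt := tendstoInDistribution_inv_sqrt_smul_sum (P := P) (V := fun k ω => f (Y k ω)) hS
    (hP.indep_obs.comp (fun _ => f) fun _ => hfm)
    (fun k => (hident k).comp hfm) (hP.memLp_comp hfL2 0)
    (by rw [hP.integral_comp hfm.aestronglyMeasurable, hmean])
    (fun t => by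
      rw [hP.integral_comp (f := fun x => ⟪f x, t⟫ ^ 2) (by fun_prop), ← hvar t]
      simp [hf, inner_neg_left])
  have hrep : ∀ (n : ℕ) ω, √n • ((n : ℝ)⁻¹ • ∑ k ∈ Finset.range n, Θ k ω - θ) =
      (√n)⁻¹ • ∑ k ∈ Finset.range n, f (Y k ω) + (√n)⁻¹ • B (remainder g θ A Y Θ n ω) := by
    intro n ω
    rcases Nat.eq_zero_or_pos n with rfl | hn
    · simp
    have hn' : (0 : ℝ) < n := by exact_mod_cast hn
    have hsq : √(n : ℝ) * √n = n := Real.mul_self_sqrt hn'.le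
    have hs0 : √(n : ℝ) ≠ 0 := (Real.sqrt_pos.2 hn').ne'
    have h1 : ∑ k ∈ Finset.range n, f (Y k ω) + B (remainder g θ A Y Θ n ω) =
        ∑ k ∈ Finset.range n, (Θ k ω - θ) := by
      rw [remainder, map_sum, ← Finset.sum_add_distrib]
      refine Finset.sum_congr rfl fun k _ => ?_
      rw [map_add, hB, hf]; simp only; abel
    rw [← smul_add, h1, Finset.sum_sub_distrib, Finset.sum_const, Finset.card_range, smul_sub,
      smul_sub, smul_smul, ← Nat.cast_smul_eq_nsmul ℝ, smul_smul]
    congr 2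
    · have : (n : ℝ)⁻¹ = (√n)⁻¹ * (√n)⁻¹ := by rw [← mul_inv, hsq]
      rw [this, mul_inv_cancel_left₀ hs0]
    · rw [eq_inv_mul_iff_mul_eq₀ hs0, hsq]
  have hRm : ∀ n : ℕ, MemLp (fun ω => (√n)⁻¹ • B (remainder g θ A Y Θ n ω)) 2 P := by
    intro n
    have : MemLp (fun ω => B (remainder g θ A Y Θ n ω)) 2 P :=
      B.comp_memLp' (memLp_remainder h hP n)
    exact this.const_smul ((√n)⁻¹ : ℝ)
  refine tendstoInDistribution_of_tendstoInMeasure_sub _ _ hclt ?_ fun n => ?_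
  · refine tendstoInMeasure_of_tendsto_eLpNorm (p := 1) one_ne_zero (fun n => ?_)
      aestronglyMeasurable_zero ?_
    · refine ((hRm n).aestronglyMeasurable).congr (Eventually.of_forall fun ω => ?_)
      simp [hrep]
    · have hlim := (tendsto_integral_norm_remainder hc hα0 hα1 h hP).const_mul ‖B‖
      rw [mul_zero] at hlim
      have hle : ∀ n : ℕ, ∫ ω, ‖(√n)⁻¹ • B (remainder g θ A Y Θ n ω)‖ ∂P ≤
          ‖B‖ * ((√n)⁻¹ * ∫ ω, ‖remainder g θ A Y Θ n ω‖ ∂P) := by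
        intro n
        have i := ((memLp_remainder h hP n).integrable one_le_two).norm
        rw [← integral_const_mul, ← integral_const_mul]
        refine integral_mono ((hRm n).integrable one_le_two).norm
          ((i.const_mul _).const_mul _) fun ω => ?_
        simp only
        rw [norm_smul, norm_inv, Real.norm_of_nonneg (Real.sqrt_nonneg _), mul_left_comm]
        gcongr
        exact B.le_opNorm _
      have hlim2 := squeeze_zero (fun n => integral_nonneg fun _ => norm_nonneg _) hle hlim
      have hlim3 := (ENNReal.continuous_ofReal.tendsto 0).comp hlim2
      rw [ENNReal.ofReal_zero] at hlim3
      refine hlim3.congr fun n => ?_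
      simp only [Function.comp]
      rw [ofReal_integral_norm_eq_lintegral_enorm ((hRm n).integrable one_le_two),
        eLpNorm_one_eq_lintegral_enorm]
      refine lintegral_congr fun ω => ?_
      simp [hrep]
  · have := fun k => measurable h hP k
    fun_prop

end Normality

/-! ### Expansion of the norm and of the direction of a vector -/

section Direction

open scoped RealInnerProductSpace
open NormedSpace (normalize norm_smul_normalize norm_normalize)

variable {F : Type*} [NormedAddCommGroup F] [InnerProductSpace ℝ F]

lemma norm_normalize_le_one (v : F) : ‖normalize v‖ ≤ 1 := by
  by_cases hv : v = 0
  · simp [hv]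
  · exact (norm_normalize hv).le

/-- The identity behind the two expansions of the direction below: it trades a division by `‖v‖` for
the increment of the norm. -/
lemma norm_smul_normalize_sub (v h : F) :
    ‖v‖ • (normalize (v + h) - normalize v) = (‖v‖ - ‖v + h‖) • normalize (v + h) + h := by
  have h1 := norm_smul_normalize (v + h)
  have h2 := norm_smul_normalize v
  rw [smul_sub, sub_smul, h1, h2]
  abel

lemma norm_normalize_add_sub_le {v : F} (hv : v ≠ 0) (h : F) :
    ‖normalize (v + h) - normalize v‖ ≤ 2 * ‖h‖ * ‖v‖⁻¹ := by
  have hn : 0 < ‖v‖ := norm_pos_iff.2 hv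
  rw [← div_eq_mul_inv, le_div_iff₀ hn]
  calc ‖normalize (v + h) - normalize v‖ * ‖v‖
      = ‖‖v‖ • (normalize (v + h) - normalize v)‖ := by rw [norm_smul, norm_norm, mul_comm]
    _ ≤ ‖(‖v‖ - ‖v + h‖) • normalize (v + h)‖ + ‖h‖ := by
        rw [norm_smul_normalize_sub]; exact norm_add_le _ _
    _ ≤ ‖h‖ * 1 + ‖h‖ := by
        rw [norm_smul]
        gcongr
        · have := abs_norm_sub_norm_le v (v + h)
          simpa using this
        · exact norm_normalize_le_one _
    _ = 2 * ‖h‖ := by ring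

lemma inner_normalize_self (v : F) : ⟪normalize v, v⟫ = ‖v‖ := by
  by_cases hv : v = 0
  · simp [hv]
  · have hn : ‖v‖ ≠ 0 := norm_ne_zero_iff.2 hv
    rw [NormedSpace.normalize, real_inner_smul_left, real_inner_self_eq_norm_sq]
    field_simp

lemma abs_inner_normalize_le (v h : F) : |⟪normalize v, h⟫| ≤ ‖h‖ :=
  (abs_real_inner_le_norm _ _).trans
    (mul_le_of_le_one_left (norm_nonneg _) (norm_normalize_le_one v))

lemma abs_norm_add_sub_sub_inner_le {v : F} (hv : v ≠ 0) (h : F) :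
    |‖v + h‖ - ‖v‖ - ⟪normalize v, h⟫| ≤ 2 * ‖h‖ ^ 2 * ‖v‖⁻¹ := by
  have hn : 0 < ‖v‖ := norm_pos_iff.2 hv
  set p := ⟪normalize v, h⟫ with hp
  have hpv : ⟪v, h⟫ = ‖v‖ * p := by
    rw [hp, ← real_inner_smul_left, norm_smul_normalize]
  have hsq : ‖v + h‖ ^ 2 = ‖v‖ ^ 2 + 2 * (‖v‖ * p) + ‖h‖ ^ 2 := by
    rw [norm_add_sq_real, hpv]
  -- the norm is convex, so the remainder is nonnegative
  have hlow : ‖v‖ + p ≤ ‖v + h‖ := by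
    have h1 : ⟪normalize v, v + h⟫ ≤ ‖v + h‖ :=
      (le_abs_self _).trans (abs_inner_normalize_le v (v + h))
    rwa [inner_add_right, inner_normalize_self] at h1
  have hm : 0 ≤ ‖v + h‖ := norm_nonneg _
  have hd : |‖v + h‖ - ‖v‖| ≤ ‖h‖ := by
    simpa using abs_norm_sub_norm_le (v + h) v
  have hpabs : |p| ≤ ‖h‖ := abs_inner_normalize_le v h
  have hprod : (‖v‖ - ‖v + h‖) * p ≤ ‖h‖ ^ 2 := by
    calc (‖v‖ - ‖v + h‖) * p ≤ |(‖v‖ - ‖v + h‖) * p| := le_abs_self _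
      _ = |‖v + h‖ - ‖v‖| * |p| := by rw [abs_mul, abs_sub_comm]
      _ ≤ ‖h‖ * ‖h‖ := by gcongr
      _ = ‖h‖ ^ 2 := by ring
  rw [abs_of_nonneg (by linarith), ← div_eq_mul_inv, le_div_iff₀ hn]
  nlinarith

/-- Second-order expansion of the direction of `v + h`, with a remainder valid for all `h`. -/
lemma norm_normalize_add_sub_sub_le {v : F} (hv : v ≠ 0) (h : F) :
    ‖normalize (v + h) - normalize v - ‖v‖⁻¹ • (h - ⟪normalize v, h⟫ • normalize v)‖ ≤
      4 * ‖h‖ ^ 2 * (‖v‖ ^ 2)⁻¹ := by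
  have hn : 0 < ‖v‖ := norm_pos_iff.2 hv
  have key : ‖v‖ • (normalize (v + h) - normalize v
        - ‖v‖⁻¹ • (h - ⟪normalize v, h⟫ • normalize v)) =
      (‖v‖ - ‖v + h‖) • (normalize (v + h) - normalize v)
        - (‖v + h‖ - ‖v‖ - ⟪normalize v, h⟫) • normalize v := by
    rw [smul_sub, norm_smul_normalize_sub, smul_inv_smul₀ hn.ne']
    module
  have h1 : ‖(‖v‖ - ‖v + h‖) • (normalize (v + h) - normalize v)‖ ≤ 2 * ‖h‖ ^ 2 * ‖v‖⁻¹ := by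
    rw [norm_smul]
    calc _ ≤ ‖h‖ * (2 * ‖h‖ * ‖v‖⁻¹) := by
          gcongr
          · simpa using abs_norm_sub_norm_le v (v + h)
          · exact norm_normalize_add_sub_le hv h
      _ = _ := by ring
  have h2 : ‖(‖v + h‖ - ‖v‖ - ⟪normalize v, h⟫) • normalize v‖ ≤ 2 * ‖h‖ ^ 2 * ‖v‖⁻¹ := by
    rw [norm_smul, norm_normalize hv, mul_one]
    exact abs_norm_add_sub_sub_inner_le hv h
  have h3 : ‖v‖ * ‖normalize (v + h) - normalize v
        - ‖v‖⁻¹ • (h - ⟪normalize v, h⟫ • normalize v)‖ ≤ 4 * ‖h‖ ^ 2 * ‖v‖⁻¹ := by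
    calc _ = ‖‖v‖ • (normalize (v + h) - normalize v
          - ‖v‖⁻¹ • (h - ⟪normalize v, h⟫ • normalize v))‖ := by rw [norm_smul, norm_norm]
      _ ≤ _ := by rw [key]; exact (norm_sub_le _ _).trans (by linarith)
  rw [← le_inv_mul_iff₀ hn] at h3
  refine h3.trans_eq ?_
  rw [sq, sq, mul_inv]; ring

lemma measurable_normalize [MeasurableSpace F] [BorelSpace F] [SecondCountableTopology F] :
    Measurable (normalize : F → F) := by
  unfold NormedSpace.normalize
  fun_prop

end Direction

/-! ### The parameter space -/

section Parameters

open scoped RealInnerProductSpace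
open NormedSpace (normalize)

variable {d : ℕ}

@[simp] lemma Par.center_mk (z : Pt d) (a : ℝ) : (Par.mk z a).center = z := rfl

@[simp] lemma Par.radius_mk (z : Pt d) (a : ℝ) : (Par.mk z a).radius = a := rfl

@[simp] lemma Par.mk_center_radius (y : Par d) : Par.mk y.center y.radius = y := by
  ext i; rcases i with i | i <;> rfl

@[simp] lemma Par.center_sub (y y' : Par d) : (y - y').center = y.center - y'.center := rfl

@[simp] lemma Par.radius_sub (y y' : Par d) : (y - y').radius = y.radius - y'.radius := rfl

@[simp] lemma Par.radius_smul (c : ℝ) (y : Par d) : (c • y).radius = c * y.radius := rfl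

lemma Par.mk_sub_mk (z z' : Pt d) (a a' : ℝ) :
    Par.mk z a - Par.mk z' a' = Par.mk (z - z') (a - a') := by
  ext i; rcases i with i | i <;> rfl

lemma Par.inner_mk (z z' : Pt d) (a a' : ℝ) : ⟪Par.mk z a, Par.mk z' a'⟫ = ⟪z, z'⟫ + a * a' := by
  simp [PiLp.inner_apply, Par.mk, mul_comm]

lemma Par.norm_sq_mk (z : Pt d) (a : ℝ) : ‖Par.mk z a‖ ^ 2 = ‖z‖ ^ 2 + a ^ 2 := by
  rw [← real_inner_self_eq_norm_sq, Par.inner_mk, real_inner_self_eq_norm_sq]; ring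

lemma Par.norm_mk_le (z : Pt d) (a : ℝ) : ‖Par.mk z a‖ ≤ ‖z‖ + |a| := by
  refine abs_le_of_sq_le_sq' ?_ (by positivity) |>.2
  rw [Par.norm_sq_mk, ← sq_abs a]
  nlinarith [norm_nonneg z, abs_nonneg a]

lemma Par.norm_center_le (y : Par d) : ‖y.center‖ ≤ ‖y‖ := by
  refine abs_le_of_sq_le_sq' ?_ (norm_nonneg _) |>.2
  have := Par.norm_sq_mk y.center y.radius
  rw [Par.mk_center_radius] at this
  nlinarith [sq_nonneg y.radius]

lemma Par.abs_radius_le (y : Par d) : |y.radius| ≤ ‖y‖ := by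
  refine abs_le_of_sq_le_sq' ?_ (norm_nonneg _) |>.2
  have := Par.norm_sq_mk y.center y.radius
  rw [Par.mk_center_radius] at this
  rw [sq_abs]
  nlinarith [sq_nonneg ‖y.center‖]

lemma Par.continuous_mk : Continuous fun p : Pt d × ℝ => Par.mk p.1 p.2 := by
  refine (PiLp.continuous_toLp 2 _).comp (continuous_pi fun i => ?_)
  rcases i with i | i
  · simp only [Sum.elim_inl]; fun_prop
  · simp only [Sum.elim_inr]; fun_prop

lemma Par.continuous_center : Continuous (Par.center : Par d → Pt d) := by
  unfold Par.center; fun_prop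

lemma Par.continuous_radius : Continuous (Par.radius : Par d → ℝ) := by
  unfold Par.radius; fun_prop

/-! ### Pointwise bounds on the gradient -/

lemma gradG_eq (x : Pt d) (y : Par d) : gradG x y =
    Par.mk (y.center - x - y.radius • normalize (y.center - x)) (y.radius - ‖y.center - x‖) := by
  rw [gradG, NormedSpace.normalize, smul_smul, div_eq_mul_inv]

lemma measurable_gradG : Measurable (Function.uncurry (gradG : Pt d → Par d → Par d)) := by
  have hc : Measurable fun p : Pt d × Par d => p.2.center :=
    Par.continuous_center.measurable.comp measurable_snd
  have hr : Measurable fun p : Pt d × Par d => p.2.radius :=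
    Par.continuous_radius.measurable.comp measurable_snd
  have hw : Measurable fun p : Pt d × Par d => p.2.center - p.1 := hc.sub measurable_fst
  have : Function.uncurry (gradG : Pt d → Par d → Par d) = fun p : Pt d × Par d =>
      (fun q : Pt d × ℝ => Par.mk q.1 q.2) (p.2.center - p.1
        - p.2.radius • normalize (p.2.center - p.1), p.2.radius - ‖p.2.center - p.1‖) := by
    funext p; exact gradG_eq p.1 p.2
  rw [this]
  exact Par.continuous_mk.measurable.comp
    ((hw.sub (hr.smul (measurable_normalize.comp hw))).prodMk (hr.sub hw.norm))

lemma norm_gradG_le (x : Pt d) (y : Par d) (μ : Pt d) :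
    ‖gradG x y‖ ≤ 2 * ‖x - μ‖ + 2 * ‖y.center - μ‖ + 2 * |y.radius| := by
  have hw : ‖y.center - x‖ ≤ ‖y.center - μ‖ + ‖x - μ‖ := by
    rw [norm_sub_rev x μ]; exact norm_sub_le_norm_sub_add_norm_sub _ _ _
  rw [gradG_eq]
  have h1 : ‖y.center - x - y.radius • normalize (y.center - x)‖ ≤
      ‖y.center - x‖ + |y.radius| := by
    refine (norm_sub_le _ _).trans ?_
    rw [norm_smul, Real.norm_eq_abs]
    gcongr
    exact mul_le_of_le_one_right (abs_nonneg _) (norm_normalize_le_one _)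
  have h2 : |y.radius - ‖y.center - x‖| ≤ |y.radius| + ‖y.center - x‖ := by
    refine (abs_sub _ _).trans ?_
    rw [abs_norm]
  linarith [Par.norm_mk_le (y.center - x - y.radius • normalize (y.center - x))
    (y.radius - ‖y.center - x‖)]

lemma norm_gradG_sub_le {x μ : Pt d} (hx : x ≠ μ) (y : Par d) (ρ : ℝ) :
    ‖gradG x y - gradG x (Par.mk μ ρ)‖ ≤
      (4 + 2 * |ρ| * ‖x - μ‖⁻¹) * ‖y - Par.mk μ ρ‖ := by
  set v := μ - x with hv
  have hv0 : v ≠ 0 := sub_ne_zero.2 hx.symm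
  set h := (y - Par.mk μ ρ).center with hh
  set b := (y - Par.mk μ ρ).radius with hb
  have hc : y.center - x = v + h := by simp [hh, hv]
  have hr : y.radius = ρ + b := by simp [hb]
  have hhn : ‖h‖ ≤ ‖y - Par.mk μ ρ‖ := Par.norm_center_le _
  have hbn : |b| ≤ ‖y - Par.mk μ ρ‖ := Par.abs_radius_le _
  have heq : gradG x y - gradG x (Par.mk μ ρ) =
      Par.mk (h - b • normalize (v + h) - ρ • (normalize (v + h) - normalize v))
        (b - (‖v + h‖ - ‖v‖)) := by
    rw [gradG_eq, gradG_eq, Par.mk_sub_mk, hc, hr, Par.center_mk, Par.radius_mk, ← hv]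
    congr 1
    · module
    · ring
  rw [heq]
  refine (Par.norm_mk_le _ _).trans ?_
  have h1 : ‖h - b • normalize (v + h) - ρ • (normalize (v + h) - normalize v)‖ ≤
      ‖h‖ + |b| + |ρ| * (2 * ‖h‖ * ‖v‖⁻¹) := by
    refine (norm_sub_le _ _).trans (add_le_add ((norm_sub_le _ _).trans ?_) ?_)
    · rw [norm_smul, Real.norm_eq_abs]
      gcongr
      exact mul_le_of_le_one_right (abs_nonneg _) (norm_normalize_le_one _)
    · rw [norm_smul, Real.norm_eq_abs]
      gcongr
      exact norm_normalize_add_sub_le hv0 h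
  have h2 : |b - (‖v + h‖ - ‖v‖)| ≤ |b| + ‖h‖ := by
    refine (abs_sub _ _).trans ?_
    gcongr
    simpa using abs_norm_sub_norm_le (v + h) v
  have hnv : ‖v‖ = ‖x - μ‖ := norm_sub_rev _ _
  rw [← hnv]
  calc _ ≤ 2 * ‖h‖ + 2 * |b| + 2 * |ρ| * ‖v‖⁻¹ * ‖h‖ := by linarith
    _ ≤ 2 * ‖y - Par.mk μ ρ‖ + 2 * ‖y - Par.mk μ ρ‖
        + 2 * |ρ| * ‖v‖⁻¹ * ‖y - Par.mk μ ρ‖ := by gcongr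
    _ = _ := by ring

/-- The Hessian at `(μ, ρ)` of the loss of the single observation `x`. -/
def hessianAt (μ : Pt d) (ρ : ℝ) (x : Pt d) : Matrix (Fin d ⊕ Unit) (Fin d ⊕ Unit) ℝ :=
  Matrix.fromBlocks
    (1 - ρ • Matrix.of fun i j => ‖x - μ‖⁻¹ *
      ((1 : Matrix (Fin d) (Fin d) ℝ) i j - (x i - μ i) * (x j - μ j) / ‖x - μ‖ ^ 2))
    (Matrix.of fun i _ => (x i - μ i) / ‖x - μ‖)
    (Matrix.of fun i _ => (x i - μ i) / ‖x - μ‖).transpose 1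

lemma toEuclideanCLM_hessianAt (μ : Pt d) (ρ : ℝ) (x : Pt d) (w : Par d) :
    Matrix.toEuclideanCLM (𝕜 := ℝ) (hessianAt μ ρ x) w =
      Par.mk (w.center - ρ • (‖μ - x‖⁻¹ • (w.center
          - ⟪normalize (μ - x), w.center⟫ • normalize (μ - x))) - w.radius • normalize (μ - x))
        (w.radius - ⟪normalize (μ - x), w.center⟫) := by
  have hinner : ⟪normalize (μ - x), w.center⟫ =
      -(‖x - μ‖⁻¹ * ∑ j, (x j - μ j) * w (Sum.inl j)) := by
    rw [NormedSpace.normalize, norm_sub_rev, real_inner_smul_left, PiLp.inner_apply,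
      ← mul_neg, ← Finset.sum_neg_distrib]
    congr 1
    refine Finset.sum_congr rfl fun j _ => ?_
    simp [Par.center]
    ring
  rw [hinner, NormedSpace.normalize, norm_sub_rev μ x]
  ext i
  rw [Matrix.ofLp_toEuclideanCLM]
  rcases i with i | i
  · simp only [hessianAt, Matrix.mulVec, dotProduct, Fintype.sum_sum_type, Par.mk,
      Matrix.fromBlocks_apply₁₁, Matrix.fromBlocks_apply₁₂, Matrix.sub_apply, Matrix.smul_apply,
      Matrix.of_apply, Sum.elim_inl, PiLp.sub_apply, PiLp.smul_apply, smul_eq_mul,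
      Finset.univ_unique, Finset.sum_singleton, Par.radius]
    have e1 : ∑ j, (1 : Matrix (Fin d) (Fin d) ℝ) i j * w (Sum.inl j) = w (Sum.inl i) := by
      simp [Matrix.one_apply]
    have e2 : ∑ j, ((1 : Matrix (Fin d) (Fin d) ℝ) i j
          - ρ * (‖x - μ‖⁻¹ * ((1 : Matrix (Fin d) (Fin d) ℝ) i j
            - (x i - μ i) * (x j - μ j) / ‖x - μ‖ ^ 2))) * w (Sum.inl j) =
        w (Sum.inl i) - ρ * (‖x - μ‖⁻¹ * (w (Sum.inl i) - (x i - μ i) / ‖x - μ‖ ^ 2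
          * ∑ j, (x j - μ j) * w (Sum.inl j))) := by
      rw [← e1, Finset.mul_sum, ← Finset.sum_sub_distrib, Finset.mul_sum, Finset.mul_sum,
        ← Finset.sum_sub_distrib]
      refine Finset.sum_congr rfl fun j _ => ?_
      ring
    rw [e2]
    simp only [Par.center]
    ring
  · simp only [hessianAt, Matrix.mulVec, dotProduct, Fintype.sum_sum_type, Par.mk,
      Matrix.fromBlocks_apply₂₁, Matrix.fromBlocks_apply₂₂, Matrix.transpose_apply,
      Matrix.of_apply, Sum.elim_inr, Finset.univ_unique, Finset.sum_singleton, Par.radius]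
    rw [sub_neg_eq_add, Finset.mul_sum, add_comm]
    congr 1
    · simp
    · refine Finset.sum_congr rfl fun j _ => ?_
      ring

/-- First-order expansion of the gradient at `(μ, ρ)`; the remainder is integrable in `x` as soon as
`‖x - μ‖⁻²` is. -/
lemma norm_gradG_sub_sub_hessianAt_le {x μ : Pt d} (hx : x ≠ μ) (y : Par d) (ρ : ℝ) :
    ‖gradG x y - gradG x (Par.mk μ ρ)
        - Matrix.toEuclideanCLM (𝕜 := ℝ) (hessianAt μ ρ x) (y - Par.mk μ ρ)‖ ≤
      (4 * ‖x - μ‖⁻¹ + 4 * |ρ| * (‖x - μ‖ ^ 2)⁻¹) * ‖y - Par.mk μ ρ‖ ^ 2 := by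
  rw [toEuclideanCLM_hessianAt]
  set v := μ - x with hv
  have hv0 : v ≠ 0 := sub_ne_zero.2 hx.symm
  set h := (y - Par.mk μ ρ).center with hh
  set b := (y - Par.mk μ ρ).radius with hb
  have hc : y.center - x = v + h := by simp [hh, hv]
  have hr : y.radius = ρ + b := by simp [hb]
  have hhn : ‖h‖ ≤ ‖y - Par.mk μ ρ‖ := Par.norm_center_le _
  have hbn : |b| ≤ ‖y - Par.mk μ ρ‖ := Par.abs_radius_le _
  have heq : gradG x y - gradG x (Par.mk μ ρ) - Par.mk (h - ρ • (‖v‖⁻¹ • (h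
          - ⟪normalize v, h⟫ • normalize v)) - b • normalize v) (b - ⟪normalize v, h⟫) =
      Par.mk (-(b • (normalize (v + h) - normalize v)) - ρ • (normalize (v + h) - normalize v
          - ‖v‖⁻¹ • (h - ⟪normalize v, h⟫ • normalize v)))
        (-(‖v + h‖ - ‖v‖ - ⟪normalize v, h⟫)) := by
    rw [gradG_eq, gradG_eq, Par.mk_sub_mk, Par.mk_sub_mk, hc, hr, Par.center_mk, Par.radius_mk,
      ← hv]
    congr 1
    · module
    · ring
  rw [heq]
  refine (Par.norm_mk_le _ _).trans ?_
  rw [abs_neg]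
  have h1 : ‖-(b • (normalize (v + h) - normalize v)) - ρ • (normalize (v + h) - normalize v
          - ‖v‖⁻¹ • (h - ⟪normalize v, h⟫ • normalize v))‖ ≤
      |b| * (2 * ‖h‖ * ‖v‖⁻¹) + |ρ| * (4 * ‖h‖ ^ 2 * (‖v‖ ^ 2)⁻¹) := by
    refine (norm_sub_le _ _).trans (add_le_add ?_ ?_)
    · rw [norm_neg, norm_smul, Real.norm_eq_abs]
      gcongr
      exact norm_normalize_add_sub_le hv0 h
    · rw [norm_smul, Real.norm_eq_abs]
      gcongr
      exact norm_normalize_add_sub_sub_le hv0 h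
  have h2 := abs_norm_add_sub_sub_inner_le hv0 h
  have hnv : ‖v‖ = ‖x - μ‖ := norm_sub_rev _ _
  rw [← hnv]
  set T := ‖y - Par.mk μ ρ‖ with hT
  calc _ ≤ |b| * (2 * ‖h‖ * ‖v‖⁻¹) + |ρ| * (4 * ‖h‖ ^ 2 * (‖v‖ ^ 2)⁻¹)
        + 2 * ‖h‖ ^ 2 * ‖v‖⁻¹ := by linarith
    _ ≤ T * (2 * T * ‖v‖⁻¹) + |ρ| * (4 * T ^ 2 * (‖v‖ ^ 2)⁻¹) + 2 * T ^ 2 * ‖v‖⁻¹ := by gcongr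
    _ = _ := by ring

end Parameters

/-! ### The mean gradient near the target -/

section MeanGradient

open scoped RealInnerProductSpace

variable {d : ℕ}

/-- The properties of the law `ν` of the observation which the analysis uses: no atoms, the moments
of order `2` and `-2` of the distance to `μ`, and the two identities which make the mean gradient
vanish at `(μ, ρ)`. -/
structure IsCentredLaw (ν : Measure (Pt d)) (μ : Pt d) (ρ : ℝ) : Prop where
  noAtom : ∀ z, ν {z} = 0
  integrable_sq : Integrable (fun x => ‖x - μ‖ ^ 2) ν
  integrable_inv_sq : Integrable (fun x => (‖x - μ‖ ^ 2)⁻¹) ν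
  integral_norm : ∫ x, ‖x - μ‖ ∂ν = ρ
  integral_sub : ∫ x, (x - μ) ∂ν = ρ • ∫ x, NormedSpace.normalize (x - μ) ∂ν

/-- `Par.mk` as a continuous linear map. -/
def Par.mkL (d : ℕ) : Pt d × ℝ →L[ℝ] Par d :=
  LinearMap.toContinuousLinearMap
    { toFun := fun p => Par.mk p.1 p.2
      map_add' := fun p q => by ext i; rcases i with i | i <;> rfl
      map_smul' := fun c p => by ext i; rcases i with i | i <;> rfl }

lemma Par.integral_mk {Ω : Type*} [MeasurableSpace Ω] {P : Measure Ω} {f : Ω → Pt d} {r : Ω → ℝ}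
    (hf : Integrable f P) (hr : Integrable r P) :
    ∫ ω, Par.mk (f ω) (r ω) ∂P = Par.mk (∫ ω, f ω ∂P) (∫ ω, r ω ∂P) := by
  have h := (Par.mkL d).integral_comp_comm (hf.prodMk hr)
  rw [integral_pair hf hr] at h
  exact h

namespace IsCentredLaw

variable {ν : Measure (Pt d)} [IsProbabilityMeasure ν] {μ : Pt d} {ρ : ℝ}

lemma ae_ne (h : IsCentredLaw ν μ ρ) (z : Pt d) : ∀ᵐ x ∂ν, x ≠ z := by
  rw [ae_iff]
  simpa using h.noAtom z

lemma memLp_norm (h : IsCentredLaw ν μ ρ) : MemLp (fun x => ‖x - μ‖) 2 ν := by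
  rw [memLp_two_iff_integrable_sq (by fun_prop)]
  exact h.integrable_sq

lemma memLp_inv (h : IsCentredLaw ν μ ρ) : MemLp (fun x => ‖x - μ‖⁻¹) 2 ν := by
  rw [memLp_two_iff_integrable_sq (by fun_prop)]
  simpa only [inv_pow] using h.integrable_inv_sq

lemma integrable_sub (h : IsCentredLaw ν μ ρ) : Integrable (fun x => x - μ) ν := by
  have := h.memLp_norm.integrable one_le_two
  exact (integrable_norm_iff (by fun_prop)).1 this

lemma integrable_normalize_sub (z : Pt d) :
    Integrable (fun x => NormedSpace.normalize (x - z)) ν :=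
  Integrable.of_bound (measurable_normalize.comp (measurable_id.sub_const z)).aestronglyMeasurable
    1 (Eventually.of_forall fun _ => norm_normalize_le_one _)

lemma integral_gradG_eq_zero (h : IsCentredLaw ν μ ρ) :
    ∫ x, gradG x (Par.mk μ ρ) ∂ν = 0 := by
  have e : ∀ x, gradG x (Par.mk μ ρ) =
      Par.mk (ρ • NormedSpace.normalize (x - μ) - (x - μ)) (ρ - ‖x - μ‖) := by
    intro x
    rw [gradG_eq, Par.center_mk, Par.radius_mk, norm_sub_rev μ x, ← neg_sub x μ,
      NormedSpace.normalize_neg]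
    congr 1
    module
  simp_rw [e]
  have i1 : Integrable (fun x => ρ • NormedSpace.normalize (x - μ)) ν :=
    (integrable_normalize_sub (ν := ν) μ).smul ρ
  have i2 : Integrable (fun x => ρ • NormedSpace.normalize (x - μ) - (x - μ)) ν :=
    i1.sub h.integrable_sub
  have i3 : Integrable (fun x => ρ - ‖x - μ‖) ν :=
    (integrable_const ρ).sub (h.memLp_norm.integrable one_le_two)
  rw [Par.integral_mk i2 i3]
  have e1 : ∫ x, (ρ • NormedSpace.normalize (x - μ) - (x - μ)) ∂ν = 0 := by
    rw [MeasureTheory.integral_sub i1 h.integrable_sub, integral_smul, h.integral_sub, sub_self]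
  have e2 : ∫ x, (ρ - ‖x - μ‖) ∂ν = 0 := by
    rw [MeasureTheory.integral_sub (integrable_const ρ) (h.memLp_norm.integrable one_le_two),
      h.integral_norm]
    simp
  rw [e1, e2]
  ext i; rcases i with i | i <;> rfl

lemma abs_coord_div_norm_le (v : Pt d) (i : Fin d) : |v i / ‖v‖| ≤ 1 := by
  rw [abs_div, abs_norm]
  exact div_le_one_of_le₀ (PiLp.norm_apply_le v i) (norm_nonneg _)

lemma abs_curv_entry_le (v : Pt d) (i j : Fin d) :
    |‖v‖⁻¹ * ((1 : Matrix (Fin d) (Fin d) ℝ) i j - v i * v j / ‖v‖ ^ 2)| ≤ 2 * ‖v‖⁻¹ := by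
  have h1 : |(1 : Matrix (Fin d) (Fin d) ℝ) i j| ≤ 1 := by
    rw [Matrix.one_apply]; split_ifs <;> simp
  have h2 : |v i * v j / ‖v‖ ^ 2| ≤ 1 := by
    rw [sq, mul_div_mul_comm, abs_mul]
    exact mul_le_one₀ (abs_coord_div_norm_le v i) (abs_nonneg _) (abs_coord_div_norm_le v j)
  rw [abs_mul, abs_inv, abs_norm, mul_comm]
  gcongr
  exact (abs_sub _ _).trans (by linarith)

lemma integrable_curv_entry {z : Pt d} (hz : Integrable (fun x => ‖x - z‖⁻¹) ν) (i j : Fin d) :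
    Integrable (fun x : Pt d => ‖x - z‖⁻¹ *
      ((1 : Matrix (Fin d) (Fin d) ℝ) i j - (x i - z i) * (x j - z j) / ‖x - z‖ ^ 2)) ν :=
  (hz.const_mul 2).mono' (Measurable.aestronglyMeasurable (by fun_prop))
    (Eventually.of_forall fun x => abs_curv_entry_le (x - z) i j)

lemma integrable_direction_entry (i : Fin d) :
    Integrable (fun x : Pt d => (x i - μ i) / ‖x - μ‖) ν :=
  Integrable.of_bound (Measurable.aestronglyMeasurable (by fun_prop)) 1
    (Eventually.of_forall fun x => abs_coord_div_norm_le (x - μ) i)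

lemma integrable_hessianAt (h : IsCentredLaw ν μ ρ) (i j : Fin d ⊕ Unit) :
    Integrable (fun x => hessianAt μ ρ x i j) ν := by
  have hz := h.memLp_inv.integrable one_le_two
  rcases i with i | i <;> rcases j with j | j <;> simp only [hessianAt,
    Matrix.fromBlocks_apply₁₁, Matrix.fromBlocks_apply₁₂, Matrix.fromBlocks_apply₂₁,
    Matrix.fromBlocks_apply₂₂, Matrix.transpose_apply, Matrix.sub_apply, Matrix.smul_apply,
    Matrix.of_apply, smul_eq_mul]
  · exact (integrable_const _).sub ((integrable_curv_entry hz i j).const_mul ρ)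
  · exact integrable_direction_entry i
  · exact integrable_direction_entry j
  · exact integrable_const _

lemma integral_hessianAt (h : IsCentredLaw ν μ ρ) (i j : Fin d ⊕ Unit) :
    ∫ x, hessianAt μ ρ x i j ∂ν = hessian ν id μ ρ i j := by
  have hz := h.memLp_inv.integrable one_le_two
  rcases i with i | i <;> rcases j with j | j <;> simp only [hessianAt, hessian,
    Matrix.fromBlocks_apply₁₁, Matrix.fromBlocks_apply₁₂, Matrix.fromBlocks_apply₂₁,
    Matrix.fromBlocks_apply₂₂, Matrix.transpose_apply, Matrix.sub_apply, Matrix.smul_apply,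
    Matrix.of_apply, smul_eq_mul, curvMatrix, meanDirection, id]
  · rw [MeasureTheory.integral_sub (integrable_const _)
      ((integrable_curv_entry hz i j).const_mul ρ), integral_const_mul]
    simp
  · simp

lemma integral_toEuclideanCLM_hessianAt (h : IsCentredLaw ν μ ρ) (w : Par d) :
    Integrable (fun x => Matrix.toEuclideanCLM (𝕜 := ℝ) (hessianAt μ ρ x) w) ν ∧
    ∫ x, Matrix.toEuclideanCLM (𝕜 := ℝ) (hessianAt μ ρ x) w ∂ν =
      Matrix.toEuclideanCLM (𝕜 := ℝ) (hessian ν id μ ρ) w := by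
  have hcoord : ∀ i j, Integrable (fun x => hessianAt μ ρ x i j * w j) ν :=
    fun i j => (h.integrable_hessianAt i j).mul_const _
  have hint : ∀ i, Integrable (fun x =>
      (Matrix.toEuclideanCLM (𝕜 := ℝ) (hessianAt μ ρ x) w : Par d) i) ν := by
    intro i
    simp only [Matrix.ofLp_toEuclideanCLM, Matrix.mulVec, dotProduct]
    exact integrable_finsetSum _ fun j _ => hcoord i j
  refine ⟨Integrable.of_eval_piLp hint, ?_⟩
  ext i
  rw [eval_integral_piLp hint]
  simp only [Matrix.ofLp_toEuclideanCLM, Matrix.mulVec, dotProduct]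
  rw [integral_finsetSum _ fun j _ => hcoord i j]
  refine Finset.sum_congr rfl fun j _ => ?_
  rw [integral_mul_const, h.integral_hessianAt]

lemma integrable_gradG (h : IsCentredLaw ν μ ρ) (y : Par d) : Integrable (fun x => gradG x y) ν := by
  have i := h.memLp_norm.integrable one_le_two
  refine (((i.const_mul 2).add (integrable_const (2 * ‖y.center - μ‖))).add
    (integrable_const (2 * |y.radius|))).mono'
    (measurable_gradG.comp (by fun_prop : Measurable fun x : Pt d => (x, y))).aestronglyMeasurable
    (Eventually.of_forall fun x => norm_gradG_le x y μ)

/-- The mean gradient is differentiable at the target, with a quadratic remainder. -/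
lemma norm_integral_gradG_sub_le (h : IsCentredLaw ν μ ρ) (y : Par d) :
    ‖(∫ x, gradG x y ∂ν) - Matrix.toEuclideanCLM (𝕜 := ℝ) (hessian ν id μ ρ) (y - Par.mk μ ρ)‖ ≤
      (∫ x, (4 * ‖x - μ‖⁻¹ + 4 * |ρ| * (‖x - μ‖ ^ 2)⁻¹) ∂ν) * ‖y - Par.mk μ ρ‖ ^ 2 := by
  obtain ⟨i1, e1⟩ := h.integral_toEuclideanCLM_hessianAt (y - Par.mk μ ρ)
  have i2 : Integrable (fun x => gradG x y - gradG x (Par.mk μ ρ)) ν :=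
    (h.integrable_gradG y).sub (h.integrable_gradG _)
  have e2 : (∫ x, gradG x y ∂ν)
      - Matrix.toEuclideanCLM (𝕜 := ℝ) (hessian ν id μ ρ) (y - Par.mk μ ρ) =
      ∫ x, (gradG x y - gradG x (Par.mk μ ρ)
        - Matrix.toEuclideanCLM (𝕜 := ℝ) (hessianAt μ ρ x) (y - Par.mk μ ρ)) ∂ν := by
    rw [MeasureTheory.integral_sub i2 i1,
      MeasureTheory.integral_sub (h.integrable_gradG y) (h.integrable_gradG _),
      h.integral_gradG_eq_zero, sub_zero, e1]
  rw [e2, ← integral_mul_const]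
  refine norm_integral_le_of_norm_le ?_ ?_
  · exact (((h.memLp_inv.integrable one_le_two).const_mul 4).add
      (h.integrable_inv_sq.const_mul (4 * |ρ|))).mul_const _
  · filter_upwards [h.ae_ne μ] with x hx using norm_gradG_sub_sub_hessianAt_le hx y ρ

/-- The gradient field is regular on every bounded set on which its mean is strongly monotone. -/
lemma isRegularField (h : IsCentredLaw ν μ ρ) {K : Set (Par d)} {R b : ℝ} (hb : 0 < b)
    (hK : ∀ y ∈ K, 2 * ‖y.center - μ‖ + 2 * |y.radius| ≤ R)
    (hmono : ∀ y ∈ K, b * ‖y - Par.mk μ ρ‖ ^ 2 ≤ ⟪∫ x, gradG x y ∂ν, y - Par.mk μ ρ⟫) :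
    IsRegularField gradG ν K (Par.mk μ ρ) (Matrix.toEuclideanCLM (𝕜 := ℝ) (hessian ν id μ ρ))
      (fun x => 2 * ‖x - μ‖ + R) (fun x => 4 + 2 * |ρ| * ‖x - μ‖⁻¹) b
      (∫ x, (4 * ‖x - μ‖⁻¹ + 4 * |ρ| * (‖x - μ‖ ^ 2)⁻¹) ∂ν) := by
  have hM : MemLp (fun x => 2 * ‖x - μ‖ + R) 2 ν := (h.memLp_norm.const_mul 2).add (memLp_const R)
  have hL : MemLp (fun x => 4 + 2 * |ρ| * ‖x - μ‖⁻¹) 2 ν :=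
    (memLp_const (4 : ℝ)).add (h.memLp_inv.const_mul (2 * |ρ|))
  have hMm : Measurable fun x => 2 * ‖x - μ‖ + R := by fun_prop
  have hLm : Measurable fun x => 4 + 2 * |ρ| * ‖x - μ‖⁻¹ := by fun_prop
  have hlip : ∀ᵐ x ∂ν, ∀ y ∈ K, ‖gradG x y - gradG x (Par.mk μ ρ)‖ ≤
      (4 + 2 * |ρ| * ‖x - μ‖⁻¹) * ‖y - Par.mk μ ρ‖ := by
    filter_upwards [h.ae_ne μ] with x hx y _ using norm_gradG_sub_le hx y ρ
  exact
    { measurable := measurable_gradG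
      measurable_M := hMm
      measurable_L := hLm
      memLp_M := hM
      memLp_L := hL
      L_nonneg := fun x => by positivity
      norm_le := fun x y hy => by linarith [norm_gradG_le x y μ, hK y hy]
      norm_sub_le := hlip
      b_pos := hb
      monotone := hmono
      C_nonneg := integral_nonneg fun x => by positivity
      linearization := fun y _ => h.norm_integral_gradG_sub_le y }

end IsCentredLaw

end MeanGradient

/-! ### The curvature matrix as a quadratic form -/

section Curvature

open scoped RealInnerProductSpace MatrixOrder

variable {d : ℕ}

/-- The largest eigenvalue bounds the quadratic form. -/
lemma dotProduct_mulVec_le_lambdaMax {T : Matrix (Fin d) (Fin d) ℝ} (hT : T.IsHermitian)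
    (h : Pt d) : h ⬝ᵥ T.mulVec h ≤ lambdaMax T * ‖h‖ ^ 2 := by
  have hbdd : BddAbove (spectrum ℝ T) := by
    rw [hT.spectrum_real_eq_range_eigenvalues]
    exact (Set.finite_range _).bddAbove
  have hle : T ≤ algebraMap ℝ (Matrix (Fin d) (Fin d) ℝ) (lambdaMax T) :=
    le_algebraMap_of_spectrum_le (fun x hx => le_csSup hbdd hx) hT
  have hpsd := (Matrix.le_iff.1 hle).dotProduct_mulVec_nonneg (h : Fin d → ℝ)
  have hnorm : ‖h‖ ^ 2 = h ⬝ᵥ (h : Fin d → ℝ) := by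
    rw [EuclideanSpace.real_norm_sq_eq, dotProduct]
    exact Finset.sum_congr rfl fun i _ => by ring
  rw [Matrix.sub_mulVec, dotProduct_sub, Matrix.algebraMap_eq_diagonal] at hpsd
  have hdiag : Matrix.diagonal (algebraMap ℝ (Fin d → ℝ) (lambdaMax T)) =
      lambdaMax T • (1 : Matrix (Fin d) (Fin d) ℝ) := by
    rw [Matrix.smul_one_eq_diagonal]; rfl
  rw [hdiag, Matrix.smul_mulVec, Matrix.one_mulVec, dotProduct_smul, smul_eq_mul] at hpsd
  simp only [star_trivial] at hpsd
  rw [hnorm]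
  linarith

lemma isHermitian_curvMatrix {Ω₀ : Type*} [MeasurableSpace Ω₀] (P₀ : Measure Ω₀) (X : Ω₀ → Pt d)
    (z : Pt d) : (curvMatrix P₀ X z).IsHermitian := by
  ext i j
  simp only [Matrix.conjTranspose_apply, curvMatrix, Matrix.of_apply, star_trivial]
  refine integral_congr_ae (Eventually.of_forall fun ω => ?_)
  simp only [Matrix.one_apply, eq_comm (a := i) (b := j), mul_comm (X ω i - z i)]

/-- The second derivative of the norm at `w` in the direction `h`. -/
def normSecondDeriv {F : Type*} [NormedAddCommGroup F] [InnerProductSpace ℝ F] (h w : F) : ℝ :=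
  ‖w‖⁻¹ * (‖h‖ ^ 2 - ⟪NormedSpace.normalize w, h⟫ ^ 2)

lemma normSecondDeriv_nonneg {F : Type*} [NormedAddCommGroup F] [InnerProductSpace ℝ F] (h w : F) :
    0 ≤ normSecondDeriv h w := by
  refine mul_nonneg (by positivity) ?_
  rw [sub_nonneg]
  exact sq_le_sq' (by linarith [(abs_le.1 (abs_inner_normalize_le w h)).1])
    (abs_le.1 (abs_inner_normalize_le w h)).2

/-- `hᵀ Γ(z) h` is the mean of the second derivative of the distance to the observation. -/
lemma dotProduct_curvMatrix_mulVec {ν : Measure (Pt d)} [IsProbabilityMeasure ν] {z : Pt d}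
    (hz : Integrable (fun x => ‖x - z‖⁻¹) ν) (h : Pt d) :
    h ⬝ᵥ (curvMatrix ν id z).mulVec h = ∫ x, normSecondDeriv h (z - x) ∂ν := by
  have hent := fun i j => IsCentredLaw.integrable_curv_entry hz i j
  have e1 : h ⬝ᵥ (curvMatrix ν id z).mulVec h = ∫ x, ∑ i, ∑ j, h i * (‖x - z‖⁻¹ *
      ((1 : Matrix (Fin d) (Fin d) ℝ) i j - (x i - z i) * (x j - z j) / ‖x - z‖ ^ 2) * h j) ∂ν := by
    have i1 : ∀ i j, Integrable (fun x : Pt d => h i * (‖x - z‖⁻¹ *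
        ((1 : Matrix (Fin d) (Fin d) ℝ) i j - (x i - z i) * (x j - z j) / ‖x - z‖ ^ 2) * h j)) ν :=
      fun i j => ((hent i j).mul_const _).const_mul _
    rw [integral_finsetSum _ fun i _ => integrable_finsetSum _ fun j _ => i1 i j]
    simp only [dotProduct, Matrix.mulVec, Finset.mul_sum]
    refine Finset.sum_congr rfl fun i _ => ?_
    rw [integral_finsetSum _ fun j _ => i1 i j]
    refine Finset.sum_congr rfl fun j _ => ?_
    rw [integral_const_mul, integral_mul_const]
    rfl
  rw [e1]
  refine integral_congr_ae (Eventually.of_forall fun x => ?_)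
  have hin : ⟪NormedSpace.normalize (z - x), h⟫ = -(‖x - z‖⁻¹ * ∑ j, (x j - z j) * h j) := by
    rw [NormedSpace.normalize, norm_sub_rev, real_inner_smul_left, PiLp.inner_apply,
      ← mul_neg, ← Finset.sum_neg_distrib]
    congr 1
    refine Finset.sum_congr rfl fun j _ => ?_
    simp only [PiLp.sub_apply, RCLike.inner_apply, conj_trivial]
    ring
  simp only [normSecondDeriv]
  rw [hin, norm_sub_rev z x, EuclideanSpace.real_norm_sq_eq h]
  have e2 : ∀ i, ∑ j, h i * (‖x - z‖⁻¹ * ((1 : Matrix (Fin d) (Fin d) ℝ) i j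
      - (x i - z i) * (x j - z j) / ‖x - z‖ ^ 2) * h j) =
      ‖x - z‖⁻¹ * (h i ^ 2 - ((x i - z i) * h i) / ‖x - z‖ ^ 2 * ∑ j, (x j - z j) * h j) := by
    intro i
    have : h i ^ 2 = ∑ j, h i * ((1 : Matrix (Fin d) (Fin d) ℝ) i j * h j) := by
      simp [Matrix.one_apply, sq]
    rw [this, Finset.mul_sum, ← Finset.sum_sub_distrib, Finset.mul_sum]
    refine Finset.sum_congr rfl fun j _ => ?_
    ring
  simp only [e2]
  rw [← Finset.mul_sum, Finset.sum_sub_distrib, ← Finset.sum_mul, ← Finset.sum_div]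
  ring

end Curvature

/-! ### The norm along a segment -/

section Segment

open scoped RealInnerProductSpace
open NormedSpace (normalize)

variable {F : Type*} [NormedAddCommGroup F] [InnerProductSpace ℝ F]

lemma inner_normalize_eq (w h : F) : ⟪NormedSpace.normalize w, h⟫ = ‖w‖⁻¹ * ⟪w, h⟫ := by
  rw [NormedSpace.normalize, real_inner_smul_left]

lemma hasDerivAt_norm_line {v h : F} {t : ℝ} (ht : v + t • h ≠ 0) :
    HasDerivAt (fun s : ℝ => ‖v + s • h‖) ⟪NormedSpace.normalize (v + t • h), h⟫ t := by
  have hline : HasDerivAt (fun s : ℝ => v + s • h) h t := by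
    simpa using ((hasDerivAt_id t).smul_const h).const_add v
  have hn : ‖v + t • h‖ ≠ 0 := norm_ne_zero_iff.2 ht
  have hs := hline.norm_sq.sqrt (pow_ne_zero 2 hn)
  have e : (fun s : ℝ => √(‖v + s • h‖ ^ 2)) = fun s => ‖v + s • h‖ := by
    funext s; exact Real.sqrt_sq (norm_nonneg _)
  rw [e] at hs
  convert hs using 1
  rw [Real.sqrt_sq (norm_nonneg _), inner_normalize_eq]
  field_simp

lemma hasDerivAt_inner_normalize_line {v h : F} {t : ℝ} (ht : v + t • h ≠ 0) :
    HasDerivAt (fun s : ℝ => ⟪NormedSpace.normalize (v + s • h), h⟫)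
      (normSecondDeriv h (v + t • h)) t := by
  have hline : HasDerivAt (fun s : ℝ => v + s • h) h t := by
    simpa using ((hasDerivAt_id t).smul_const h).const_add v
  have hn : ‖v + t • h‖ ≠ 0 := norm_ne_zero_iff.2 ht
  have h1 : HasDerivAt (fun s : ℝ => ⟪v + s • h, h⟫) (⟪h, h⟫) t := by
    simpa using hline.inner ℝ (hasDerivAt_const t h)
  have h2 := (hasDerivAt_norm_line ht).inv hn
  have h3 := h2.mul h1
  have e : (fun s : ℝ => ⟪NormedSpace.normalize (v + s • h), h⟫) =
      (fun s : ℝ => ‖v + s • h‖)⁻¹ * fun s : ℝ => ⟪v + s • h, h⟫ := by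
    funext s; exact inner_normalize_eq _ _
  rw [e]
  refine h3.congr_deriv ?_
  simp only [normSecondDeriv, inner_normalize_eq, Pi.inv_apply, real_inner_self_eq_norm_sq]
  field_simp
  ring

lemma continuousOn_normSecondDeriv_line {v h : F} {s : Set ℝ} (hs : ∀ t ∈ s, v + t • h ≠ 0) :
    ContinuousOn (fun t : ℝ => normSecondDeriv h (v + t • h)) s := by
  have hline : Continuous fun t : ℝ => v + t • h := by fun_prop
  have hn : ContinuousOn (fun t : ℝ => ‖v + t • h‖⁻¹) s :=
    hline.norm.continuousOn.inv₀ fun t ht => norm_ne_zero_iff.2 (hs t ht)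
  simp only [normSecondDeriv, inner_normalize_eq]
  have : Continuous fun t : ℝ => ⟪v + t • h, h⟫ := hline.inner continuous_const
  exact hn.mul (continuousOn_const.sub ((hn.mul this.continuousOn).pow 2))

lemma integral_normSecondDeriv_line {v h : F} (hs : ∀ t ∈ Set.Icc (0 : ℝ) 1, v + t • h ≠ 0) :
    ∫ t in (0 : ℝ)..1, normSecondDeriv h (v + t • h) =
      ⟪NormedSpace.normalize (v + h), h⟫ - ⟪NormedSpace.normalize v, h⟫ := by
  have huIcc : Set.uIcc (0 : ℝ) 1 = Set.Icc 0 1 := Set.uIcc_of_le zero_le_one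
  have := intervalIntegral.integral_eq_sub_of_hasDerivAt (a := 0) (b := 1)
    (f := fun t : ℝ => ⟪NormedSpace.normalize (v + t • h), h⟫)
    (fun t ht => hasDerivAt_inner_normalize_line (hs t (huIcc ▸ ht)))
    (ContinuousOn.intervalIntegrable (by rw [huIcc]; exact continuousOn_normSecondDeriv_line hs))
  simpa using this

/-- Integration by parts against the affine weight `a + β (1 - t)`, for the second derivative of the
norm along the segment from `v` to `v + h`. -/
lemma integral_weight_mul_normSecondDeriv_line {v h : F}
    (hs : ∀ t ∈ Set.Icc (0 : ℝ) 1, v + t • h ≠ 0) (a β : ℝ) :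
    ∫ t in (0 : ℝ)..1, (a + β * (1 - t)) * normSecondDeriv h (v + t • h) =
      a * ⟪NormedSpace.normalize (v + h), h⟫ - (a + β) * ⟪NormedSpace.normalize v, h⟫
        + β * (‖v + h‖ - ‖v‖) := by
  have huIcc : Set.uIcc (0 : ℝ) 1 = Set.Icc 0 1 := Set.uIcc_of_le zero_le_one
  have hder : ∀ t ∈ Set.uIcc (0 : ℝ) 1, HasDerivAt
      (fun t : ℝ => (a + β * (1 - t)) * ⟪NormedSpace.normalize (v + t • h), h⟫
        + β * ‖v + t • h‖) ((a + β * (1 - t)) * normSecondDeriv h (v + t • h)) t := by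
    intro t ht
    rw [huIcc] at ht
    have hw : HasDerivAt (fun t : ℝ => a + β * (1 - t)) (-β) t := by
      simpa using (((hasDerivAt_id t).const_sub 1).const_mul β).const_add a
    have := (hw.mul (hasDerivAt_inner_normalize_line (hs t ht))).add
      ((hasDerivAt_norm_line (hs t ht)).const_mul β)
    exact this.congr_deriv (by ring)
  have hcont : ContinuousOn (fun t : ℝ => (a + β * (1 - t)) * normSecondDeriv h (v + t • h))
      (Set.uIcc 0 1) := by
    rw [huIcc]
    exact (by fun_prop : Continuous fun t : ℝ => a + β * (1 - t)).continuousOn.mul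
      (continuousOn_normSecondDeriv_line hs)
  rw [intervalIntegral.integral_eq_sub_of_hasDerivAt hder hcont.intervalIntegrable]
  simp only [one_smul, zero_smul, add_zero, sub_self, mul_zero, sub_zero, mul_one]
  ring

end Segment

/-! ### Almost every point and almost every direction is regular -/

section AlmostEvery

open scoped RealInnerProductSpace

variable {d : ℕ}

/-- In polar coordinates the integrand is `y⁻¹ y^(d-1)`, which is bounded when `d ≥ 2`. -/
lemma integrableOn_inv_norm_ball (hd : 2 ≤ d) :
    IntegrableOn (fun z : Pt d => ‖z‖⁻¹) (ball (0 : Pt d) 1) volume := by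
  have : Nontrivial (Pt d) := by
    have : Nonempty (Fin d) := ⟨⟨0, by omega⟩⟩
    infer_instance
  rw [integrableOn_fun_norm_addHaar (μ := (volume : Measure (Pt d))) (f := fun y : ℝ => y⁻¹)]
  refine Measure.integrableOn_of_bounded (M := 1) (by simp)
    (Measurable.aestronglyMeasurable (by fun_prop)) ?_
  refine (ae_restrict_iff' measurableSet_Ioo).2 (Eventually.of_forall fun y hy => ?_)
  have hfin : Module.finrank ℝ (Pt d) - 1 = (d - 2) + 1 := by
    rw [finrank_euclideanSpace_fin]; omega
  rw [hfin, smul_eq_mul, pow_succ, mul_assoc, mul_inv_cancel₀ hy.1.ne', mul_one,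
    Real.norm_of_nonneg (pow_nonneg hy.1.le _)]
  exact pow_le_one₀ hy.1.le hy.2.le

/-- The singular part of the kernel `‖x - z‖⁻¹`, truncated to the unit ball. -/
def truncKernel (z : Pt d) : ENNReal :=
  (ball (0 : Pt d) 1).indicator (fun z => ENNReal.ofReal ‖z‖⁻¹) z

lemma measurable_truncKernel : Measurable (truncKernel : Pt d → ENNReal) :=
  Measurable.indicator (by fun_prop) measurableSet_ball

lemma lintegral_truncKernel_lt_top (hd : 2 ≤ d) :
    ∫⁻ z : Pt d, truncKernel z < ⊤ := by
  unfold truncKernel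
  rw [lintegral_indicator measurableSet_ball]
  have h := (integrableOn_inv_norm_ball hd).2
  rw [hasFiniteIntegral_iff_ofReal (Eventually.of_forall fun z => by positivity)] at h
  exact h

lemma integrable_inv_norm_of_lintegral_truncKernel {ν : Measure (Pt d)} [IsProbabilityMeasure ν]
    {z : Pt d} (hz : ∫⁻ x, truncKernel (x - z) ∂ν < ⊤) :
    Integrable (fun x => ‖x - z‖⁻¹) ν := by
  refine ⟨by fun_prop, ?_⟩
  rw [hasFiniteIntegral_iff_ofReal (Eventually.of_forall fun x => by positivity)]
  have hle : ∀ x : Pt d, ENNReal.ofReal ‖x - z‖⁻¹ ≤ 1 + truncKernel (x - z) := by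
    intro x
    unfold truncKernel
    by_cases hx : x - z ∈ ball (0 : Pt d) 1
    · rw [Set.indicator_of_mem hx]; exact le_add_self
    · rw [Set.indicator_of_notMem hx, add_zero, ← ENNReal.ofReal_one]
      rw [mem_ball_zero_iff, not_lt] at hx
      exact ENNReal.ofReal_le_ofReal (inv_le_one_of_one_le₀ hx)
  refine (lintegral_mono hle).trans_lt ?_
  rw [lintegral_add_left measurable_const]
  simpa using hz

/-- By Tonelli's theorem, the inverse distance to almost every point is integrable. -/
lemma ae_lintegral_truncKernel_lt_top (hd : 2 ≤ d) (ν : Measure (Pt d)) [IsProbabilityMeasure ν] :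
    ∀ᵐ z : Pt d, ∫⁻ x, truncKernel (x - z) ∂ν < ⊤ := by
  have hm : Measurable fun p : Pt d × Pt d => truncKernel (p.2 - p.1) :=
    measurable_truncKernel.comp (by fun_prop)
  have hsym : ∀ w : Pt d, truncKernel (-w) = truncKernel w := by
    intro w
    by_cases hw : w ∈ ball (0 : Pt d) 1
    · have hw' : -w ∈ ball (0 : Pt d) 1 := by simpa using hw
      rw [truncKernel, truncKernel, Set.indicator_of_mem hw, Set.indicator_of_mem hw', norm_neg]
    · have hw' : -w ∉ ball (0 : Pt d) 1 := by simpa using hw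
      rw [truncKernel, truncKernel, Set.indicator_of_notMem hw, Set.indicator_of_notMem hw']
  refine ae_lt_top hm.lintegral_prod_right' ?_
  rw [lintegral_lintegral_swap (by exact hm.aemeasurable)]
  have : ∀ x : Pt d, ∫⁻ z : Pt d, truncKernel (x - z) = ∫⁻ z : Pt d, truncKernel z := by
    intro x
    have h1 : ∀ z : Pt d, truncKernel (x - z) = truncKernel (z - x) := by
      intro z; rw [← hsym, neg_sub]
    simp_rw [h1]
    exact lintegral_sub_right_eq_self _ x
  simp_rw [this]
  simpa using (lintegral_truncKernel_lt_top hd).ne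

/-- For almost every direction, the inverse distance to almost every point of the segment is
integrable. -/
lemma ae_ae_integrable_inv_norm_line (hd : 2 ≤ d) (ν : Measure (Pt d)) [IsProbabilityMeasure ν]
    (μ : Pt d) : ∀ᵐ h : Pt d, ∀ᵐ t : ℝ ∂(volume.restrict (Set.Ioc 0 1)),
      Integrable (fun x => ‖x - (μ + t • h)‖⁻¹) ν := by
  have hm : Measurable fun p : Pt d × Pt d => truncKernel (p.2 - p.1) :=
    measurable_truncKernel.comp (by fun_prop)
  have hgood : MeasurableSet {z : Pt d | ∫⁻ x, truncKernel (x - z) ∂ν < ⊤} :=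
    measurableSet_lt hm.lintegral_prod_right' measurable_const
  -- for a fixed `t > 0`, the map `h ↦ μ + t • h` pulls null sets back to null sets
  have key : ∀ᵐ t : ℝ ∂(volume.restrict (Set.Ioc 0 1)), ∀ᵐ h : Pt d,
      ∫⁻ x, truncKernel (x - (μ + t • h)) ∂ν < ⊤ := by
    refine (ae_restrict_iff' measurableSet_Ioc).2 (Eventually.of_forall fun t ht => ?_)
    have hae := ae_lintegral_truncKernel_lt_top hd ν
    rw [ae_iff] at hae ⊢
    have hpre : {h : Pt d | ¬ ∫⁻ x, truncKernel (x - (μ + t • h)) ∂ν < ⊤} =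
        (fun h : Pt d => t • h) ⁻¹' ((fun w => μ + w) ⁻¹'
          {z | ¬ ∫⁻ x, truncKernel (x - z) ∂ν < ⊤}) := rfl
    rw [hpre, Measure.addHaar_preimage_smul _ ht.1.ne', measure_preimage_add, hae, mul_zero]
  have hmeas : MeasurableSet {p : ℝ × Pt d | ∫⁻ x, truncKernel (x - (μ + p.1 • p.2)) ∂ν < ⊤} :=
    hgood.preimage (by fun_prop : Measurable fun p : ℝ × Pt d => μ + p.1 • p.2)
  rw [Measure.ae_ae_comm hmeas] at key
  filter_upwards [key] with h hh
  filter_upwards [hh] with t ht using integrable_inv_norm_of_lintegral_truncKernel ht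

/-- In dimension at least `2`, for almost every direction `h`, almost no observation lies on the
segment from `μ` to `μ + h`. -/
lemma ae_ae_line_ne_zero (hd : 2 ≤ d) {ν : Measure (Pt d)} [IsProbabilityMeasure ν] {μ : Pt d}
    (hν : ∀ᵐ x ∂ν, x ≠ μ) : ∀ᵐ h : Pt d, ∀ᵐ x ∂ν,
      ∀ t : ℝ, μ - x + t • h ≠ 0 := by
  have hmeas : MeasurableSet {p : Pt d × Pt d | |⟪μ - p.1, p.2⟫| ≠ ‖μ - p.1‖ * ‖p.2‖} :=
    (measurableSet_eq_fun (f := fun p : Pt d × Pt d => |⟪μ - p.1, p.2⟫|)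
      (g := fun p : Pt d × Pt d => ‖μ - p.1‖ * ‖p.2‖)
      (Continuous.measurable (by fun_prop)) (by fun_prop)).compl
  -- for a fixed `x ≠ μ`, equality in the Cauchy-Schwarz inequality puts `h` on a line, which is null
  have key : ∀ᵐ x ∂ν, ∀ᵐ h : Pt d, |⟪μ - x, h⟫| ≠ ‖μ - x‖ * ‖h‖ := by
    filter_upwards [hν] with x hx
    have hv : μ - x ≠ 0 := sub_ne_zero.2 hx.symm
    rw [ae_iff]
    have hspan : (Submodule.span ℝ {μ - x}) ≠ ⊤ := by
      intro htop
      have h1 := finrank_span_singleton (K := ℝ) hv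
      rw [htop, finrank_top, finrank_euclideanSpace_fin] at h1
      omega
    refine measure_mono_null ?_ (Measure.addHaar_submodule volume _ hspan)
    intro h hh
    simp only [Set.mem_ofPred_eq, ne_eq, not_not] at hh
    rw [SetLike.mem_coe, Submodule.mem_span_singleton]
    by_cases h0 : h = 0
    · exact ⟨0, by simp [h0]⟩
    · obtain ⟨r, -, hr⟩ := (norm_inner_eq_norm_iff (𝕜 := ℝ) hv h0).1 hh
      exact ⟨r, hr.symm⟩
  rw [Measure.ae_ae_comm hmeas] at key
  filter_upwards [key] with h hh
  filter_upwards [hh] with x hx t ht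
  refine hx ?_
  have hv : μ - x = -(t • h) := eq_neg_of_add_eq_zero_left ht
  rw [hv, inner_neg_left, abs_neg, norm_neg, real_inner_smul_left, abs_mul, norm_smul,
    real_inner_self_eq_norm_sq, abs_of_nonneg (sq_nonneg ‖h‖), Real.norm_eq_abs]
  ring

end AlmostEvery

/-! ### Strong monotonicity of the mean gradient -/

section Monotonicity

open scoped RealInnerProductSpace

variable {d : ℕ}

lemma inner_gradG_mk (x μ k : Pt d) (ρ β : ℝ) :
    ⟪gradG x (Par.mk (μ + k) (ρ + β)), Par.mk k β⟫ = ⟪μ - x, k⟫ + ‖k‖ ^ 2 + β * (ρ + β)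
      - (ρ + β) * ⟪NormedSpace.normalize (μ - x + k), k⟫ - β * ‖μ - x + k‖ := by
  have e : μ + k - x = μ - x + k := by abel
  rw [gradG_eq, Par.center_mk, Par.radius_mk, Par.inner_mk, e, inner_sub_left, inner_add_left,
    real_inner_self_eq_norm_sq, real_inner_smul_left]
  ring

/-- Along a segment which does not meet the observation, the second order Taylor expansion of the
gradient of `(‖x - z‖ - a)² / 2`, with integral remainder. -/
lemma inner_gradG_mk_eq_sub_integral {x μ k : Pt d}
    (hs : ∀ t ∈ Set.Icc (0 : ℝ) 1, μ - x + t • k ≠ 0) (ρ β : ℝ) :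
    ⟪gradG x (Par.mk (μ + k) (ρ + β)), Par.mk k β⟫ =
      ‖k‖ ^ 2 + β ^ 2 + β * ρ - ⟪x - μ, k⟫ + (ρ + 2 * β) * ⟪NormedSpace.normalize (x - μ), k⟫
        - β * ‖x - μ‖
        - ∫ t in (0 : ℝ)..1, (ρ + β + β * (1 - t)) * normSecondDeriv k (μ - x + t • k) := by
  rw [inner_gradG_mk, integral_weight_mul_normSecondDeriv_line hs, ← neg_sub x μ,
    NormedSpace.normalize_neg, inner_neg_left, inner_neg_left, norm_neg]
  ring

lemma measurable_normSecondDeriv_line (μ k : Pt d) :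
    Measurable fun p : Pt d × ℝ => normSecondDeriv k (μ - p.1 + p.2 • k) := by
  have hw : Measurable fun p : Pt d × ℝ => μ - p.1 + p.2 • k := by fun_prop
  have h1 : Measurable fun p : Pt d × ℝ => ⟪NormedSpace.normalize (μ - p.1 + p.2 • k), k⟫ :=
    (measurable_normalize.comp hw).inner_const
  unfold normSecondDeriv
  exact hw.norm.inv.mul (measurable_const.sub (h1.pow_const 2))

/-- The second derivative is nonnegative and its integral along the segment is an increment of the
first derivative, which is bounded by `2 ‖k‖`. -/
lemma integrable_prod_normSecondDeriv_line {ν : Measure (Pt d)} [IsProbabilityMeasure ν]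
    {μ k : Pt d} (hk : ∀ᵐ x ∂ν, ∀ t : ℝ, μ - x + t • k ≠ 0) :
    Integrable (fun p : Pt d × ℝ => normSecondDeriv k (μ - p.1 + p.2 • k))
      (ν.prod (volume.restrict (Set.Ioc 0 1))) := by
  have hm := measurable_normSecondDeriv_line μ k
  rw [integrable_prod_iff hm.aestronglyMeasurable]
  constructor
  · filter_upwards [hk] with x hx
    exact ((continuousOn_normSecondDeriv_line (s := Set.Icc 0 1) fun t _ => hx t).integrableOn_Icc
      ).mono_set Set.Ioc_subset_Icc_self
  · have hm' := hm.norm.stronglyMeasurable.integral_prod_right'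
      (ν := volume.restrict (Set.Ioc (0 : ℝ) 1))
    refine Integrable.of_bound hm'.aestronglyMeasurable (2 * ‖k‖) ?_
    filter_upwards [hk] with x hx
    have e : ∫ t in Set.Ioc (0 : ℝ) 1, ‖normSecondDeriv k (μ - x + t • k)‖ =
        ⟪NormedSpace.normalize (μ - x + k), k⟫ - ⟪NormedSpace.normalize (μ - x), k⟫ := by
      rw [← integral_normSecondDeriv_line fun t _ => hx t,
        intervalIntegral.integral_of_le zero_le_one]
      exact integral_congr_ae (Eventually.of_forall fun t =>
        Real.norm_of_nonneg (normSecondDeriv_nonneg _ _))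
    refine (congrArg norm e).le.trans ?_
    rw [Real.norm_eq_abs]
    refine (abs_sub _ _).trans ?_
    linarith [abs_inner_normalize_le (μ - x + k) k, abs_inner_normalize_le (μ - x) k]

lemma integrable_prod_weight_mul_normSecondDeriv_line {ν : Measure (Pt d)}
    [IsProbabilityMeasure ν] {μ k : Pt d} (hk : ∀ᵐ x ∂ν, ∀ t : ℝ, μ - x + t • k ≠ 0) (a β : ℝ) :
    Integrable (fun p : Pt d × ℝ =>
      (a + β * (1 - p.2)) * normSecondDeriv k (μ - p.1 + p.2 • k))
      (ν.prod (volume.restrict (Set.Ioc 0 1))) := by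
  refine (integrable_prod_normSecondDeriv_line hk).bdd_mul (c := |a| + |β|)
    (Measurable.aestronglyMeasurable (by fun_prop)) ?_
  have hmem : ∀ᵐ p ∂(ν.prod (volume.restrict (Set.Ioc (0 : ℝ) 1))), p.2 ∈ Set.Ioc (0 : ℝ) 1 :=
    Measure.quasiMeasurePreserving_snd.ae (ae_restrict_mem measurableSet_Ioc)
  filter_upwards [hmem] with p hp
  rw [Real.norm_eq_abs]
  refine (abs_add_le _ _).trans ?_
  rw [abs_mul]
  gcongr
  refine mul_le_of_le_one_right (abs_nonneg _) ?_
  rw [abs_le]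
  constructor <;> linarith [hp.1, hp.2]

namespace IsCentredLaw

variable {ν : Measure (Pt d)} [IsProbabilityMeasure ν] {μ : Pt d} {ρ : ℝ}

lemma continuous_integral_gradG (h : IsCentredLaw ν μ ρ) :
    Continuous fun y => ∫ x, gradG x y ∂ν := by
  refine continuous_iff_continuousAt.2 fun y₀ => ?_
  have hc : Continuous fun y : Par d => 2 * ‖y.center - μ‖ + 2 * |y.radius| := by
    have := Par.continuous_center (d := d)
    have := Par.continuous_radius (d := d)
    fun_prop
  have hnear : ∀ᶠ y in nhds y₀, 2 * ‖y.center - μ‖ + 2 * |y.radius| <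
      2 * ‖y₀.center - μ‖ + 2 * |y₀.radius| + 1 :=
    hc.continuousAt.eventually_lt continuousAt_const (lt_add_one _)
  refine continuousAt_of_dominated
    (bound := fun x => 2 * ‖x - μ‖ + (2 * ‖y₀.center - μ‖ + 2 * |y₀.radius| + 1))
    (Eventually.of_forall fun y => (h.integrable_gradG y).aestronglyMeasurable) ?_ ?_ ?_
  · filter_upwards [hnear] with y hy
    refine Eventually.of_forall fun x => (norm_gradG_le x y μ).trans ?_
    linarith
  · exact ((h.memLp_norm.integrable one_le_two).const_mul 2).add (integrable_const _)
  · filter_upwards [h.ae_ne y₀.center] with x hx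
    have hne : ‖y₀.center - x‖ ≠ 0 := norm_ne_zero_iff.2 (sub_ne_zero.2 hx.symm)
    have h1 : ContinuousAt (fun y : Par d => y.center - x) y₀ :=
      (Par.continuous_center.sub continuous_const).continuousAt
    have h2 : ContinuousAt (fun y : Par d => y.radius) y₀ := Par.continuous_radius.continuousAt
    have h3 : ContinuousAt (fun y : Par d => (y.center - x - (y.radius / ‖y.center - x‖) •
        (y.center - x), y.radius - ‖y.center - x‖)) y₀ :=
      (h1.sub ((h2.div h1.norm hne).smul h1)).prodMk (h2.sub h1.norm)
    exact Par.continuous_mk.continuousAt.comp h3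

/-- The mean gradient in a direction which is regular for the law of the observation. -/
lemma inner_integral_gradG_eq (h : IsCentredLaw ν μ ρ) {k : Pt d}
    (hk : ∀ᵐ x ∂ν, ∀ t : ℝ, μ - x + t • k ≠ 0) (β : ℝ) :
    ⟪∫ x, gradG x (Par.mk (μ + k) (ρ + β)) ∂ν, Par.mk k β⟫ =
      ‖k‖ ^ 2 + β ^ 2 + 2 * β * ⟪∫ x, NormedSpace.normalize (x - μ) ∂ν, k⟫
        - ∫ t in Set.Ioc (0 : ℝ) 1, (ρ + β + β * (1 - t)) *
            ∫ x, normSecondDeriv k (μ - x + t • k) ∂ν := by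
  have hw := integrable_prod_weight_mul_normSecondDeriv_line hk (ρ + β) β
  have i1 : Integrable (fun x => ‖x - μ‖) ν := h.memLp_norm.integrable one_le_two
  have i2 : Integrable (fun x => ⟪x - μ, k⟫) ν := h.integrable_sub.inner_const k
  have i3 : Integrable (fun x => ⟪NormedSpace.normalize (x - μ), k⟫) ν :=
    (integrable_normalize_sub μ).inner_const k
  have i4 : Integrable (fun x => ∫ t in Set.Ioc (0 : ℝ) 1, (ρ + β + β * (1 - t)) *
      normSecondDeriv k (μ - x + t • k)) ν := hw.integral_prod_left
  have e2 : ∫ x, ⟪x - μ, k⟫ ∂ν = ρ * ⟪∫ x, NormedSpace.normalize (x - μ) ∂ν, k⟫ := by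
    simp_rw [real_inner_comm k]
    rw [integral_inner h.integrable_sub, h.integral_sub, real_inner_smul_right]
  have e3 : ∫ x, ⟪NormedSpace.normalize (x - μ), k⟫ ∂ν =
      ⟪∫ x, NormedSpace.normalize (x - μ) ∂ν, k⟫ := by
    simp_rw [real_inner_comm k]
    rw [integral_inner (integrable_normalize_sub μ)]
  have e4 : ∫ x, (∫ t in Set.Ioc (0 : ℝ) 1, (ρ + β + β * (1 - t)) *
      normSecondDeriv k (μ - x + t • k)) ∂ν = ∫ t in Set.Ioc (0 : ℝ) 1, (ρ + β + β * (1 - t)) *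
            ∫ x, normSecondDeriv k (μ - x + t • k) ∂ν := by
    rw [integral_integral_swap hw]
    simp_rw [integral_const_mul]
  have e0 : ⟪∫ x, gradG x (Par.mk (μ + k) (ρ + β)) ∂ν, Par.mk k β⟫ =
      ∫ x, ((‖k‖ ^ 2 + β ^ 2 + β * ρ) - ⟪x - μ, k⟫
        + (ρ + 2 * β) * ⟪NormedSpace.normalize (x - μ), k⟫ - β * ‖x - μ‖
        - ∫ t in Set.Ioc (0 : ℝ) 1, (ρ + β + β * (1 - t)) *
          normSecondDeriv k (μ - x + t • k)) ∂ν := by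
    rw [real_inner_comm, ← integral_inner (h.integrable_gradG _)]
    refine integral_congr_ae ?_
    filter_upwards [hk] with x hx
    rw [real_inner_comm, inner_gradG_mk_eq_sub_integral fun t _ => hx t,
      intervalIntegral.integral_of_le zero_le_one]
  have j1 : Integrable (fun x => ‖k‖ ^ 2 + β ^ 2 + β * ρ - ⟪x - μ, k⟫) ν :=
    (integrable_const _).sub i2
  have j2 : Integrable (fun x => ‖k‖ ^ 2 + β ^ 2 + β * ρ - ⟪x - μ, k⟫
      + (ρ + 2 * β) * ⟪NormedSpace.normalize (x - μ), k⟫) ν := j1.add (i3.const_mul _)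
  have j3 : Integrable (fun x => ‖k‖ ^ 2 + β ^ 2 + β * ρ - ⟪x - μ, k⟫
      + (ρ + 2 * β) * ⟪NormedSpace.normalize (x - μ), k⟫ - β * ‖x - μ‖) ν :=
    j2.sub (i1.const_mul _)
  rw [e0, MeasureTheory.integral_sub j3 i4, MeasureTheory.integral_sub j2 (i1.const_mul β),
    integral_add j1 (i3.const_mul _), MeasureTheory.integral_sub (integrable_const _) i2, e4,
    e2, integral_const_mul, integral_const_mul, e3, h.integral_norm]
  simp only [integral_const, probReal_univ, one_smul]
  ring

/-- A bound on the quadratic form of the curvature on a ball makes the mean gradient strongly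
monotone with respect to the target. For almost every direction this comes from the Taylor expansion
with integral remainder; continuity gives the remaining directions. -/
lemma exists_strongly_monotone (h : IsCentredLaw ν μ ρ) (hd : 2 ≤ d) (hρ : 0 ≤ ρ)
    {Rμ Rr lam A : ℝ} (hRμ : 0 < Rμ) (hRr : 0 < Rr)
    (hlam : ∀ z ∈ closedBall μ Rμ, ∀ k : Pt d,
      k ⬝ᵥ (curvMatrix ν id z).mulVec k ≤ lam * ‖k‖ ^ 2)
    (hA : ‖∫ x, NormedSpace.normalize (x - μ) ∂ν‖ ^ 2 < A) (hA1 : A < 1)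
    (hlt : lam * (ρ + 3 / 2 * Rr) <
      1 - ‖∫ x, NormedSpace.normalize (x - μ) ∂ν‖ ^ 2 / A) :
    ∃ b : ℝ, 0 < b ∧ ∀ y : Par d, y.center ∈ closedBall μ Rμ → y.radius ∈ closedBall ρ Rr →
      b * ‖y - Par.mk μ ρ‖ ^ 2 ≤ ⟪∫ x, gradG x y ∂ν, y - Par.mk μ ρ⟫ := by
  set m := ∫ x, NormedSpace.normalize (x - μ) ∂ν with hm
  have hA0 : 0 < A := (sq_nonneg _).trans_lt hA
  set b := min (1 - A) (1 - ‖m‖ ^ 2 / A - lam * (ρ + 3 / 2 * Rr)) with hb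
  have hb1 : b ≤ 1 - A := min_le_left _ _
  have hb2 : b ≤ 1 - ‖m‖ ^ 2 / A - lam * (ρ + 3 / 2 * Rr) := min_le_right _ _
  refine ⟨b, lt_min (by linarith) (by linarith), fun y hy hyr => ?_⟩
  obtain ⟨k₀, hk₀⟩ : ∃ k, k = y.center - μ := ⟨_, rfl⟩
  obtain ⟨β, hβ⟩ : ∃ β, β = y.radius - ρ := ⟨_, rfl⟩
  have hyeq : y = Par.mk (μ + k₀) (ρ + β) := by
    rw [hk₀, hβ, add_sub_cancel, add_sub_cancel, Par.mk_center_radius]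
  have hsub : y - Par.mk μ ρ = Par.mk k₀ β := by
    rw [hyeq, Par.mk_sub_mk, add_sub_cancel_left, add_sub_cancel_left]
  have hβR : |β| ≤ Rr := by rw [hβ]; exact mem_closedBall_iff_norm.1 hyr
  have hkR : k₀ ∈ closedBall (0 : Pt d) Rμ := by
    rw [hk₀, mem_closedBall_zero_iff]; exact mem_closedBall_iff_norm.1 hy
  rw [hsub, hyeq]
  clear hsub hyeq hyr hy
  -- the inequality in almost every direction
  have hae : ∀ᵐ k : Pt d, k ∈ ball (0 : Pt d) Rμ → b * ‖Par.mk k β‖ ^ 2 ≤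
      ⟪∫ x, gradG x (Par.mk (μ + k) (ρ + β)) ∂ν, Par.mk k β⟫ := by
    filter_upwards [ae_ae_integrable_inv_norm_line hd ν μ, ae_ae_line_ne_zero hd (h.ae_ne μ)]
      with k hint hne hkball
    rw [mem_ball_zero_iff] at hkball
    rw [h.inner_integral_gradG_eq hne, Par.norm_sq_mk]
    -- the curvature is nonnegative, so `β` may be replaced by its upper bound `Rr` in the weight
    have hrem : ∫ t in Set.Ioc (0 : ℝ) 1, (ρ + β + β * (1 - t)) *
        ∫ x, normSecondDeriv k (μ - x + t • k) ∂ν ≤ lam * (ρ + 3 / 2 * Rr) * ‖k‖ ^ 2 := by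
      have hval : ∫ t in Set.Ioc (0 : ℝ) 1, (ρ + Rr + Rr * (1 - t)) * (lam * ‖k‖ ^ 2) =
          lam * (ρ + 3 / 2 * Rr) * ‖k‖ ^ 2 := by
        rw [integral_mul_const, ← intervalIntegral.integral_of_le zero_le_one]
        rw [intervalIntegral.integral_add (by simp) (Continuous.intervalIntegrable (by fun_prop) _ _),
          intervalIntegral.integral_const_mul, intervalIntegral.integral_sub (by simp) (by simp),
          integral_id]
        simp only [intervalIntegral.integral_const]
        norm_num
        ring
      rw [← hval]
      have hwint : Integrable (fun t : ℝ => (ρ + β + β * (1 - t)) *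
          ∫ x, normSecondDeriv k (μ - x + t • k) ∂ν) (volume.restrict (Set.Ioc 0 1)) := by
        have := (integrable_prod_weight_mul_normSecondDeriv_line hne (ρ + β) β).integral_prod_right
        simpa only [integral_const_mul] using this
      have hcint : Integrable (fun t : ℝ => (ρ + Rr + Rr * (1 - t)) * (lam * ‖k‖ ^ 2))
          (volume.restrict (Set.Ioc 0 1)) :=
        (Continuous.integrableOn_Icc (by fun_prop)).mono_set Set.Ioc_subset_Icc_self
      refine integral_mono_ae hwint hcint ?_
      filter_upwards [hint, ae_restrict_mem measurableSet_Ioc] with t hti ht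
      have hz : μ + t • k ∈ closedBall μ Rμ := by
        rw [mem_closedBall_iff_norm, add_sub_cancel_left, norm_smul, Real.norm_of_nonneg ht.1.le]
        exact (mul_le_of_le_one_left (norm_nonneg _) ht.2).trans hkball.le
      have e : ∫ x, normSecondDeriv k (μ - x + t • k) ∂ν =
          k ⬝ᵥ (curvMatrix ν id (μ + t • k)).mulVec k := by
        rw [dotProduct_curvMatrix_mulVec hti]
        refine integral_congr_ae (Eventually.of_forall fun x => ?_)
        simp only [add_sub_right_comm]
      have hnn : 0 ≤ ∫ x, normSecondDeriv k (μ - x + t • k) ∂ν :=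
        integral_nonneg fun x => normSecondDeriv_nonneg _ _
      have hle : ∫ x, normSecondDeriv k (μ - x + t • k) ∂ν ≤ lam * ‖k‖ ^ 2 :=
        e ▸ hlam _ hz k
      have hweight : ρ + β + β * (1 - t) ≤ ρ + Rr + Rr * (1 - t) := by
        have h1 := (abs_le.1 hβR).2
        have h2 := mul_le_mul_of_nonneg_right h1 (sub_nonneg.2 ht.2)
        linarith
      have hpos : 0 ≤ ρ + Rr + Rr * (1 - t) := by
        have := mul_nonneg hRr.le (sub_nonneg.2 ht.2)
        linarith
      exact (mul_le_mul_of_nonneg_right hweight hnn).trans (mul_le_mul_of_nonneg_left hle hpos)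
    -- Young's inequality with weight `A`
    have hcross : -(A * β ^ 2 + ‖m‖ ^ 2 / A * ‖k‖ ^ 2) ≤ 2 * β * ⟪m, k⟫ := by
      have h1 : |⟪m, k⟫| ≤ ‖m‖ * ‖k‖ := abs_real_inner_le_norm m k
      have h2 : 0 ≤ A⁻¹ * (A * β + ⟪m, k⟫) ^ 2 := by positivity
      have h3 : A⁻¹ * (A * β + ⟪m, k⟫) ^ 2 = A * β ^ 2 + 2 * β * ⟪m, k⟫ + ⟪m, k⟫ ^ 2 / A := by
        field_simp
        ring
      have h4 : ⟪m, k⟫ ^ 2 / A ≤ ‖m‖ ^ 2 / A * ‖k‖ ^ 2 := by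
        rw [div_mul_eq_mul_div, ← mul_pow, ← sq_abs ⟪m, k⟫]
        gcongr
      linarith
    have h5 := mul_le_mul_of_nonneg_right hb1 (sq_nonneg β)
    have h6 := mul_le_mul_of_nonneg_right hb2 (sq_nonneg ‖k‖)
    linarith
  -- extension by continuity
  have hcl : IsClosed {k : Pt d | b * ‖Par.mk k β‖ ^ 2 ≤
      ⟪∫ x, gradG x (Par.mk (μ + k) (ρ + β)) ∂ν, Par.mk k β⟫} := by
    have c1 : Continuous fun k : Pt d => Par.mk k β :=
      Par.continuous_mk.comp (by fun_prop : Continuous fun k : Pt d => (k, β))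
    have c2 : Continuous fun k : Pt d => Par.mk (μ + k) (ρ + β) :=
      Par.continuous_mk.comp (by fun_prop : Continuous fun k : Pt d => (μ + k, ρ + β))
    exact isClosed_le (by fun_prop) ((h.continuous_integral_gradG.comp c2).inner c1)
  have hdense := (Measure.dense_of_ae hae).open_subset_closure_inter
    (isOpen_ball (x := (0 : Pt d)) (ε := Rμ))
  have hsub : ball (0 : Pt d) Rμ ⊆ {k : Pt d | b * ‖Par.mk k β‖ ^ 2 ≤
      ⟪∫ x, gradG x (Par.mk (μ + k) (ρ + β)) ∂ν, Par.mk k β⟫} :=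
    hdense.trans (closure_minimal (fun k hk => hk.2 hk.1) hcl)
  rw [← closure_ball (0 : Pt d) hRμ.ne'] at hkR
  exact closure_minimal hsub hcl hkR

end IsCentredLaw

end Monotonicity

/-! ### The truncated sphere model -/

section Model

open scoped RealInnerProductSpace

variable {d : ℕ} {Ω₀ : Type*} [MeasurableSpace Ω₀] {P₀ : Measure Ω₀} {X : Ω₀ → Pt d} {μ : Pt d}
  {r : ℝ} {W : Ω₀ → ℝ} {S : Set (sphere (0 : Pt d) 1)} {U : Ω₀ → sphere (0 : Pt d) 1}

namespace IsTruncatedSphereModel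

lemma measurable (hm : IsTruncatedSphereModel P₀ X μ r W S U) : Measurable X := by
  have hU : Measurable fun ω => (U ω : Pt d) := measurable_subtype_coe.comp hm.measurable_U
  rw [funext hm.eq_X]
  exact ((hm.measurable_W.const_mul r).smul hU).const_add μ

lemma ae_norm_sub (hm : IsTruncatedSphereModel P₀ X μ r W S U) :
    ∀ᵐ ω ∂P₀, ‖X ω - μ‖ = r * W ω := by
  filter_upwards [hm.W_pos] with ω hω
  rw [hm.eq_X, add_sub_cancel_left, norm_smul, norm_eq_of_mem_sphere, mul_one,
    Real.norm_of_nonneg (mul_pos hm.r_pos hω).le]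

lemma ae_normalize_sub (hm : IsTruncatedSphereModel P₀ X μ r W S U) :
    ∀ᵐ ω ∂P₀, NormedSpace.normalize (X ω - μ) = U ω := by
  filter_upwards [hm.W_pos] with ω hω
  rw [hm.eq_X, add_sub_cancel_left, NormedSpace.normalize_smul_of_pos (mul_pos hm.r_pos hω),
    NormedSpace.normalize_eq_self_of_norm_eq_one (norm_eq_of_mem_sphere _)]

lemma rStar_nonneg (hm : IsTruncatedSphereModel P₀ X μ r W S U) : 0 ≤ rStar P₀ r W :=
  mul_nonneg hm.r_pos.le (integral_nonneg_of_ae (hm.W_pos.mono fun _ hω => hω.le))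

lemma integral_normalize_map (hm : IsTruncatedSphereModel P₀ X μ r W S U) :
    ∫ x, NormedSpace.normalize (x - μ) ∂(P₀.map X) = ∫ ω, (U ω : Pt d) ∂P₀ := by
  have hmeas : Measurable fun x : Pt d => NormedSpace.normalize (x - μ) :=
    measurable_normalize.comp (measurable_id.sub_const μ)
  rw [integral_map hm.measurable.aemeasurable hmeas.aestronglyMeasurable]
  exact integral_congr_ae hm.ae_normalize_sub

/-- The law of the truncated sphere model: independence of `W` and `U` gives
`𝔼[X - μ] = r 𝔼[W] 𝔼[U]`, and `U` is the direction of `X - μ`. -/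
lemma isCentredLaw (hm : IsTruncatedSphereModel P₀ X μ r W S U) (hA1 : A1 P₀ X μ)
    (hA2 : A2 P₀ X μ) : IsCentredLaw (P₀.map X) μ (rStar P₀ r W) where
  noAtom z := by
    rw [Measure.map_apply hm.measurable (measurableSet_singleton z)]
    -- `X = z` forces `W = ‖z - μ‖ / r`
    refine measure_mono_null (t := {ω | ¬ ‖X ω - μ‖ = r * W ω} ∪ W ⁻¹' {‖z - μ‖ / r}) ?_
      (measure_union_null hm.ae_norm_sub (hm.W_continuous _))
    intro ω hω
    by_cases hn : ‖X ω - μ‖ = r * W ω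
    · right
      rw [Set.mem_preimage, Set.mem_singleton_iff] at hω ⊢
      rw [← hω, hn, mul_div_cancel_left₀ _ hm.r_pos.ne']
    · exact Or.inl hn
  integrable_sq :=
    (integrable_map_measure (Measurable.aestronglyMeasurable (by fun_prop))
      hm.measurable.aemeasurable).2 hA2
  integrable_inv_sq :=
    (integrable_map_measure (Measurable.aestronglyMeasurable (by fun_prop))
      hm.measurable.aemeasurable).2 hA1
  integral_norm := by
    rw [integral_map hm.measurable.aemeasurable (Measurable.aestronglyMeasurable (by fun_prop)),
      integral_congr_ae hm.ae_norm_sub, integral_const_mul, rStar]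
  integral_sub := by
    have hU : Measurable fun ω => (U ω : Pt d) := measurable_subtype_coe.comp hm.measurable_U
    have hind : IndepFun (fun ω => r * W ω) (fun ω => (U ω : Pt d)) P₀ :=
      hm.indep.comp (measurable_const_mul r) measurable_subtype_coe
    rw [hm.integral_normalize_map, integral_map hm.measurable.aemeasurable
      (Measurable.aestronglyMeasurable (by fun_prop))]
    simp only [hm.eq_X, add_sub_cancel_left]
    rw [hind.integral_fun_smul_eq_smul_integral
      (hm.measurable_W.const_mul r).aestronglyMeasurable hU.aestronglyMeasurable,
      integral_const_mul, rStar]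

end IsTruncatedSphereModel

lemma curvMatrix_map_id (hX : Measurable X) (z : Pt d) :
    curvMatrix (P₀.map X) id z = curvMatrix P₀ X z := by
  ext i j
  exact integral_map hX.aemeasurable (Measurable.aestronglyMeasurable (by
    simp only [id]; fun_prop))

lemma meanDirection_map_id (hX : Measurable X) (z : Pt d) :
    meanDirection (P₀.map X) id z = meanDirection P₀ X z := by
  ext i j
  exact integral_map hX.aemeasurable (Measurable.aestronglyMeasurable (by
    simp only [id]; fun_prop))

lemma hessian_map_id (hX : Measurable X) (z : Pt d) (a : ℝ) :
    hessian (P₀.map X) id z a = hessian P₀ X z a := by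
  rw [hessian, hessian, curvMatrix_map_id hX, meanDirection_map_id hX]

lemma measurable_gradG_left (y : Par d) : Measurable fun x => gradG x y :=
  measurable_gradG.of_uncurry_right

lemma gradCov_map_id (hX : Measurable X) (y : Par d) :
    gradCov (P₀.map X) id y = gradCov P₀ X y := by
  ext i j
  have hm : ∀ i, Measurable fun x => gradG x y i := fun i =>
    (EuclideanSpace.proj (𝕜 := ℝ) i).continuous.measurable.comp (measurable_gradG_left y)
  exact integral_map hX.aemeasurable ((hm i).mul (hm j)).aestronglyMeasurable

end Model

/-! ### The asymptotic covariance -/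

section Covariance

open scoped RealInnerProductSpace

variable {d : ℕ} {ν : Measure (Pt d)} [IsProbabilityMeasure ν] {μ : Pt d} {ρ : ℝ}

lemma isHermitian_gradCov (ν : Measure (Pt d)) (y : Par d) : (gradCov ν id y).IsHermitian := by
  ext i j
  simp only [Matrix.conjTranspose_apply, gradCov, Matrix.of_apply, star_trivial]
  exact integral_congr_ae (Eventually.of_forall fun x => mul_comm _ _)

namespace IsCentredLaw

lemma memLp_gradG (h : IsCentredLaw ν μ ρ) (y : Par d) : MemLp (fun x => gradG x y) 2 ν := by
  have hM : MemLp (fun x => 2 * ‖x - μ‖ + (2 * ‖y.center - μ‖ + 2 * |y.radius|)) 2 ν :=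
    (h.memLp_norm.const_mul 2).add (memLp_const _)
  refine hM.mono' (measurable_gradG_left y).aestronglyMeasurable
    (Eventually.of_forall fun x => ?_)
  linarith [norm_gradG_le x y μ]

lemma dotProduct_gradCov_mulVec (h : IsCentredLaw ν μ ρ) (y : Par d) (t : Fin d ⊕ Unit → ℝ) :
    t ⬝ᵥ (gradCov ν id y).mulVec t = ∫ x, (gradG x y ⬝ᵥ t) ^ 2 ∂ν := by
  have hcoord : ∀ i, MemLp (fun x => gradG x y i) 2 ν := fun i => (h.memLp_gradG y).eval_piLp i
  have i1 : ∀ i j, Integrable (fun x => t i * (gradG x y i * gradG x y j * t j)) ν := fun i j =>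
    (((hcoord i).integrable_mul (hcoord j)).mul_const _).const_mul _
  have e : ∀ x, (gradG x y ⬝ᵥ t) ^ 2 = ∑ i, ∑ j, t i * (gradG x y i * gradG x y j * t j) := by
    intro x
    rw [dotProduct, sq, Finset.sum_mul_sum]
    refine Finset.sum_congr rfl fun i _ => Finset.sum_congr rfl fun j _ => by ring
  simp_rw [e]
  rw [integral_finsetSum _ fun i _ => integrable_finsetSum _ fun j _ => i1 i j]
  simp only [dotProduct, Matrix.mulVec, Finset.mul_sum]
  refine Finset.sum_congr rfl fun i _ => ?_
  rw [integral_finsetSum _ fun j _ => i1 i j]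
  refine Finset.sum_congr rfl fun j _ => ?_
  rw [integral_const_mul, integral_mul_const]
  rfl

lemma posSemidef_gradCov (h : IsCentredLaw ν μ ρ) (y : Par d) : (gradCov ν id y).PosSemidef := by
  refine Matrix.PosSemidef.of_dotProduct_mulVec_nonneg (isHermitian_gradCov ν y) fun t => ?_
  rw [star_trivial, h.dotProduct_gradCov_mulVec]
  exact integral_nonneg fun x => sq_nonneg _

/-- The covariance of the image of the gradient by a symmetric matrix. -/
lemma integral_inner_sq (h : IsCentredLaw ν μ ρ) (y : Par d)
    {T : Matrix (Fin d ⊕ Unit) (Fin d ⊕ Unit) ℝ} (hT : T.IsHermitian) (t : Par d) :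
    ∫ x, ⟪Matrix.toEuclideanCLM (𝕜 := ℝ) T (gradG x y), t⟫ ^ 2 ∂ν =
      t ⬝ᵥ (T * gradCov ν id y * T).mulVec t := by
  have hT' : T.transpose = T := by
    rw [← Matrix.conjTranspose_eq_transpose_of_trivial]; exact hT
  have e : ∀ x, ⟪Matrix.toEuclideanCLM (𝕜 := ℝ) T (gradG x y), t⟫ = gradG x y ⬝ᵥ T.mulVec t := by
    intro x
    rw [EuclideanSpace.inner_eq_star_dotProduct, star_trivial, Matrix.ofLp_toEuclideanCLM,
      ← Matrix.dotProduct_transpose_mulVec, hT']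
  simp_rw [e]
  rw [← h.dotProduct_gradCov_mulVec, ← Matrix.mulVec_mulVec, ← Matrix.mulVec_mulVec]
  rw [Matrix.dotProduct_mulVec t T, ← Matrix.mulVec_transpose, hT']

end IsCentredLaw

end Covariance

end SphereFit

end

theorem theorem4p4 {d : ℕ} (hd : 2 ≤ d)
    -- the observed random vector `X = μ + r W U`
    {Ω₀ : Type*} [MeasurableSpace Ω₀] (P₀ : Measure Ω₀) [IsProbabilityMeasure P₀]
    (X : Ω₀ → SphereFit.Pt d) (μ : SphereFit.Pt d) (r : ℝ) (W : Ω₀ → ℝ)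
    (S : Set (sphere (0 : SphereFit.Pt d) 1)) (U : Ω₀ → sphere (0 : SphereFit.Pt d) 1)
    (hmodel : SphereFit.IsTruncatedSphereModel P₀ X μ r W S U)
    -- the assumptions
    (Rμ Rr : ℝ)
    (hA1 : SphereFit.A1 P₀ X μ) (hA2 : SphereFit.A2 P₀ X μ)
    (hA3 : SphereFit.A3 P₀ X μ r W U Rμ Rr) (hA4 : SphereFit.A4 P₀ X μ r W)
    (hmoment : Integrable (fun ω => ‖X ω - μ‖ ^ 12) P₀)
    -- the compact convex set and the projection
    (K : Set (SphereFit.Par d)) (hK_compact : IsCompact K) (hK_convex : Convex ℝ K)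
    (hK_pos : ∀ y ∈ K, 0 < y.radius)
    (hK_ball : ∀ y ∈ K, y.center ∈ closedBall μ Rμ ∧
      y.radius ∈ closedBall (SphereFit.rStar P₀ r W) Rr)
    (hθ : SphereFit.theta P₀ μ r W ∈ interior K)
    (π : SphereFit.Par d → SphereFit.Par d) (hπ : SphereFit.IsProjectionOnto K π)
    -- the step sequence
    (cγ α : ℝ) (hcγ : 0 < cγ) (hα : α ∈ Set.Ioo (1 / 2 : ℝ) 1)
    (γ : ℕ → ℝ) (hγ : ∀ n : ℕ, 1 ≤ n → γ n = cγ * (n : ℝ) ^ (-α))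
    -- the sample `(X_n)`, `n ≥ 1`, and the starting point
    {Ω : Type*} [MeasurableSpace Ω] (P : Measure Ω) [IsProbabilityMeasure P]
    (Xs : ℕ → Ω → SphereFit.Pt d) (hXs_meas : ∀ n, Measurable (Xs n))
    (hXs_indep : iIndepFun (fun n : ℕ => Xs (n + 1)) P)
    (hXs_law : ∀ n : ℕ, 1 ≤ n → IdentDistrib (Xs n) X P P₀)
    (start : Ω → SphereFit.Par d) (hstart_meas : Measurable start) (hstart : ∀ ω, start ω ∈ K)
    (hstart_indep : IndepFun start (fun ω (n : ℕ) => Xs (n + 2) ω) P) :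
    (SphereFit.limitCov P₀ X μ r W).PosSemidef ∧
    TendstoInDistribution
      (fun (n : ℕ) ω =>
        Real.sqrt n • (SphereFit.prmAvg π γ Xs start n ω - SphereFit.theta P₀ μ r W))
      atTop id (fun _ => P) (multivariateGaussian 0 (SphereFit.limitCov P₀ X μ r W)) := by
  have hX := hmodel.measurable
  have hν : IsProbabilityMeasure (P₀.map X) := Measure.isProbabilityMeasure_map hX.aemeasurable
  have hlaw := hmodel.isCentredLaw hA1 hA2
  set ρ := SphereFit.rStar P₀ r W with hρ
  have hρ0 : 0 ≤ ρ := hmodel.rStar_nonneg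
  obtain ⟨hRμ, hRr, A, hA, hA1', hsup⟩ := hA3
  obtain ⟨lam, hlam1, hlam2⟩ := EReal.lt_iff_exists_real_btwn.1 hsup
  rw [← hmodel.integral_normalize_map] at hA hlam2
  have hlam2' := EReal.coe_lt_coe_iff.1 hlam2
  rw [lt_div_iff₀ (by positivity)] at hlam2'
  have hlam : ∀ z ∈ closedBall μ Rμ, ∀ k : SphereFit.Pt d,
      k ⬝ᵥ (SphereFit.curvMatrix (P₀.map X) id z).mulVec k ≤ lam * ‖k‖ ^ 2 := by
    intro z hz k
    refine (SphereFit.dotProduct_mulVec_le_lambdaMax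
      (SphereFit.isHermitian_curvMatrix _ _ _) k).trans ?_
    rw [SphereFit.curvMatrix_map_id hX]
    refine mul_le_mul_of_nonneg_right ?_ (sq_nonneg _)
    exact EReal.coe_le_coe_iff.1 ((le_iSup₂ (f := fun z (_ : z ∈ closedBall μ Rμ) =>
      (SphereFit.lambdaMax (SphereFit.curvMatrix P₀ X z) : EReal)) z hz).trans hlam1.le)
  obtain ⟨b, hb, hmono⟩ := hlaw.exists_strongly_monotone hd hρ0 hRμ hRr hlam hA hA1' hlam2'
  have hbound : ∀ y ∈ K, 2 * ‖y.center - μ‖ + 2 * |y.radius| ≤ 2 * Rμ + 2 * (ρ + Rr) := by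
    intro y hy
    have h1 := mem_closedBall_iff_norm.1 (hK_ball y hy).1
    have h2 := mem_closedBall_iff_norm.1 (hK_ball y hy).2
    rw [Real.norm_eq_abs] at h2
    have h3 := (abs_le.1 h2).2
    rw [abs_of_pos (hK_pos y hy)]
    linarith
  have hfield := hlaw.isRegularField hb hbound
    fun y hy => hmono y (hK_ball y hy).1 (hK_ball y hy).2
  set H := SphereFit.hessian P₀ X μ ρ with hH
  rw [SphereFit.hessian_map_id hX, ← hH] at hfield
  have hHpd : H.PosDef := hA4
  have hdet : IsUnit H.det := (Matrix.isUnit_iff_isUnit_det _).1 hHpd.isUnit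
  have hHinv : (H⁻¹).IsHermitian := hHpd.isHermitian.inv
  have hcov : SphereFit.limitCov P₀ X μ r W =
      H⁻¹ * SphereFit.gradCov (P₀.map X) id (SphereFit.Par.mk μ ρ) * H⁻¹ := by
    rw [SphereFit.gradCov_map_id hX]; rfl
  have hpsd : (SphereFit.limitCov P₀ X μ r W).PosSemidef := by
    have := (hlaw.posSemidef_gradCov (SphereFit.Par.mk μ ρ)).mul_mul_conjTranspose_same H⁻¹
    rw [hHinv.eq] at this
    rwa [hcov]
  refine ⟨hpsd, ?_⟩
  have hγ' : ∀ k : ℕ, γ (k + 1) = SphereFit.stepSize cγ α k := fun k => by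
    rw [hγ _ (Nat.le_add_left 1 k), SphereFit.stepSize, Nat.cast_add_one]
  have halg : SphereFit.IsProjectedAlgorithm P SphereFit.gradG (P₀.map X) K
      {y | 0 < y.radius} (SphereFit.Par.mk μ ρ) π (SphereFit.stepSize cγ α)
      (fun k => Xs (k + 2)) (fun k => SphereFit.prm π γ Xs start (k + 1)) :=
    { isCompact := hK_compact
      mem_interior := hθ
      subset := hK_pos
      measurable_proj := hπ.measurable
      proj_mem := hπ.mem
      proj_fix := hπ.fix
      proj_nonexpansive := fun y hy y' hy' => hπ.nonexpansive y y' hy hy'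
      step_mem := by
        -- once the step is below `1` the new radius is a convex combination of the old one and of
        -- the distance to the observation
        have hlim : Tendsto (SphereFit.stepSize cγ α) atTop (nhds 0) := by
          have := (SphereFit.tendsto_succ_rpow_neg (lt_trans (by norm_num) hα.1)).const_mul cγ
          rwa [mul_zero] at this
        filter_upwards [hlim.eventually_lt_const one_pos] with k hk x y hy
        have h0 : 0 ≤ SphereFit.stepSize cγ α k := by unfold SphereFit.stepSize; positivity
        have hy0 := hK_pos y hy
        have e : (y - SphereFit.stepSize cγ α k • SphereFit.gradG x y).radius =
            (1 - SphereFit.stepSize cγ α k) * y.radius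
              + SphereFit.stepSize cγ α k * ‖y.center - x‖ := by
          rw [SphereFit.Par.radius_sub, SphereFit.Par.radius_smul, SphereFit.gradG,
            SphereFit.Par.radius_mk]
          ring
        have := mul_pos (sub_pos.2 hk) hy0
        exact (add_pos_of_pos_of_nonneg this (mul_nonneg h0 (norm_nonneg _))).trans_eq e.symm
      measurable_obs := fun k => hXs_meas _
      map_obs := fun k => (hXs_law (k + 2) (by omega)).map_eq
      indep_obs := hXs_indep.precomp (g := fun k => k + 1) (add_left_injective 1)
      measurable_start := hstart_meas
      start_mem := hstart
      indep_start := hstart_indep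
      succ := fun k ω => by rw [← hγ']; rfl }
  have hmain := SphereFit.IsProjectedAlgorithm.tendstoInDistribution_average hcγ hα.1 hα.2 hfield
    halg (Matrix.toEuclideanCLM (𝕜 := ℝ) H⁻¹)
    (fun y => by
      rw [← mul_apply_eq_comp, ← map_mul, Matrix.nonsing_inv_mul _ hdet, map_one]
      rfl) hpsd
    (fun t => by rw [hlaw.integral_inner_sq _ hHinv, hcov])
  have havg : ∀ (n : ℕ) (ω : Ω), SphereFit.prmAvg π γ Xs start n ω =
      (n : ℝ)⁻¹ • ∑ k ∈ Finset.range n, SphereFit.prm π γ Xs start (k + 1) ω := by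
    intro n ω
    rw [SphereFit.prmAvg, Finset.range_eq_Ico,
      Finset.sum_Ico_add' (fun k => SphereFit.prm π γ Xs start k ω) 0 n 1]
    rfl
  simp_rw [havg]
  exact hmain
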